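/- Conventions. Let $\Bbbk$ be $\mathbb R$ or $\mathbb C$. Manifolds are smooth, finite-dimensional and without boundary; $M$ and $N$ are Hausdorff manifolds, while the manifolds $G$, $H$, $P$ below need not be Hausdorff, and no manifold is assumed to be second countable. $\mathcal C^\infty_c(M)$ is the (not necessarily unital) algebra of $\Bbbk$-valued smooth functions with compact support. Write $R=\mathcal C^\infty_c(M)$ and $R'=\mathcal C^\infty_c(N)$. All modules are locally unitary. A left $R$-coalgebra is a left $R$-module $C$ with $R$-linear maps $\Delta\colon C\to C\otimes_R C$ and $\epsilon\colon C\to R$ that are coassociative and counital. Hopf algebroids. An $R$-bialgebroid is an algebra $A$ containing $R$ as a commutative subalgebra with local identities for $A$ (every finite subset of $A$ has a two-sided identity in $R$), with a structure of a left $R$-coalgebra such that: $\epsilon|_R=\mathrm{id}$, and $\Delta|_R$ is the canonical embedding, $\Delta(u)=u\otimes e$ for $u,e\in R$ with $eu=u$; on the image of $\Delta$ in the tensor product $A\otimes_R A$ of left $R$-modules the two right $R$-actions coincide; $\epsilon(ab)=\epsilon(a\,\epsilon(b))$; and $\Delta(ab)=\Delta(a)\Delta(b)$ (componentwise product). It is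 a Hopf $R$-algebroid if it has a linear involution $S\colon A\to A$ with $S|_R=\mathrm{id}$, $S(ab)=S(b)S(a)$ and $\mu_A\circ(S\otimes\mathrm{id})\circ\Delta=\epsilon\circ S$, where $\mu_A$ is the multiplication. Bimodules. Let $A$ be a Hopf $R$-algebroid and $B$ a Hopf $R'$-algebroid. A preprincipal $A$-$B$-bimodule is a locally unitary $A$-$B$-bimodule $\mathcal M$ with a structure of a left $R$-coalgebra such that on $\Delta(\mathcal M)\subset \mathcal M\otimes_R \mathcal M$ the two right $R'$-actions coincide, $\epsilon(mb)=\epsilon(m\,\epsilon(b))$, $\epsilon(am)=\epsilon(a\,\epsilon(m))$, $\Delta(am)=\Delta(a)\Delta(m)$ and $\Delta(mb)=\Delta(m)\Delta(b)$. It is principal if $\epsilon\colon\mathcal M\to R$ is surjective and the map $\mathcal M\otimes_{R'}B\to \mathcal M\otimes_R\mathcal M$, $m\otimes b\mapsto\Delta(m)(v\otimes b)$ with $v\in R'$, $vb=b$, is an isomorphism. Local structure. For a left $R$-coalgebra $C$ and $x\in M$, let $C_x$ be the quotient of $C$ by the elements annihilated by some $u\in R$ with germ $1$ at $x$; it is a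 coalgebra over the ring of germs at $x$ of smooth functions. Write $c_x$ for the class of $c$, and $G(C_x)$ for the set of grouplike elements of $C_x$ ($\Delta(\zeta)=\zeta\otimes\zeta$, $\epsilon(\zeta)=1$). An element $c\in C$ is weakly grouplike if $\Delta(c)=c\otimes c'$ for some $c'\in C$, and normalised on an open set $W\subset M$ if $\epsilon(c)=1$ on $W$. The spectral sheaf $\pi\colon E_{sp}(C)\to M$ has stalk $G(C_x)$ over $x$; its topology is generated by the sets $c_W=\{c_x : x\in W\}$, where $c$ is weakly grouplike and normalised on the open set $W$. The coalgebra $C$ is locally grouplike if each $C_x$ is freely generated, as a module over the germs at $x$, by $G(C_x)$. An element $a$ of a Hopf $R$-algebroid $A$ is $S$-invariant weakly grouplike if, for some $a'\in A$, $\Delta(a)=a\otimes a'$ and $\Delta(S(a))=S(a')\otimes S(a)$; let $G^S(A_y)$ be the set of the classes $a_y$ of such elements $a$ that are normalised on a neighbourhood of $y$. The Hopf algebroid $A$ is locally grouplike if each $A_y$ is freely generated by $G^S(A_y)$. Spectral groupoid. The spectral étale groupoid of a locally grouplike Hopf $R$-algebroid $A$ is the étale Lie groupoid $G$ over $G_0=M$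 with space of arrows $E_{sp}(A)$, every arrow being of the form $g=a_y$ with $a$ $S$-invariant weakly grouplike and normalised on an open neighbourhood $W$ of $y$; the target of $a_y$ is $y$ and its source is $\tau^{-1}(y)$, where $\tau$ is a diffeomorphism from an open subset of $M$ onto $W$ with $ua=a(u\circ\tau)$ for all $u\in R$ with support in $W$ ($u\circ\tau$ being extended by $0$); the product of composable arrows is $a'_{y'}a_y=(a'a)_{y'}$, the unit at $x$ is $u_x$ for $u\in R$ with germ $1$ at $x$, and the inverse of $a_y$ is the class of $S(a)$ at the source of $a_y$. Principal bundles. A principal $H$-bundle over $G$, for étale Lie groupoids $G$ and $H$, is a manifold $P$ with a surjective submersion $\pi\colon P\to G_0$, a smooth map $\phi\colon P\to H_0$, a smooth left action of $G$ on $P$ along $\pi$ and a smooth right action of $H$ on $P$ along $\phi$ such that $\phi(g\cdot p)=\phi(p)$, $\pi(p\cdot h)=\pi(p)$, $(g\cdot p)\cdot h=g\cdot(p\cdot h)$, and $P\times_{H_0}H\to P\times_{G_0}P$, $(p,h)\mapsto(p,p\cdot h)$, is a diffeomorphism. Proposition. Let $A$ be a locally grouplike Hopf $\mathcal C^\infty_c(M)$-algebroid,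 $B$ a locally grouplike Hopf $\mathcal C^\infty_c(N)$-algebroid, and let $\mathcal M$ be a principal $A$-$B$-bimodule which is locally grouplike as a left $\mathcal C^\infty_c(M)$-coalgebra. Then the spectral étale groupoids $G$ of $A$ and $H$ of $B$ exist and are unique. The spectral sheaf $P=E_{sp}(\mathcal M)$ is a smooth manifold, with the charts for which $\pi\colon P\to M=G_0$ is a local diffeomorphism. There is exactly one structure of a principal $H$-bundle over $G$ on $P$ such that * its projection to $G_0$ is $\pi$; * its moment map $\phi\colon P\to N=H_0$ satisfies $\epsilon(mv)(x)=v(\phi(m_x))$ for all $v\in\mathcal C^\infty_c(N)$; * the action of $G$ is $g\cdot m_x=(am)_y$ for $g=a_y\in G$ with source $x$; * the action of $H$ is $m_x\cdot h=(mb)_x$ for $h=b_z\in H$ with target $z=\phi(m_x)$. Here $m$ is any weakly grouplike element of $\mathcal M$ normalised on a neighbourhood of $x$, and $a\in A$, $b\in B$ are any $S$-invariant weakly grouplike elements normalised on neighbourhoods of $y$ and $z$, respectively. In particular, $\phi$ and the two actions are well-defined and smooth. -/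

import Mathlib

open Set Filter Topology
open scoped Manifold ContDiff TensorProduct

noncomputable section

/-! ### Smooth functions with compact support and their germs -/

section Functions

theorem contMDiffAt_mul {𝕜 : Type*} [RCLike 𝕜]
    {E : Type*} [NormedAddCommGroup E] [NormedSpace ℝ E]
    {M : Type*} [TopologicalSpace M] [ChartedSpace E M] {f g : M → 𝕜} {x : M}
    (hf : ContMDiffAt 𝓘(ℝ, E) 𝓘(ℝ, 𝕜) ∞ f x) (hg : ContMDiffAt 𝓘(ℝ, E) 𝓘(ℝ, 𝕜) ∞ g x) :
    ContMDiffAt 𝓘(ℝ, E) 𝓘(ℝ, 𝕜) ∞ (f * g) x :=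
  (contDiff_mul (𝕜 := ℝ) (𝔸 := 𝕜) (n := ∞)).contMDiff.contMDiffAt.comp x (hf.prodMk_space hg)

variable (𝕜 : Type*) [RCLike 𝕜]
  (E : Type*) [NormedAddCommGroup E] [NormedSpace ℝ E]
  (M : Type*) [TopologicalSpace M] [ChartedSpace E M]

/-- The commutative (in general non-unital) algebra of smooth `𝕜`-valued functions with compact
support on the Hausdorff manifold `M`. -/
def Cc : NonUnitalSubalgebra 𝕜 (M → 𝕜) where
  carrier := {f | ContMDiff 𝓘(ℝ, E) 𝓘(ℝ, 𝕜) ∞ f ∧ HasCompactSupport f}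
  add_mem' hf hg := ⟨hf.1.add hg.1, hf.2.add hg.2⟩
  zero_mem' := ⟨contMDiff_const, HasCompactSupport.zero⟩
  mul_mem' hf hg := ⟨fun x => contMDiffAt_mul (hf.1 x) (hg.1 x), hf.2.mul_right⟩
  smul_mem' c f hf := by
    refine ⟨fun x => contMDiffAt_mul (contMDiffAt_const (c := c)) (hf.1 x), ?_⟩
    exact HasCompactSupport.mul_left (f := fun _ => c) hf.2

/-- The unitization of `Cc`. A unital module over it is the same thing as a module over the
non-unital algebra `Cc`, and tensor products over the two algebras agree. -/
abbrev CcU := Unitization 𝕜 (Cc 𝕜 E M)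

instance : NonUnitalCommRing (Cc 𝕜 E M) := inferInstance
instance : Module 𝕜 (Cc 𝕜 E M) := inferInstance
instance : IsScalarTower 𝕜 (Cc 𝕜 E M) (Cc 𝕜 E M) := inferInstance
instance : SMulCommClass 𝕜 (Cc 𝕜 E M) (Cc 𝕜 E M) := inferInstance
instance : CommRing (CcU 𝕜 E M) := inferInstance
instance : CommSemiring (CcU 𝕜 E M) := inferInstance
instance : Semiring (CcU 𝕜 E M) := inferInstance

variable {M}

/-- The ring of germs at `x` of smooth `𝕜`-valued functions. -/
def SmoothGerm (x : M) : Subring (Germ (𝓝 x) 𝕜) where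
  carrier := {g | ∃ f : M → 𝕜, (∀ᶠ y in 𝓝 x, ContMDiffAt 𝓘(ℝ, E) 𝓘(ℝ, 𝕜) ∞ f y) ∧ g = ↑f}
  mul_mem' := by
    rintro _ _ ⟨f, hf, rfl⟩ ⟨g, hg, rfl⟩
    exact ⟨f * g, by filter_upwards [hf, hg] with y h1 h2 using contMDiffAt_mul h1 h2, rfl⟩
  add_mem' := by
    rintro _ _ ⟨f, hf, rfl⟩ ⟨g, hg, rfl⟩
    exact ⟨f + g, by filter_upwards [hf, hg] with y h1 h2 using h1.add h2, rfl⟩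
  one_mem' := ⟨1, Eventually.of_forall fun _ => contMDiffAt_const, rfl⟩
  zero_mem' := ⟨0, Eventually.of_forall fun _ => contMDiffAt_const, rfl⟩
  neg_mem' := by
    rintro _ ⟨f, hf, rfl⟩
    exact ⟨-f, by filter_upwards [hf] with y h1 using h1.neg, rfl⟩

instance (x : M) : CommRing (SmoothGerm 𝕜 E x) := inferInstance
instance (x : M) : CommSemiring (SmoothGerm 𝕜 E x) := inferInstance
instance (x : M) : Semiring (SmoothGerm 𝕜 E x) := inferInstance

variable {𝕜 E}

/-- The function `c + u` on `M` defined by the element `(c, u)` of the unitization. -/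
def CcU.toFun (r : CcU 𝕜 E M) : M → 𝕜 := fun y => r.fst + (r.snd : M → 𝕜) y

theorem CcU.contMDiff (r : CcU 𝕜 E M) : ContMDiff 𝓘(ℝ, E) 𝓘(ℝ, 𝕜) ∞ r.toFun :=
  contMDiff_const.add r.snd.2.1

/-- The ring homomorphism which maps a function to its germ at `x`. -/
def germHom (x : M) : CcU 𝕜 E M →+* SmoothGerm 𝕜 E x where
  toFun r := ⟨(r.toFun : Germ (𝓝 x) 𝕜), r.toFun, Eventually.of_forall r.contMDiff, rfl⟩
  map_one' := by
    apply Subtype.ext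
    change ((CcU.toFun 1 : M → 𝕜) : Germ (𝓝 x) 𝕜) = ((1 : M → 𝕜) : Germ (𝓝 x) 𝕜)
    congr 1; ext y; simp [CcU.toFun]
  map_mul' r s := by
    apply Subtype.ext
    change ((CcU.toFun (r * s) : M → 𝕜) : Germ (𝓝 x) 𝕜) = ((r.toFun * s.toFun : M → 𝕜) :)
    congr 1; ext y; simp [CcU.toFun]; ring
  map_zero' := by
    apply Subtype.ext
    change ((CcU.toFun 0 : M → 𝕜) : Germ (𝓝 x) 𝕜) = ((0 : M → 𝕜) : Germ (𝓝 x) 𝕜)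
    congr 1; ext y; simp [CcU.toFun]
  map_add' r s := by
    apply Subtype.ext
    change ((CcU.toFun (r + s) : M → 𝕜) : Germ (𝓝 x) 𝕜) = ((r.toFun + s.toFun : M → 𝕜) :)
    congr 1; ext y; simp [CcU.toFun]; ring

instance instAlgebraSmoothGerm (x : M) : Algebra (CcU 𝕜 E M) (SmoothGerm 𝕜 E x) :=
  (germHom x).toAlgebra

theorem algebraMap_eq_iff (x : M) (r s : CcU 𝕜 E M) :
    algebraMap (CcU 𝕜 E M) (SmoothGerm 𝕜 E x) r = algebraMap _ _ s ↔
      ∀ᶠ y in 𝓝 x, r.toFun y = s.toFun y := by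
  change germHom x r = germHom x s ↔ _
  rw [Subtype.ext_iff]
  exact Germ.coe_eq

section Bump

variable [FiniteDimensional ℝ E] [IsManifold 𝓘(ℝ, E) ∞ M] [T2Space M]

/-- Every function which is smooth near `x` agrees near `x` with a compactly supported smooth
function, whose support can be chosen arbitrarily close to `x`. -/
theorem exists_Cc_eventuallyEq (x : M) (f : M → 𝕜) (U : Set M) (hU : U ∈ 𝓝 x)
    (hf : ∀ᶠ y in 𝓝 x, ContMDiffAt 𝓘(ℝ, E) 𝓘(ℝ, 𝕜) ∞ f y) :
    ∃ u : Cc 𝕜 E M, (∀ᶠ y in 𝓝 x, (u : M → 𝕜) y = f y) ∧ ∀ y, (u : M → 𝕜) y ≠ 0 → y ∈ U := by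
  obtain ⟨b, -, hb⟩ := (SmoothBumpFunction.nhds_basis_tsupport (I := 𝓘(ℝ, E)) x).mem_iff.1
    (inter_mem hU hf)
  refine ⟨⟨fun y => b y • f y, ?_, ?_⟩, ?_, ?_⟩
  · intro y
    by_cases hy : y ∈ tsupport b
    · exact (b.contMDiff y).smul (hb hy).2
    · have : (fun y => b y • f y) =ᶠ[𝓝 y] fun _ => 0 := by
        filter_upwards [(isClosed_tsupport b).isOpen_compl.mem_nhds hy] with z hz
        rw [image_eq_zero_of_notMem_tsupport hz, zero_smul]
      exact contMDiffAt_const.congr_of_eventuallyEq this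
  · exact b.hasCompactSupport.smul_right
  · filter_upwards [b.eventuallyEq_one] with y hy
    simp only [hy, Pi.one_apply, one_smul]
  · intro y hy
    refine (hb (subset_tsupport _ fun h => hy ?_)).1
    simp only [h, zero_smul]

theorem germ_surjective (x : M) :
    Function.Surjective (algebraMap (CcU 𝕜 E M) (SmoothGerm 𝕜 E x)) := by
  rintro ⟨_, f, hf, rfl⟩
  obtain ⟨u, hu, -⟩ := exists_Cc_eventuallyEq x f univ univ_mem hf
  refine ⟨(u : CcU 𝕜 E M), Subtype.ext (Germ.coe_eq.2 ?_)⟩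
  filter_upwards [hu] with y hy
  simpa [CcU.toFun] using hy

/-- The functions which are equal to `1` near `x`. -/
def oneNear (x : M) : Submonoid (CcU 𝕜 E M) where
  carrier := {r | ∀ᶠ y in 𝓝 x, r.toFun y = 1}
  one_mem' := Eventually.of_forall fun y => by simp [CcU.toFun]
  mul_mem' := by
    rintro r s hr hs
    filter_upwards [hr, hs] with y h1 h2
    have : (r * s).toFun y = r.toFun y * s.toFun y := by simp [CcU.toFun]; ring
    rw [this, h1, h2, one_mul]

theorem exists_mul_eq_mul (x : M) {r s : CcU 𝕜 E M} (h : ∀ᶠ y in 𝓝 x, r.toFun y = s.toFun y) :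
    ∃ u : Cc 𝕜 E M, (∀ᶠ y in 𝓝 x, (u : M → 𝕜) y = 1) ∧
      (u : CcU 𝕜 E M) * r = (u : CcU 𝕜 E M) * s := by
  obtain ⟨u, hu, hu'⟩ := exists_Cc_eventuallyEq (𝕜 := 𝕜) (E := E) x (fun _ => 1) _ h
    (Eventually.of_forall fun _ => contMDiffAt_const)
  refine ⟨u, hu, ?_⟩
  refine Unitization.ext (by simp) (Subtype.ext (funext fun y => ?_))
  by_cases hy : (u : M → 𝕜) y = 0
  · simp [hy]
  · have := hu' y hy
    simp only [CcU.toFun, mem_ofPred_eq] at this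
    simp only [Unitization.snd_mul, Unitization.fst_inr, Unitization.snd_inr, zero_smul, zero_add]
    simp only [NonUnitalSubalgebra.coe_add, NonUnitalSubalgebra.coe_smul,
      NonUnitalSubalgebra.coe_mul, Pi.add_apply, Pi.smul_apply, Pi.mul_apply, smul_eq_mul]
    linear_combination (u : M → 𝕜) y * this

instance instIsLocalizationSmoothGerm (x : M) :
    IsLocalization (oneNear (𝕜 := 𝕜) (E := E) x) (SmoothGerm 𝕜 E x) := by
  refine (isLocalization_iff _ _).2 ⟨?_, ?_, ?_⟩
  · rintro ⟨r, hr⟩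
    have : algebraMap (CcU 𝕜 E M) (SmoothGerm 𝕜 E x) r = algebraMap (CcU 𝕜 E M) _ 1 := by
      rw [algebraMap_eq_iff]
      filter_upwards [hr] with y hy
      rw [hy]; simp [CcU.toFun]
    simp [this]
  · intro z
    obtain ⟨r, rfl⟩ := germ_surjective x z
    exact ⟨(r, 1), by simp⟩
  · intro r s h
    rw [algebraMap_eq_iff] at h
    obtain ⟨u, hu, hu'⟩ := exists_mul_eq_mul x h
    exact ⟨⟨u, by filter_upwards [hu] with y hy; simpa [CcU.toFun] using hy⟩, hu'⟩

end Bump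

end Functions

/-! ### Coalgebras over `Cc M`, their localisations and the spectral sheaf -/

section Coalgebras

/-- The counit of a left `R`-coalgebra `C` over a non-unital commutative algebra `R`. Such a
coalgebra is a locally unitary coalgebra over the unitization of `R`, whose counit then takes
values in `R` (see `counit_eq_inr`). -/
def counitR (𝕜 R : Type*) {C : Type*} [Field 𝕜] [NonUnitalCommRing R] [Module 𝕜 R] [IsScalarTower 𝕜 R R]
    [SMulCommClass 𝕜 R R] [AddCommGroup C] [Module (Unitization 𝕜 R) C]
    [Coalgebra (Unitization 𝕜 R) C] (c : C) : R :=
  (Coalgebra.counit (R := Unitization 𝕜 R) c).snd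

theorem counit_eq_inr {𝕜 R C : Type*} [Field 𝕜] [NonUnitalCommRing R] [Module 𝕜 R]
    [IsScalarTower 𝕜 R R] [SMulCommClass 𝕜 R R] [AddCommGroup C] [Module (Unitization 𝕜 R) C]
    [Coalgebra (Unitization 𝕜 R) C] (c : C) (hc : ∃ u : R, (u : Unitization 𝕜 R) • c = c) :
    Coalgebra.counit (R := Unitization 𝕜 R) c = (counitR 𝕜 R c : R) := by
  obtain ⟨u, hu⟩ := hc
  refine Unitization.ext ?_ rfl
  conv_lhs => rw [← hu, map_smul]
  simp

theorem comul_one_tmul {R S C : Type*} [CommRing R] [CommRing S] [Algebra R S] [AddCommGroup C]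
    [Module R C] [Coalgebra R C] (c : C) :
    Coalgebra.comul (R := S) (1 ⊗ₜ[R] c : S ⊗[R] C) =
      TensorProduct.AlgebraTensorModule.distribBaseChange R S C C (1 ⊗ₜ Coalgebra.comul c) := by
  simp only [TensorProduct.comul_tmul, CommSemiring.comul_apply]
  induction Coalgebra.comul (R := R) c with
  | zero => simp
  | tmul a b => simp [TensorProduct.AlgebraTensorModule.distribBaseChange]
  | add a b ha hb => simp only [TensorProduct.tmul_add, map_add, ha, hb]

theorem distrib_one_tmul {R S C : Type*} [CommRing R] [CommRing S] [Algebra R S] [AddCommGroup C]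
    [Module R C] (a b : C) :
    TensorProduct.AlgebraTensorModule.distribBaseChange R S C C (1 ⊗ₜ (a ⊗ₜ b)) =
      (1 ⊗ₜ[R] a) ⊗ₜ[S] (1 ⊗ₜ[R] b) := by
  simp [TensorProduct.AlgebraTensorModule.distribBaseChange]

theorem one_tmul_smul {R S C : Type*} [CommRing R] [CommRing S] [Algebra R S] [AddCommGroup C]
    [Module R C] (r : R) (c : C) :
    (1 ⊗ₜ[R] (r • c) : S ⊗[R] C) = algebraMap R S r • (1 ⊗ₜ[R] c : S ⊗[R] C) := by
  rw [← TensorProduct.smul_tmul, TensorProduct.smul_tmul', Algebra.smul_def, smul_eq_mul]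

/-- The elements `c` with `Δ(c) = c ⊗ c'` for some `c'`. -/
def WeaklyGrouplike (R : Type*) {C : Type*} [CommRing R] [AddCommGroup C] [Module R C]
    [Coalgebra R C] (c : C) : Prop :=
  ∃ c' : C, Coalgebra.comul (R := R) c = c ⊗ₜ[R] c'

/-- The set `S` is a basis of the `R`-module `X`. -/
def FreelyGenerates (R : Type*) {X : Type*} [Ring R] [AddCommGroup X] [Module R X]
    (S : Set X) : Prop :=
  LinearIndependent R ((↑) : S → X) ∧ Submodule.span R S = ⊤

variable {𝕜 : Type*} [RCLike 𝕜]
  {E : Type*} [NormedAddCommGroup E] [NormedSpace ℝ E]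
  {M : Type*} [TopologicalSpace M] [ChartedSpace E M]

variable (𝕜 E) in
/-- The localisation `C_x` of a module `C` over `Cc M` at `x`. The kernel of the surjection
`C → C_x` consists of the elements annihilated by some function with germ `1` at `x`
(see `germAt_surjective`, `germAt_eq_zero_iff`). If `C` is a coalgebra over `Cc M`, then `C_x` is a
coalgebra over the ring of germs at `x`. -/
abbrev LocalAt (C : Type*) [AddCommGroup C] [Module (CcU 𝕜 E M) C] (x : M) :=
  SmoothGerm 𝕜 E x ⊗[CcU 𝕜 E M] C

variable (𝕜 E) in
/-- The class `c_x` of `c` in `C_x`. -/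
def germAt {C : Type*} [AddCommGroup C] [Module (CcU 𝕜 E M) C] (x : M) (c : C) :
    LocalAt 𝕜 E C x :=
  1 ⊗ₜ[CcU 𝕜 E M] c

variable (𝕜 E) in
/-- The element `c` is normalised on `W`: the function `ε(c)` is equal to `1` on `W`. -/
def NormalisedOn {C : Type*} [AddCommGroup C] [Module (CcU 𝕜 E M) C] [Coalgebra (CcU 𝕜 E M) C]
    (c : C) (W : Set M) : Prop :=
  ∀ y ∈ W, CcU.toFun (Coalgebra.counit (R := CcU 𝕜 E M) c) y = 1

variable (𝕜 E) in
/-- The set `G(C_x)` of grouplike elements of `C_x`. -/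
def grouplikeAt (C : Type*) [AddCommGroup C] [Module (CcU 𝕜 E M) C] [Coalgebra (CcU 𝕜 E M) C]
    (x : M) : Set (LocalAt 𝕜 E C x) :=
  {ζ | IsGroupLikeElem (SmoothGerm 𝕜 E x) ζ}

variable (𝕜 E M) in
/-- The total space of the spectral sheaf of the coalgebra `C` over `Cc M`. Its stalk over `x` is
the set `G(C_x)`. -/
@[ext]
structure SpectralSheaf (C : Type*) [AddCommGroup C] [Module (CcU 𝕜 E M) C]
    [Coalgebra (CcU 𝕜 E M) C] where
  /-- the projection to `M` -/
  pt : M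
  val : LocalAt 𝕜 E C pt
  mem : val ∈ grouplikeAt 𝕜 E C pt

namespace SpectralSheaf

variable {C : Type*} [AddCommGroup C] [Module (CcU 𝕜 E M) C] [Coalgebra (CcU 𝕜 E M) C]

/-- The set `m_W` of the points `m_x` of the spectral sheaf with `x ∈ W`. -/
def basicSet (m : C) (W : Set M) : Set (SpectralSheaf 𝕜 E M C) :=
  {p | p.pt ∈ W ∧ p.val = germAt 𝕜 E p.pt m}

/-- The topology on the spectral sheaf is generated by the sets `m_W`, where `m` is weakly
grouplike and normalised on the open set `W`. -/
instance : TopologicalSpace (SpectralSheaf 𝕜 E M C) :=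
  TopologicalSpace.generateFrom {U | ∃ (m : C) (W : Set M), IsOpen W ∧
    WeaklyGrouplike (CcU 𝕜 E M) m ∧ NormalisedOn 𝕜 E m W ∧ U = basicSet m W}

/-- The element `c` is normalised on an open neighbourhood of the base point of `p`, and `p` is the
class of `c` at this point. -/
def IsGermOf (p : SpectralSheaf 𝕜 E M C) (c : C) : Prop :=
  (∃ W : Set M, IsOpen W ∧ p.pt ∈ W ∧ NormalisedOn 𝕜 E c W) ∧ p.val = germAt 𝕜 E p.pt c

theorem isOpen_basicSet {m : C} {W : Set M} (hW : IsOpen W)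
    (hm : WeaklyGrouplike (CcU 𝕜 E M) m) (hn : NormalisedOn 𝕜 E m W) :
    IsOpen (basicSet m W : Set (SpectralSheaf 𝕜 E M C)) :=
  TopologicalSpace.isOpen_generateFrom_of_mem ⟨m, W, hW, hm, hn, rfl⟩

end SpectralSheaf

theorem counit_germAt {C : Type*} [AddCommGroup C] [Module (CcU 𝕜 E M) C]
    [Coalgebra (CcU 𝕜 E M) C] (x : M) (c : C) :
    Coalgebra.counit (R := SmoothGerm 𝕜 E x) (germAt 𝕜 E x c) =
      algebraMap (CcU 𝕜 E M) _ (Coalgebra.counit c) := by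
  simp [germAt, Algebra.smul_def]

theorem germAt_mem_grouplikeAt {C : Type*} [AddCommGroup C] [Module (CcU 𝕜 E M) C]
    [Coalgebra (CcU 𝕜 E M) C] {x : M} {m : C} (hm : WeaklyGrouplike (CcU 𝕜 E M) m) {W : Set M}
    (hW : IsOpen W) (hx : x ∈ W) (hn : NormalisedOn 𝕜 E m W) :
    germAt 𝕜 E x m ∈ grouplikeAt 𝕜 E C x := by
  have h1 : algebraMap (CcU 𝕜 E M) (SmoothGerm 𝕜 E x) (Coalgebra.counit m) = 1 := by
    rw [← map_one (algebraMap (CcU 𝕜 E M) (SmoothGerm 𝕜 E x)), algebraMap_eq_iff]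
    filter_upwards [hW.mem_nhds hx] with y hy
    rw [hn y hy]; simp [CcU.toFun]
  obtain ⟨m', hm'⟩ := hm
  have h2 : Coalgebra.counit (R := CcU 𝕜 E M) m • m' = m := by
    have := Coalgebra.rTensor_counit_comul (R := CcU 𝕜 E M) m
    rw [hm', LinearMap.rTensor_tmul] at this
    simpa using congrArg (TensorProduct.lid (CcU 𝕜 E M) C) this
  have h3 : germAt 𝕜 E x m = germAt 𝕜 E x m' := by
    conv_lhs => rw [← h2]
    rw [germAt, one_tmul_smul, h1, one_smul, germAt]
  refine ⟨?_, ?_⟩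
  · rw [counit_germAt, h1]
  · rw [germAt, comul_one_tmul, hm', distrib_one_tmul]
    exact congrArg _ h3.symm

section Local

variable [FiniteDimensional ℝ E] [IsManifold 𝓘(ℝ, E) ∞ M] [T2Space M]
  {C : Type*} [AddCommGroup C] [Module (CcU 𝕜 E M) C]

theorem germAt_surjective (x : M) : Function.Surjective (germAt 𝕜 E x : C → LocalAt 𝕜 E C x) :=
  TensorProduct.mk_surjective (CcU 𝕜 E M) C (SmoothGerm 𝕜 E x) (germ_surjective x)

theorem germAt_eq_iff (x : M) (c d : C) :
    germAt 𝕜 E x c = germAt 𝕜 E x d ↔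
      ∃ u : Cc 𝕜 E M, (∀ᶠ y in 𝓝 x, (u : M → 𝕜) y = 1) ∧
        (u : CcU 𝕜 E M) • c = (u : CcU 𝕜 E M) • d := by
  have hloc : IsLocalizedModule (oneNear (𝕜 := 𝕜) (E := E) x)
      (TensorProduct.mk (CcU 𝕜 E M) (SmoothGerm 𝕜 E x) C 1) :=
    (isLocalizedModule_iff_isBaseChange _ (SmoothGerm 𝕜 E x) _).2
      (TensorProduct.isBaseChange (CcU 𝕜 E M) C (SmoothGerm 𝕜 E x))
  constructor
  · intro h
    obtain ⟨⟨r, hr⟩, hrc⟩ := (IsLocalizedModule.eq_iff_exists (oneNear (𝕜 := 𝕜) (E := E) x)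
      (TensorProduct.mk (CcU 𝕜 E M) (SmoothGerm 𝕜 E x) C 1)).1 h
    have hr1 : ∀ᶠ y in 𝓝 x, r.toFun y = CcU.toFun (1 : CcU 𝕜 E M) y := by
      filter_upwards [hr] with y hy
      rw [hy]; simp [CcU.toFun]
    obtain ⟨u, hu, hur⟩ := exists_mul_eq_mul x hr1
    refine ⟨u, hu, ?_⟩
    rw [mul_one] at hur
    rw [← hur, mul_smul, mul_smul]
    exact congrArg _ hrc
  · rintro ⟨u, hu, h⟩
    refine (IsLocalizedModule.eq_iff_exists (oneNear (𝕜 := 𝕜) (E := E) x)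
      (TensorProduct.mk (CcU 𝕜 E M) (SmoothGerm 𝕜 E x) C 1)).2 ⟨⟨u, ?_⟩, h⟩
    filter_upwards [hu] with y hy
    simpa [CcU.toFun] using hy

theorem germAt_eq_zero_iff (x : M) (c : C) :
    germAt 𝕜 E x c = 0 ↔
      ∃ u : Cc 𝕜 E M, (∀ᶠ y in 𝓝 x, (u : M → 𝕜) y = 1) ∧ (u : CcU 𝕜 E M) • c = 0 := by
  have : (0 : LocalAt 𝕜 E C x) = germAt 𝕜 E x (0 : C) := (TensorProduct.tmul_zero _ _).symm
  rw [this, germAt_eq_iff]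
  simp

theorem germAt_eventuallyEq {x : M} {c d : C} (h : germAt 𝕜 E x c = germAt 𝕜 E x d) :
    ∀ᶠ y in 𝓝 x, germAt 𝕜 E y c = germAt 𝕜 E y d := by
  obtain ⟨u, hu, h⟩ := (germAt_eq_iff x c d).1 h
  filter_upwards [eventually_eventually_nhds.2 hu] with y hy
  exact (germAt_eq_iff y c d).2 ⟨u, hy, h⟩

variable [Coalgebra (CcU 𝕜 E M) C]

namespace SpectralSheaf

/-- Every point of the spectral sheaf is the class of a weakly grouplike element which is
normalised near the base point. -/
theorem exists_isGermOf (p : SpectralSheaf 𝕜 E M C) :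
    ∃ m : C, WeaklyGrouplike (CcU 𝕜 E M) m ∧ p.IsGermOf m := by
  obtain ⟨x, ζ, h1, h2⟩ := p
  obtain ⟨c, rfl⟩ := germAt_surjective x ζ
  rw [germAt, comul_one_tmul, ← distrib_one_tmul] at h2
  have h2' := (TensorProduct.AlgebraTensorModule.distribBaseChange (CcU 𝕜 E M)
    (SmoothGerm 𝕜 E x) C C).injective h2
  obtain ⟨u, hu, h⟩ := (germAt_eq_iff (𝕜 := 𝕜) (E := E) x _ _).1 h2'
  rw [counit_germAt, ← map_one (algebraMap (CcU 𝕜 E M) (SmoothGerm 𝕜 E x)),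
    algebraMap_eq_iff] at h1
  have hev : ∀ᶠ y in 𝓝 x, CcU.toFun (Coalgebra.counit (R := CcU 𝕜 E M)
      ((u : CcU 𝕜 E M) • c)) y = 1 := by
    filter_upwards [h1, hu] with y hy hy'
    rw [map_smul]
    have e : ∀ r s : CcU 𝕜 E M, (r * s).toFun y = r.toFun y * s.toFun y := by
      intro r s; simp [CcU.toFun]; ring
    rw [smul_eq_mul, e, hy]
    simp [CcU.toFun, hy']
  obtain ⟨W, hW, hWo, hxW⟩ := eventually_nhds_iff.1 hev
  refine ⟨(u : CcU 𝕜 E M) • c, ⟨c, ?_⟩, ⟨W, hWo, hxW, hW⟩, ?_⟩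
  · rw [map_smul, h, TensorProduct.smul_tmul']
  · refine (germAt_eq_iff x _ _).2 ?_
    have hu2 : ∀ᶠ y in 𝓝 x, CcU.toFun (u : CcU 𝕜 E M) y = CcU.toFun (1 : CcU 𝕜 E M) y := by
      filter_upwards [hu] with y hy
      simp [CcU.toFun, hy]
    obtain ⟨v, hv, hvu⟩ := exists_mul_eq_mul x hu2
    refine ⟨v, hv, ?_⟩
    rw [← mul_smul, hvu, mul_one]

/-- The section `x ↦ m_x` over `W`, extended arbitrarily. -/
def sectionFun (m : C) (W : Set M) (p₀ : SpectralSheaf 𝕜 E M C) (x : M) : SpectralSheaf 𝕜 E M C :=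
  open Classical in
  if h : x ∈ W ∧ germAt 𝕜 E x m ∈ grouplikeAt 𝕜 E C x then ⟨x, germAt 𝕜 E x m, h.2⟩ else p₀

theorem continuous_pt : Continuous (pt : SpectralSheaf 𝕜 E M C → M) := by
  refine continuous_def.2 fun O hO => isOpen_iff_forall_mem_open.2 fun p hp => ?_
  obtain ⟨m, hm, ⟨W, hW, hpW, hn⟩, hpm⟩ := p.exists_isGermOf
  exact ⟨basicSet m (W ∩ O), fun q hq => hq.1.2,
    isOpen_basicSet (hW.inter hO) hm fun y hy => hn y hy.1, ⟨hpW, hp⟩, hpm⟩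

/-- The projection of the spectral sheaf restricts to a homeomorphism `m_W → W`. -/
def sectionHomeo (m : C) (W : Set M) (p₀ : SpectralSheaf 𝕜 E M C) (hW : IsOpen W)
    (hm : WeaklyGrouplike (CcU 𝕜 E M) m) (hn : NormalisedOn 𝕜 E m W) :
    OpenPartialHomeomorph (SpectralSheaf 𝕜 E M C) M where
  toFun := pt
  invFun := sectionFun m W p₀
  source := basicSet m W
  target := W
  map_source' p hp := hp.1
  map_target' x hx := by
    have h := germAt_mem_grouplikeAt hm hW hx hn
    rw [sectionFun, dif_pos ⟨hx, h⟩]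
    exact ⟨hx, rfl⟩
  left_inv' := by
    rintro ⟨x, ζ, hζ⟩ ⟨hx, h⟩
    change ζ = germAt 𝕜 E x m at h
    subst h
    change sectionFun m W p₀ x = _
    rw [sectionFun, dif_pos ⟨hx, hζ⟩]
  right_inv' x hx := by
    have h := germAt_mem_grouplikeAt hm hW hx hn
    rw [sectionFun, dif_pos ⟨hx, h⟩]
  open_source := isOpen_basicSet hW hm hn
  open_target := hW
  continuousOn_toFun := continuous_pt.continuousOn
  continuousOn_invFun := by
    refine continuousOn_to_generateFrom_iff.2 ?_
    rintro x hx _ ⟨n, V, hV, -, -, rfl⟩ hxn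
    refine mem_nhdsWithin_of_mem_nhds ?_
    rw [sectionFun, dif_pos ⟨hx, germAt_mem_grouplikeAt hm hW hx hn⟩] at hxn
    filter_upwards [hW.mem_nhds hx, hV.mem_nhds hxn.1, germAt_eventuallyEq hxn.2] with y h1 h2 h3
    rw [mem_preimage, sectionFun, dif_pos ⟨h1, germAt_mem_grouplikeAt hm hW h1 hn⟩]
    exact ⟨h2, h3⟩

theorem isLocalHomeomorph_pt : IsLocalHomeomorph (pt : SpectralSheaf 𝕜 E M C → M) := by
  intro p
  obtain ⟨m, hm, ⟨W, hW, hpW, hn⟩, hpm⟩ := p.exists_isGermOf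
  exact ⟨sectionHomeo m W p hW hm hn, ⟨hpW, hpm⟩, rfl⟩

/-- The smooth structure on the spectral sheaf for which the projection is a local diffeomorphism:
the charts are the compositions of local restrictions of the projection with charts of `M`. -/
instance : ChartedSpace E (SpectralSheaf 𝕜 E M C) where
  atlas := {e | ∃ (f : OpenPartialHomeomorph (SpectralSheaf 𝕜 E M C) M)
    (c : OpenPartialHomeomorph M E), ⇑f = pt ∧ c ∈ atlas E M ∧ e = f.trans c}
  chartAt p := (isLocalHomeomorph_pt p).choose.trans (chartAt E p.pt)
  mem_chart_source p := by
    have h := (isLocalHomeomorph_pt p).choose_spec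
    refine ⟨h.1, ?_⟩
    rw [mem_preimage]
    change (isLocalHomeomorph_pt p).choose p ∈ _
    rw [← h.2]
    exact mem_chart_source E p.pt
  chart_mem_atlas p :=
    ⟨_, _, (isLocalHomeomorph_pt p).choose_spec.2.symm, chart_mem_atlas E p.pt, rfl⟩

end SpectralSheaf

end Local

end Coalgebras

/-! ### Bialgebroids, Hopf algebroids and principal bimodules

Throughout, `R` is a commutative algebra over the field `𝕜`, not necessarily with a unit, and left
`R`-modules are modules over the unitization of `R`. Componentwise products in tensor products
over `R` are only partially defined; they are expressed through representatives in the tensor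
product over `𝕜`. -/

section Algebroids

/-- The canonical surjection from the tensor product over the ground field. -/
def toBase (𝕜 R : Type*) {X Y : Type*} [Field 𝕜] [NonUnitalCommRing R] [Module 𝕜 R]
    [IsScalarTower 𝕜 R R] [SMulCommClass 𝕜 R R]
    [AddCommGroup X] [Module 𝕜 X] [Module (Unitization 𝕜 R) X]
    [IsScalarTower 𝕜 (Unitization 𝕜 R) X]
    [AddCommGroup Y] [Module 𝕜 Y] [Module (Unitization 𝕜 R) Y]
    [IsScalarTower 𝕜 (Unitization 𝕜 R) Y] :
    X ⊗[𝕜] Y →ₗ[𝕜] X ⊗[Unitization 𝕜 R] Y :=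
  TensorProduct.mapOfCompatibleSMul (Unitization 𝕜 R) 𝕜 𝕜 X Y

variable {𝕜 : Type*} [Field 𝕜]

open TensorProduct (map map₂)
open Coalgebra (comul)

/-- An `R`-bialgebroid: an algebra `A` with local identities in the commutative subalgebra `R`, with
a compatible structure of a left `R`-coalgebra. The tensor product `A ⊗[Unitization 𝕜 R] A` is taken
with respect to the left action of `R` on both factors. (The inclusion of `R` is injective by
`counit_incl`.) -/
structure Bialgebroid (𝕜 R A : Type*) [Field 𝕜]
    [NonUnitalCommRing R] [Module 𝕜 R] [IsScalarTower 𝕜 R R] [SMulCommClass 𝕜 R R]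
    [NonUnitalRing A] [Module 𝕜 A] [IsScalarTower 𝕜 A A] [SMulCommClass 𝕜 A A]
    [Module (Unitization 𝕜 R) A] [IsScalarTower 𝕜 (Unitization 𝕜 R) A]
    [Coalgebra (Unitization 𝕜 R) A] where
  /-- the inclusion of the base algebra -/
  incl : R →ₙₐ[𝕜] A
  smul_eq : ∀ (u : R) (a : A), (u : Unitization 𝕜 R) • a = incl u * a
  local_identities : ∀ s : Finset A, ∃ u : R, ∀ a ∈ s, incl u * a = a ∧ a * incl u = a
  counit_incl : ∀ u : R, counitR 𝕜 R (incl u) = u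
  comul_incl : ∀ u e : R, e * u = u →
    comul (R := Unitization 𝕜 R) (incl u) = incl u ⊗ₜ[Unitization 𝕜 R] incl e
  /-- the two right actions of `R` coincide on the image of the comultiplication -/
  comul_right : ∀ (a : A) (u : R) (t : A ⊗[𝕜] A), toBase 𝕜 R t = comul a →
    toBase 𝕜 R (map (LinearMap.mulRight 𝕜 (incl u)) LinearMap.id t) =
      toBase 𝕜 R (map LinearMap.id (LinearMap.mulRight 𝕜 (incl u)) t)
  counit_mul : ∀ a b : A, counitR 𝕜 R (a * b) = counitR 𝕜 R (a * incl (counitR 𝕜 R b))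
  comul_mul : ∀ (a b : A) (t s : A ⊗[𝕜] A), toBase 𝕜 R t = comul a → toBase 𝕜 R s = comul b →
    comul (a * b) = toBase 𝕜 R (map₂ (LinearMap.mul 𝕜 A) (LinearMap.mul 𝕜 A) t s)

/-- A Hopf `R`-algebroid: an `R`-bialgebroid with an involutive antipode. -/
structure HopfAlgebroid (𝕜 R A : Type*) [Field 𝕜]
    [NonUnitalCommRing R] [Module 𝕜 R] [IsScalarTower 𝕜 R R] [SMulCommClass 𝕜 R R]
    [NonUnitalRing A] [Module 𝕜 A] [IsScalarTower 𝕜 A A] [SMulCommClass 𝕜 A A]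
    [Module (Unitization 𝕜 R) A] [IsScalarTower 𝕜 (Unitization 𝕜 R) A]
    [Coalgebra (Unitization 𝕜 R) A] extends Bialgebroid 𝕜 R A where
  antipode : A →ₗ[𝕜] A
  antipode_antipode : ∀ a, antipode (antipode a) = a
  antipode_incl : ∀ u, antipode (incl u) = incl u
  antipode_mul : ∀ a b, antipode (a * b) = antipode b * antipode a
  antipode_comul : ∀ (a : A) (t : A ⊗[𝕜] A), toBase 𝕜 R t = comul a →
    LinearMap.mul' 𝕜 A (map antipode LinearMap.id t) = incl (counitR 𝕜 R (antipode a))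

variable {R A R' B : Type*}
  [NonUnitalCommRing R] [Module 𝕜 R] [IsScalarTower 𝕜 R R] [SMulCommClass 𝕜 R R]
  [NonUnitalRing A] [Module 𝕜 A] [IsScalarTower 𝕜 A A] [SMulCommClass 𝕜 A A]
  [Module (Unitization 𝕜 R) A] [IsScalarTower 𝕜 (Unitization 𝕜 R) A]
  [Coalgebra (Unitization 𝕜 R) A]
  [NonUnitalCommRing R'] [Module 𝕜 R'] [IsScalarTower 𝕜 R' R'] [SMulCommClass 𝕜 R' R']
  [NonUnitalRing B] [Module 𝕜 B] [IsScalarTower 𝕜 B B] [SMulCommClass 𝕜 B B]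
  [Module (Unitization 𝕜 R') B] [IsScalarTower 𝕜 (Unitization 𝕜 R') B]
  [Coalgebra (Unitization 𝕜 R') B]

/-- A preprincipal `A`-`B`-bimodule `X`: a locally unitary bimodule with a compatible structure of a
left `R`-coalgebra. Here `lact a m` is `a m` and `ract b m` is `m b`. -/
structure PreprincipalBimodule (𝓐 : Bialgebroid 𝕜 R A) (𝓑 : Bialgebroid 𝕜 R' B) (X : Type*)
    [AddCommGroup X] [Module 𝕜 X] [Module (Unitization 𝕜 R) X]
    [IsScalarTower 𝕜 (Unitization 𝕜 R) X] [Coalgebra (Unitization 𝕜 R) X] where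
  lact : A →ₗ[𝕜] X →ₗ[𝕜] X
  ract : B →ₗ[𝕜] X →ₗ[𝕜] X
  mul_lact : ∀ a a' m, lact (a * a') m = lact a (lact a' m)
  mul_ract : ∀ b b' m, ract (b * b') m = ract b' (ract b m)
  lact_ract : ∀ a b m, lact a (ract b m) = ract b (lact a m)
  smul_eq : ∀ (u : R) (m : X), (u : Unitization 𝕜 R) • m = lact (𝓐.incl u) m
  local_unitary : ∀ s : Finset X, ∃ (u : R) (v : R'), ∀ m ∈ s,
    lact (𝓐.incl u) m = m ∧ ract (𝓑.incl v) m = m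
  /-- the two right actions of `R'` coincide on the image of the comultiplication -/
  comul_right : ∀ (m : X) (v : R') (t : X ⊗[𝕜] X), toBase 𝕜 R t = comul m →
    toBase 𝕜 R (map (ract (𝓑.incl v)) LinearMap.id t) =
      toBase 𝕜 R (map LinearMap.id (ract (𝓑.incl v)) t)
  counit_ract : ∀ m b,
    counitR 𝕜 R (ract b m) = counitR 𝕜 R (ract (𝓑.incl (counitR 𝕜 R' b)) m)
  counit_lact : ∀ a m,
    counitR 𝕜 R (lact a m) = counitR 𝕜 R (a * 𝓐.incl (counitR 𝕜 R m))
  comul_lact : ∀ (a : A) (m : X) (s : A ⊗[𝕜] A) (t : X ⊗[𝕜] X),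
    toBase 𝕜 R s = comul a → toBase 𝕜 R t = comul m →
    comul (lact a m) = toBase 𝕜 R (map₂ lact lact s t)
  comul_ract : ∀ (m : X) (b : B) (t : X ⊗[𝕜] X) (s : B ⊗[𝕜] B),
    toBase 𝕜 R t = comul m → toBase 𝕜 R' s = comul b →
    comul (ract b m) = toBase 𝕜 R (map₂ ract ract s t)

namespace PreprincipalBimodule

variable {𝓐 : Bialgebroid 𝕜 R A} {𝓑 : Bialgebroid 𝕜 R' B} {X : Type*}
  [AddCommGroup X] [Module 𝕜 X] [Module (Unitization 𝕜 R) X]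
  [IsScalarTower 𝕜 (Unitization 𝕜 R) X] [Coalgebra (Unitization 𝕜 R) X]

/-- The tensor product of `X` and `B` over `R'`, with respect to the right action of `R'` on `X` and
the left action of `R'` on `B`. -/
abbrev TensorB (𝓧 : PreprincipalBimodule 𝓐 𝓑 X) :=
  (X ⊗[𝕜] B) ⧸ Submodule.span 𝕜
    {z | ∃ (m : X) (v : R') (b : B),
      z = 𝓧.ract (𝓑.incl v) m ⊗ₜ[𝕜] b - m ⊗ₜ[𝕜] (𝓑.incl v * b)}

/-- The bimodule is principal: the counit is surjective, and the map
`m ⊗ b ↦ Δ(m) (v ⊗ b)`, where `v` is any element of `R'` with `v b = b`, is an isomorphism from the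
tensor product of `X` and `B` over `R'` to the tensor product of `X` and `X` over `R`. -/
def IsPrincipal (𝓧 : PreprincipalBimodule 𝓐 𝓑 X) : Prop :=
  Function.Surjective (counitR 𝕜 R : X → R) ∧
  ∃ D : 𝓧.TensorB ≃ₗ[𝕜] X ⊗[Unitization 𝕜 R] X,
    ∀ (m : X) (b : B) (v : R') (t : X ⊗[𝕜] X), 𝓑.incl v * b = b → toBase 𝕜 R t = comul m →
      D (Submodule.Quotient.mk (m ⊗ₜ[𝕜] b)) =
        toBase 𝕜 R (map (𝓧.ract (𝓑.incl v)) (𝓧.ract b) t)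

end PreprincipalBimodule

end Algebroids

/-! ### Locally grouplike Hopf algebroids and bimodules -/

section LocallyGrouplike

variable {𝕜 : Type*} [RCLike 𝕜]
  {E : Type*} [NormedAddCommGroup E] [NormedSpace ℝ E]
  {M : Type*} [TopologicalSpace M] [ChartedSpace E M]
  {A : Type*} [NonUnitalRing A] [Module 𝕜 A] [IsScalarTower 𝕜 A A] [SMulCommClass 𝕜 A A]
  [Module (CcU 𝕜 E M) A] [IsScalarTower 𝕜 (CcU 𝕜 E M) A] [Coalgebra (CcU 𝕜 E M) A]

namespace HopfAlgebroid

/-- The `S`-invariant weakly grouplike elements. -/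
def SInvariant (𝓐 : HopfAlgebroid 𝕜 (Cc 𝕜 E M) A) (a : A) : Prop :=
  ∃ a' : A, Coalgebra.comul (R := CcU 𝕜 E M) a = a ⊗ₜ[CcU 𝕜 E M] a' ∧
    Coalgebra.comul (R := CcU 𝕜 E M) (𝓐.antipode a) =
      𝓐.antipode a' ⊗ₜ[CcU 𝕜 E M] 𝓐.antipode a

/-- The set of arrows with target `y`. -/
def arrowsAt (𝓐 : HopfAlgebroid 𝕜 (Cc 𝕜 E M) A) (y : M) : Set (LocalAt 𝕜 E A y) :=
  {ζ | ∃ a : A, 𝓐.SInvariant a ∧ (∃ W : Set M, IsOpen W ∧ y ∈ W ∧ NormalisedOn 𝕜 E a W) ∧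
    ζ = germAt 𝕜 E y a}

/-- The Hopf algebroid is locally grouplike: each local module `A_y` is freely generated by the
set of arrows with target `y`. -/
def IsLocallyGrouplike (𝓐 : HopfAlgebroid 𝕜 (Cc 𝕜 E M) A) : Prop :=
  ∀ y : M, FreelyGenerates (SmoothGerm 𝕜 E y) (𝓐.arrowsAt y)

end HopfAlgebroid

variable (𝕜 E M) in
/-- The coalgebra `X` over `Cc M` is locally grouplike: each local module `X_x` is freely
generated by its grouplike elements. -/
def IsLocallyGrouplike (X : Type*) [AddCommGroup X] [Module (CcU 𝕜 E M) X]
    [Coalgebra (CcU 𝕜 E M) X] : Prop :=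
  ∀ x : M, FreelyGenerates (SmoothGerm 𝕜 E x) (grouplikeAt 𝕜 E X x)

end LocallyGrouplike

/-! ### Smooth maps on fibre products, étale Lie groupoids and principal bundles -/

section Groupoids

section Subsets

variable {E₁ H₁ X E₂ H₂ Y : Type*}
  [NormedAddCommGroup E₁] [NormedSpace ℝ E₁] [TopologicalSpace H₁] (I : ModelWithCorners ℝ E₁ H₁)
  [TopologicalSpace X] [ChartedSpace H₁ X]
  [NormedAddCommGroup E₂] [NormedSpace ℝ E₂] [TopologicalSpace H₂] (J : ModelWithCorners ℝ E₂ H₂)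
  [TopologicalSpace Y] [ChartedSpace H₂ Y]

/-- A map defined on a subset `S` of a manifold is smooth if it locally extends to a smooth map on
an open subset of the manifold. If `S` is an embedded submanifold (for instance a fibre product
along a submersion) this is the smoothness on the manifold `S`. -/
def SmoothOnSubset {S : Set X} (f : S → Y) : Prop :=
  ∀ p : S, ∃ (U : Set X) (F : X → Y), IsOpen U ∧ (p : X) ∈ U ∧ ContMDiffOn I J ∞ F U ∧
    ∀ q : S, (q : X) ∈ U → F q = f q

/-- A map from a subset `S` of a manifold to a manifold is a local diffeomorphism. -/
def LocalDiffeoOnSubset {S : Set X} (f : S → Y) : Prop :=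
  SmoothOnSubset I J f ∧
  ∀ p : S, ∃ (U : Set X) (V : Set Y) (k : Y → X), IsOpen U ∧ (p : X) ∈ U ∧ IsOpen V ∧
    ContMDiffOn J I ∞ k V ∧
    (∀ q : S, (q : X) ∈ U → f q ∈ V ∧ k (f q) = q) ∧
    (∀ y ∈ V, k y ∈ U ∧ ∃ h : k y ∈ S, f ⟨k y, h⟩ = y)

/-- A map between subsets of manifolds is a diffeomorphism. -/
def DiffeoOnSubset {S : Set X} {T : Set Y} (f : S → T) : Prop :=
  SmoothOnSubset I J (fun q => (f q : Y)) ∧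
  ∃ k : T → S, Function.LeftInverse k f ∧ Function.RightInverse k f ∧
    SmoothOnSubset J I (fun q => (k q : X))

end Subsets

/-- An étale Lie groupoid with space of objects `M` and space of arrows `Γ`, which need not be
Hausdorff. -/
@[ext]
structure EtaleLieGroupoid (E M Γ : Type*) [NormedAddCommGroup E] [NormedSpace ℝ E]
    [TopologicalSpace M] [ChartedSpace E M] [TopologicalSpace Γ] [ChartedSpace E Γ] where
  isManifold : IsManifold 𝓘(ℝ, E) ∞ Γ
  src : Γ → M
  tgt : Γ → M
  /-- the product `g' g` of the arrows `g'` and `g` with `s(g') = t(g)` -/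
  mul : (g' g : Γ) → src g' = tgt g → Γ
  uni : M → Γ
  inv : Γ → Γ
  src_mul : ∀ g' g h, src (mul g' g h) = src g
  tgt_mul : ∀ g' g h, tgt (mul g' g h) = tgt g'
  mul_assoc : ∀ g'' g' g (h' : src g'' = tgt g') (h : src g' = tgt g),
    mul (mul g'' g' h') g ((src_mul _ _ _).trans h) =
      mul g'' (mul g' g h) (h'.trans (tgt_mul _ _ _).symm)
  src_uni : ∀ x, src (uni x) = x
  tgt_uni : ∀ x, tgt (uni x) = x
  uni_mul : ∀ g, mul (uni (tgt g)) g (src_uni _) = g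
  mul_uni : ∀ g, mul g (uni (src g)) (tgt_uni _).symm = g
  src_inv : ∀ g, src (inv g) = tgt g
  tgt_inv : ∀ g, tgt (inv g) = src g
  inv_mul : ∀ g, mul (inv g) g (src_inv g) = uni (src g)
  mul_inv : ∀ g, mul g (inv g) (tgt_inv g).symm = uni (tgt g)
  src_etale : IsLocalDiffeomorph 𝓘(ℝ, E) 𝓘(ℝ, E) ∞ src
  tgt_etale : IsLocalDiffeomorph 𝓘(ℝ, E) 𝓘(ℝ, E) ∞ tgt
  uni_etale : IsLocalDiffeomorph 𝓘(ℝ, E) 𝓘(ℝ, E) ∞ uni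
  inv_etale : IsLocalDiffeomorph 𝓘(ℝ, E) 𝓘(ℝ, E) ∞ inv
  mul_etale : LocalDiffeoOnSubset (𝓘(ℝ, E).prod 𝓘(ℝ, E)) 𝓘(ℝ, E)
    (S := {q : Γ × Γ | src q.1 = tgt q.2}) (fun q => mul q.1.1 q.1.2 q.2)
  t2_fiber : ∀ x : M, T2Space (src ⁻¹' {x})

/-- A principal `H`-bundle over `G` with total space `P`, which need not be Hausdorff: a left action
`lact` of `G` along the surjective submersion `π` and a right action `ract` of `H` along `φ`, which
commute, such that `(p, h) ↦ (p, p · h)` is a diffeomorphism of fibre products. -/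
@[ext]
structure PrincipalBundle {E M Γ E' N Λ : Type*}
    [NormedAddCommGroup E] [NormedSpace ℝ E] [TopologicalSpace M] [ChartedSpace E M]
    [TopologicalSpace Γ] [ChartedSpace E Γ]
    [NormedAddCommGroup E'] [NormedSpace ℝ E'] [TopologicalSpace N] [ChartedSpace E' N]
    [TopologicalSpace Λ] [ChartedSpace E' Λ]
    (G : EtaleLieGroupoid E M Γ) (H : EtaleLieGroupoid E' N Λ) (F P : Type*)
    [NormedAddCommGroup F] [NormedSpace ℝ F] [TopologicalSpace P] [ChartedSpace F P] where
  isManifold : IsManifold 𝓘(ℝ, F) ∞ P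
  π : P → M
  φ : P → N
  lact : (g : Γ) → (p : P) → G.src g = π p → P
  ract : (p : P) → (h : Λ) → φ p = H.tgt h → P
  π_surjective : Function.Surjective π
  π_submersion : Manifold.IsSubmersion 𝓘(ℝ, F) 𝓘(ℝ, E) ∞ π
  φ_smooth : ContMDiff 𝓘(ℝ, F) 𝓘(ℝ, E') ∞ φ
  lact_smooth : SmoothOnSubset (𝓘(ℝ, E).prod 𝓘(ℝ, F)) 𝓘(ℝ, F)
    (S := {q : Γ × P | G.src q.1 = π q.2}) (fun q => lact q.1.1 q.1.2 q.2)
  ract_smooth : SmoothOnSubset (𝓘(ℝ, F).prod 𝓘(ℝ, E')) 𝓘(ℝ, F)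
    (S := {q : P × Λ | φ q.1 = H.tgt q.2}) (fun q => ract q.1.1 q.1.2 q.2)
  π_lact : ∀ g p e, π (lact g p e) = G.tgt g
  uni_lact : ∀ p, lact (G.uni (π p)) p (G.src_uni _) = p
  lact_lact : ∀ g' g p (e' : G.src g' = G.tgt g) (e : G.src g = π p),
    lact g' (lact g p e) (e'.trans (π_lact _ _ _).symm) =
      lact (G.mul g' g e') p ((G.src_mul _ _ _).trans e)
  φ_ract : ∀ p h e, φ (ract p h e) = H.src h
  ract_uni : ∀ p, ract p (H.uni (φ p)) (H.tgt_uni _).symm = p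
  ract_ract : ∀ p h h' (e : φ p = H.tgt h) (e' : H.src h = H.tgt h'),
    ract (ract p h e) h' ((φ_ract _ _ _).trans e') =
      ract p (H.mul h h' e') (e.trans (H.tgt_mul _ _ _).symm)
  φ_lact : ∀ g p e, φ (lact g p e) = φ p
  π_ract : ∀ p h e, π (ract p h e) = π p
  lact_ract : ∀ g p h (e : G.src g = π p) (e' : φ p = H.tgt h),
    lact g (ract p h e') (e.trans (π_ract _ _ _).symm) =
      ract (lact g p e) h ((φ_lact _ _ _).trans e')
  diffeo : DiffeoOnSubset (𝓘(ℝ, F).prod 𝓘(ℝ, E')) (𝓘(ℝ, F).prod 𝓘(ℝ, F))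
    (S := {q : P × Λ | φ q.1 = H.tgt q.2}) (T := {q : P × P | π q.1 = π q.2})
    (fun q => ⟨(q.1.1, ract q.1.1 q.1.2 q.2), (π_ract _ _ _).symm⟩)

end Groupoids

/-! ### The spectral groupoid and the principal bundle of a bimodule -/

section Spectral

variable {𝕜 : Type*} [RCLike 𝕜]
  {E : Type*} [NormedAddCommGroup E] [NormedSpace ℝ E] [FiniteDimensional ℝ E]
  {M : Type*} [TopologicalSpace M] [T2Space M] [ChartedSpace E M] [IsManifold 𝓘(ℝ, E) ∞ M]
  {A : Type*} [NonUnitalRing A] [Module 𝕜 A] [IsScalarTower 𝕜 A A] [SMulCommClass 𝕜 A A]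
  [Module (CcU 𝕜 E M) A] [IsScalarTower 𝕜 (CcU 𝕜 E M) A] [Coalgebra (CcU 𝕜 E M) A]

/-- The étale Lie groupoid `G` over `M`, with the spectral sheaf of `A` as the space of arrows, is
the spectral groupoid of the Hopf algebroid `A`. -/
structure HopfAlgebroid.IsSpectralGroupoid (𝓐 : HopfAlgebroid 𝕜 (Cc 𝕜 E M) A)
    (G : EtaleLieGroupoid E M (SpectralSheaf 𝕜 E M A)) : Prop where
  /-- every arrow is represented by an `S`-invariant weakly grouplike element -/
  exists_isGermOf : ∀ g : SpectralSheaf 𝕜 E M A, ∃ a : A, 𝓐.SInvariant a ∧ g.IsGermOf a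
  tgt_eq : ∀ g, G.tgt g = g.pt
  /-- an `S`-invariant weakly grouplike element `a`, normalised on `W`, induces a diffeomorphism
  `τ` onto `W` with `u a = a (u ∘ τ)` for all `u` with compact support in `W`, and the source of the
  arrow `a_y` is the preimage of `y` along `τ` -/
  src_eq : ∀ (a : A) (W : Set M), 𝓐.SInvariant a → IsOpen W → NormalisedOn 𝕜 E a W →
    ∃ τ : OpenPartialHomeomorph M M, τ.target = W ∧
      ContMDiffOn 𝓘(ℝ, E) 𝓘(ℝ, E) ∞ τ τ.source ∧
      ContMDiffOn 𝓘(ℝ, E) 𝓘(ℝ, E) ∞ τ.symm τ.target ∧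
      (∀ u u' : Cc 𝕜 E M, tsupport (u : M → 𝕜) ⊆ W →
        EqOn (u' : M → 𝕜) ((u : M → 𝕜) ∘ τ) τ.source →
        (∀ x, x ∉ τ.source → (u' : M → 𝕜) x = 0) → 𝓐.incl u * a = a * 𝓐.incl u') ∧
      ∀ g : SpectralSheaf 𝕜 E M A, g.pt ∈ W → g.val = germAt 𝕜 E g.pt a →
        G.src g = τ.symm g.pt
  mul_eq : ∀ (a' a : A) (g' g : SpectralSheaf 𝕜 E M A) (h : G.src g' = G.tgt g),
    𝓐.SInvariant a' → 𝓐.SInvariant a → g'.IsGermOf a' → g.IsGermOf a →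
      (G.mul g' g h).IsGermOf (a' * a)
  uni_eq : ∀ (x : M) (u : Cc 𝕜 E M), (∀ᶠ y in 𝓝 x, (u : M → 𝕜) y = 1) →
    (G.uni x).IsGermOf (𝓐.incl u)
  inv_eq : ∀ (a : A) (g : SpectralSheaf 𝕜 E M A), 𝓐.SInvariant a → g.IsGermOf a →
    (G.inv g).IsGermOf (𝓐.antipode a)

variable {E' : Type*} [NormedAddCommGroup E'] [NormedSpace ℝ E'] [FiniteDimensional ℝ E']
  {N : Type*} [TopologicalSpace N] [T2Space N] [ChartedSpace E' N] [IsManifold 𝓘(ℝ, E') ∞ N]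
  {B : Type*} [NonUnitalRing B] [Module 𝕜 B] [IsScalarTower 𝕜 B B] [SMulCommClass 𝕜 B B]
  [Module (CcU 𝕜 E' N) B] [IsScalarTower 𝕜 (CcU 𝕜 E' N) B] [Coalgebra (CcU 𝕜 E' N) B]
  {X : Type*} [AddCommGroup X] [Module 𝕜 X]
  [Module (CcU 𝕜 E M) X] [IsScalarTower 𝕜 (CcU 𝕜 E M) X] [Coalgebra (CcU 𝕜 E M) X]

/-- The principal `H`-bundle `P` over `G`, with the spectral sheaf of the bimodule `X` as the total
space, has the projection of the spectral sheaf, the moment map of `X` and the actions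
`a_y · m_x = (am)_y` and `m_x · b_z = (mb)_x` as its structure maps. -/
structure PreprincipalBimodule.IsSpectralBundle {𝓐 : HopfAlgebroid 𝕜 (Cc 𝕜 E M) A}
    {𝓑 : HopfAlgebroid 𝕜 (Cc 𝕜 E' N) B}
    (𝓧 : PreprincipalBimodule 𝓐.toBialgebroid 𝓑.toBialgebroid X)
    {G : EtaleLieGroupoid E M (SpectralSheaf 𝕜 E M A)}
    {H : EtaleLieGroupoid E' N (SpectralSheaf 𝕜 E' N B)}
    (P : PrincipalBundle G H E (SpectralSheaf 𝕜 E M X)) : Prop where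
  π_eq : ∀ p, P.π p = p.pt
  /-- the moment map is determined by `ε(m v)(x) = v(φ(m_x))` -/
  φ_eq : ∀ (m : X) (p : SpectralSheaf 𝕜 E M X) (v : Cc 𝕜 E' N),
    WeaklyGrouplike (CcU 𝕜 E M) m → p.IsGermOf m →
      (counitR 𝕜 (Cc 𝕜 E M) (𝓧.ract (𝓑.incl v) m) : M → 𝕜) p.pt = (v : N → 𝕜) (P.φ p)
  lact_eq : ∀ (a : A) (m : X) (g : SpectralSheaf 𝕜 E M A) (p : SpectralSheaf 𝕜 E M X)
    (e : G.src g = P.π p), 𝓐.SInvariant a → WeaklyGrouplike (CcU 𝕜 E M) m →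
      g.IsGermOf a → p.IsGermOf m → (P.lact g p e).IsGermOf (𝓧.lact a m)
  ract_eq : ∀ (b : B) (m : X) (p : SpectralSheaf 𝕜 E M X) (h : SpectralSheaf 𝕜 E' N B)
    (e : P.φ p = H.tgt h), 𝓑.SInvariant b → WeaklyGrouplike (CcU 𝕜 E M) m →
      p.IsGermOf m → h.IsGermOf b → (P.ract p h e).IsGermOf (𝓧.ract b m)

end Spectral

/-!
The proof rests on three facts about the localisations of the algebras and of the bimodule.

*Moment maps.* If `m` is weakly grouplike, `Δ(m) = m ⊗ m'`, then comparing the two right actions of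
`v ∈ Cc N` on `Δ(m)` and applying the counit gives `m v = ε(m' v) m`: on weakly grouplike elements
the right multiplication by a function is the left multiplication by another function. Hence, for
`m` normalised near `x`, the map `v ↦ ε(m v)(x)` is a non-zero character of `Cc N`. Such a character
is the evaluation at a point (`Cc.exists_eq_eval`), which defines the moment map
`φ(m_x)` (`PreprincipalBimodule.moment`); it is smooth because `v ∘ φ` is locally `ε(m v)` for every
`v` (`contMDiffAt_of_forall_Cc`). It follows that `(mb)_x` depends only on `m_x` and on the germ of
`b` at `φ(m_x)` (`germAt_ract_congr`), and similarly for `am`, so that the two actions are well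
defined on spectral sheaves. They are smooth because they are locally given by the germs of a single
weakly grouplike element. A bialgebroid is a bimodule over itself, and the same results applied to
this bimodule give the source map and the multiplication of the spectral groupoid.

*Spectral groupoids.* The ring of smooth germs has no idempotents besides `0` and `1`. Therefore a
basis of `A_y` consisting of grouplike elements contains all grouplike elements
(`FreelyGenerates.mem_of_isGroupLikeElem`), and every arrow of the spectral sheaf has an
`S`-invariant weakly grouplike representative `a`. The antipode `S(a)` then provides the
inverse of the map `y ↦ φ(a_y)` (`SInvariant.sourceHomeo`), which is thus a local diffeomorphism,
and the inverse arrow. The source map of any spectral groupoid has to agree with the moment map,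
since functions with small support separate points, and this gives uniqueness.

*Principality.* If `Δ(m) = m ⊗ m'`, the canonical map sends `m ⊗ b` to `m ⊗ m' b`. Locally at `x`
its values are spanned by the tensors `m_x ⊗ n_x` with `n_x` in the orbit of `m_x`. These tensors belong
to the basis of `(X ⊗ X)_x` formed by all the tensors of two grouplike elements, so the surjectivity
of the canonical map makes the action transitive on the fibres (`IsPrincipal.exists_sheafRact_eq`).
The injectivity makes it free (`IsPrincipal.sheafRact_injective`): products of coordinate
functionals, evaluated at `x` and `φ(m_x)`, are defined on the tensor product over `Cc N` and
separate the arrows. The inverse of `(p, h) ↦ (p, p · h)` is smooth since it is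
given by local sections of the spectral sheaf of `B`.
-/

/-! ### Instances -/

section SpectralTheory

-- The following instances can be inferred, but only after a long search through the instances for
-- unital algebras.

local instance (priority := high) isScalarTowerCc {𝕜 : Type*} [RCLike 𝕜]
    {E : Type*} [NormedAddCommGroup E] [NormedSpace ℝ E]
    {M : Type*} [TopologicalSpace M] [ChartedSpace E M] :
    IsScalarTower 𝕜 (Cc 𝕜 E M) (Cc 𝕜 E M) := inferInstance

local instance (priority := high) smulCommClassCc {𝕜 : Type*} [RCLike 𝕜]
    {E : Type*} [NormedAddCommGroup E] [NormedSpace ℝ E]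
    {M : Type*} [TopologicalSpace M] [ChartedSpace E M] :
    SMulCommClass 𝕜 (Cc 𝕜 E M) (Cc 𝕜 E M) := inferInstance

local instance addCommMonoidCc {𝕜 : Type*} [RCLike 𝕜]
    {E : Type*} [NormedAddCommGroup E] [NormedSpace ℝ E]
    {M : Type*} [TopologicalSpace M] [ChartedSpace E M] :
    AddCommMonoid (Cc 𝕜 E M) := inferInstance

local instance addMonoidCc {𝕜 : Type*} [RCLike 𝕜]
    {E : Type*} [NormedAddCommGroup E] [NormedSpace ℝ E]
    {M : Type*} [TopologicalSpace M] [ChartedSpace E M] :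
    AddMonoid (Cc 𝕜 E M) := inferInstance

local instance addZeroClassCc {𝕜 : Type*} [RCLike 𝕜]
    {E : Type*} [NormedAddCommGroup E] [NormedSpace ℝ E]
    {M : Type*} [TopologicalSpace M] [ChartedSpace E M] :
    AddZeroClass (Cc 𝕜 E M) := inferInstance

local instance moduleCcU {𝕜 : Type*} [RCLike 𝕜]
    {E : Type*} [NormedAddCommGroup E] [NormedSpace ℝ E]
    {M : Type*} [TopologicalSpace M] [ChartedSpace E M] :
    Module 𝕜 (CcU 𝕜 E M) := inferInstance

local instance smulCcU {𝕜 : Type*} [RCLike 𝕜]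
    {E : Type*} [NormedAddCommGroup E] [NormedSpace ℝ E]
    {M : Type*} [TopologicalSpace M] [ChartedSpace E M] :
    SMul 𝕜 (CcU 𝕜 E M) := inferInstance

local instance smulOfModuleCcU {𝕜 : Type*} [RCLike 𝕜]
    {E : Type*} [NormedAddCommGroup E] [NormedSpace ℝ E]
    {M : Type*} [TopologicalSpace M] [ChartedSpace E M]
    {X : Type*} [AddCommGroup X] [Module (CcU 𝕜 E M) X] : SMul (CcU 𝕜 E M) X := inferInstance

/-! ### Characters of `Cc M` and smooth maps -/

section Characters

variable {𝕜 : Type*} [RCLike 𝕜]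
  {E : Type*} [NormedAddCommGroup E] [NormedSpace ℝ E]
  {M : Type*} [TopologicalSpace M] [ChartedSpace E M]

@[simp]
theorem CcU.toFun_inr (u : Cc 𝕜 E M) (y : M) : CcU.toFun (u : CcU 𝕜 E M) y = (u : M → 𝕜) y := by
  simp [CcU.toFun]

theorem Cc.contMDiff (u : Cc 𝕜 E M) : ContMDiff 𝓘(ℝ, E) 𝓘(ℝ, 𝕜) ∞ (u : M → 𝕜) := u.2.1

theorem Cc.ext {u v : Cc 𝕜 E M} (h : ∀ y, (u : M → 𝕜) y = (v : M → 𝕜) y) : u = v :=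
  Subtype.ext (funext h)

@[simp]
theorem Cc.mul_apply (u v : Cc 𝕜 E M) (y : M) :
    ((u * v : Cc 𝕜 E M) : M → 𝕜) y = (u : M → 𝕜) y * (v : M → 𝕜) y := rfl

@[simp]
theorem Cc.add_apply (u v : Cc 𝕜 E M) (y : M) :
    ((u + v : Cc 𝕜 E M) : M → 𝕜) y = (u : M → 𝕜) y + (v : M → 𝕜) y := rfl

@[simp]
theorem Cc.smul_apply (c : 𝕜) (u : Cc 𝕜 E M) (y : M) :
    ((c • u : Cc 𝕜 E M) : M → 𝕜) y = c * (u : M → 𝕜) y := rfl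

/-- The complex conjugate of a compactly supported function. -/
def Cc.conj (u : Cc 𝕜 E M) : Cc 𝕜 E M :=
  ⟨fun y => (starRingEnd 𝕜) ((u : M → 𝕜) y),
    (RCLike.conjCLE (K := 𝕜)).contDiff.contMDiff.comp u.2.1,
    u.2.2.comp_left (map_zero _)⟩

theorem Cc.conj_mul_self_apply (u : Cc 𝕜 E M) (y : M) :
    ((Cc.conj u * u : Cc 𝕜 E M) : M → 𝕜) y = ((‖(u : M → 𝕜) y‖ ^ 2 : ℝ) : 𝕜) := by
  rw [Cc.mul_apply]
  exact (RCLike.conj_mul _).trans (by push_cast; rfl)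

/-- Division by a function without zeros on the support of `u`. -/
theorem Cc.exists_mul_eq [T2Space M] (u F : Cc 𝕜 E M)
    (hF : ∀ y ∈ tsupport (u : M → 𝕜), (F : M → 𝕜) y ≠ 0) : ∃ q : Cc 𝕜 E M, q * F = u := by
  refine ⟨⟨fun y => (u : M → 𝕜) y * ((F : M → 𝕜) y)⁻¹, ?_, ?_⟩, ?_⟩
  · intro y
    by_cases hy : y ∈ tsupport (u : M → 𝕜)
    · refine contMDiffAt_mul (u.2.1 y) ?_
      exact ((contDiffAt_inv (𝕜 := ℝ) (hF y hy) (n := ∞)).contMDiffAt).comp y (F.2.1 y)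
    · have : (fun y => (u : M → 𝕜) y * ((F : M → 𝕜) y)⁻¹) =ᶠ[𝓝 y] fun _ => 0 := by
        filter_upwards [(isClosed_tsupport (u : M → 𝕜)).isOpen_compl.mem_nhds hy] with z hz
        rw [image_eq_zero_of_notMem_tsupport hz, zero_mul]
      exact contMDiffAt_const.congr_of_eventuallyEq this
  · exact HasCompactSupport.mul_right (f := (u : M → 𝕜)) (f' := fun y => ((F : M → 𝕜) y)⁻¹) u.2.2
  · refine Cc.ext fun y => ?_
    rw [Cc.mul_apply]
    by_cases hy : y ∈ tsupport (u : M → 𝕜)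
    · exact inv_mul_cancel_right₀ (hF y hy) _
    · have := image_eq_zero_of_notMem_tsupport hy
      simp [this]

variable [FiniteDimensional ℝ E] [IsManifold 𝓘(ℝ, E) ∞ M] [T2Space M]

theorem Cc.exists_eventually_one (x : M) {U : Set M} (hU : U ∈ 𝓝 x) :
    ∃ u : Cc 𝕜 E M, (∀ᶠ y in 𝓝 x, (u : M → 𝕜) y = 1) ∧ tsupport (u : M → 𝕜) ⊆ U := by
  have := ChartedSpace.locallyCompactSpace E M
  obtain ⟨K, hK, hKc, hKU⟩ := exists_mem_nhds_isClosed_subset hU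
  obtain ⟨u, hu, hu'⟩ := exists_Cc_eventuallyEq (𝕜 := 𝕜) (E := E) x (fun _ => 1) K hK
    (Eventually.of_forall fun _ => contMDiffAt_const)
  exact ⟨u, hu, (closure_minimal (fun y hy => hu' y hy) hKc).trans hKU⟩

theorem Cc.exists_eq_one (x : M) : ∃ u : Cc 𝕜 E M, ∀ᶠ y in 𝓝 x, (u : M → 𝕜) y = 1 :=
  let ⟨u, hu, _⟩ := Cc.exists_eventually_one (𝕜 := 𝕜) (E := E) x univ_mem
  ⟨u, hu⟩

variable (𝕜 E) in
/-- Compactly supported functions separate the points. -/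
theorem Cc.eq_of_forall_apply_eq {x y : M}
    (h : ∀ u : Cc 𝕜 E M, (u : M → 𝕜) x = (u : M → 𝕜) y) : x = y := by
  by_contra hxy
  obtain ⟨u, hu, hu'⟩ := Cc.exists_eventually_one (𝕜 := 𝕜) (E := E) x
    (isOpen_compl_singleton.mem_nhds hxy)
  have h1 : (u : M → 𝕜) y = 0 := image_eq_zero_of_notMem_tsupport fun hy => hu' hy rfl
  have h2 := hu.self_of_nhds
  rw [h u, h1] at h2
  exact zero_ne_one h2

/-- A nonzero character of `Cc M` is the evaluation at a point. Otherwise, for each point of the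
support of a function `w` with `χ w = 1`, some element of the kernel of `χ` would not vanish at
this point; a finite sum `F` of the squares of the absolute values of such elements has no zeros on
the support of `w`, so `w` is divisible by `F` and lies in the kernel. -/
theorem Cc.exists_eq_eval (χ : Cc 𝕜 E M →ₗ[𝕜] 𝕜) (hmul : ∀ u v, χ (u * v) = χ u * χ v)
    (hne : ∃ u, χ u ≠ 0) : ∃ x : M, ∀ u, χ u = (u : M → 𝕜) x := by
  by_contra! hcon
  have hker : ∀ x : M, ∃ g : Cc 𝕜 E M, χ g = 0 ∧ (g : M → 𝕜) x ≠ 0 := by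
    intro x
    obtain ⟨f, hf⟩ := hcon x
    obtain ⟨w, hw⟩ := Cc.exists_eq_one (𝕜 := 𝕜) (E := E) x
    refine ⟨f * w - χ f • w, by simp [hmul], ?_⟩
    simp [hw.self_of_nhds, sub_ne_zero, Ne.symm hf]
  obtain ⟨w, hw⟩ := hne
  choose g hg hgx using hker
  obtain ⟨t, ht⟩ := w.2.2.elim_nhds_subcover (fun x => {y | (g x : M → 𝕜) y ≠ 0})
    fun x _ => (g x).2.1.continuous.isOpen_preimage _ isOpen_compl_singleton |>.mem_nhds (hgx x)
  obtain ⟨q, hq⟩ := Cc.exists_mul_eq w (∑ x ∈ t, Cc.conj (g x) * g x) fun y hy => by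
    obtain ⟨x, hxt, hx⟩ := mem_iUnion₂.1 (ht.2 hy)
    have hsum : ((∑ x ∈ t, Cc.conj (g x) * g x : Cc 𝕜 E M) : M → 𝕜) y =
        ((∑ x ∈ t, ‖(g x : M → 𝕜) y‖ ^ 2 : ℝ) : 𝕜) := by
      push_cast
      rw [Finset.sum_apply]
      refine Finset.sum_congr rfl fun z _ => (Cc.conj_mul_self_apply (g z) y).trans ?_
      push_cast; rfl
    rw [hsum, Ne, RCLike.ofReal_eq_zero]
    refine (Finset.sum_pos' (fun z _ => sq_nonneg _) ⟨x, hxt, ?_⟩).ne'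
    exact pow_pos (norm_pos_iff.2 hx) 2
  refine hw ?_
  rw [← hq, hmul, map_sum, Finset.sum_eq_zero (fun x _ => ?_), mul_zero]
  rw [hmul, hg, mul_zero]

variable {E₁ : Type*} [NormedAddCommGroup E₁] [NormedSpace ℝ E₁]
  {M₁ : Type*} [TopologicalSpace M₁] [ChartedSpace E₁ M₁]

/-- A map into a manifold is smooth if its compositions with the compactly supported smooth
functions are smooth. -/
theorem contMDiffAt_of_forall_Cc {f : M₁ → M} {x : M₁}
    (h : ∀ v : Cc 𝕜 E M, ContMDiffAt 𝓘(ℝ, E₁) 𝓘(ℝ, 𝕜) ∞ (fun y => (v : M → 𝕜) (f y)) x) :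
    ContMDiffAt 𝓘(ℝ, E₁) 𝓘(ℝ, E) ∞ f x := by
  have hcont : ContinuousAt f x := by
    intro U hU
    obtain ⟨v, hv, hvU⟩ := Cc.exists_eventually_one (𝕜 := 𝕜) (E := E) (f x) hU
    have h1 : ∀ᶠ y in 𝓝 x, (v : M → 𝕜) (f y) ≠ 0 := by
      refine (h v).continuousAt.eventually_ne ?_
      rw [hv.self_of_nhds]; exact one_ne_zero
    refine mem_map.2 ?_
    filter_upwards [h1] with y hy
    exact hvU (subset_tsupport _ hy)
  refine contMDiffAt_iff_target.2 ⟨hcont, ?_⟩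
  let b := Module.finBasis ℝ E
  have hcoord : ∀ i, ∃ v : Cc 𝕜 E M,
      ∀ᶠ z in 𝓝 (f x), (v : M → 𝕜) z = ((b.coord i (extChartAt 𝓘(ℝ, E) (f x) z) : ℝ) : 𝕜) := by
    intro i
    obtain ⟨v, hv, -⟩ := exists_Cc_eventuallyEq (𝕜 := 𝕜) (E := E) (f x)
      (fun z => ((b.coord i (extChartAt 𝓘(ℝ, E) (f x) z) : ℝ) : 𝕜)) univ univ_mem (by
        filter_upwards [extChartAt_source_mem_nhds (I := 𝓘(ℝ, E)) (f x)] with z hz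
        rw [extChartAt_source] at hz
        have h1 := contMDiffAt_extChartAt' (I := 𝓘(ℝ, E)) (n := ∞) hz
        have h2 : ContDiff ℝ ∞ fun e : E => ((b.coord i e : ℝ) : 𝕜) :=
          ((RCLike.ofRealCLM (K := 𝕜)).comp (b.coord i).toContinuousLinearMap).contDiff
        exact h2.contMDiff.contMDiffAt.comp z h1)
    exact ⟨v, hv⟩
  choose v hv using hcoord
  have heq : (extChartAt 𝓘(ℝ, E) (f x) ∘ f) =ᶠ[𝓝 x]
      fun y => ∑ i, RCLike.re ((v i : M → 𝕜) (f y)) • b i := by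
    filter_upwards [hcont.eventually (eventually_all.2 hv)] with y hy
    simp only [hy, RCLike.ofReal_re, Function.comp_apply, Module.Basis.coord_apply]
    exact (b.sum_repr _).symm
  refine ContMDiffAt.congr_of_eventuallyEq ?_ heq
  refine ContMDiffAt.sum fun i _ => ?_
  have h2 : ContDiff ℝ ∞ fun c : 𝕜 => RCLike.re c • b i :=
    ((RCLike.reCLM (K := 𝕜)).smulRight (b i)).contDiff
  exact h2.contMDiff.contMDiffAt.comp x (h (v i))

end Characters

/-! ### The smooth structure of the spectral sheaf -/

section SheafSections

variable {𝕜 : Type*} [RCLike 𝕜]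
  {E : Type*} [NormedAddCommGroup E] [NormedSpace ℝ E]
  {M : Type*} [TopologicalSpace M] [ChartedSpace E M]
  {C : Type*} [AddCommGroup C] [Module (CcU 𝕜 E M) C] [Coalgebra (CcU 𝕜 E M) C]

namespace SpectralSheaf

theorem sectionFun_eq {m : C} {W : Set M} (hW : IsOpen W)
    (hm : WeaklyGrouplike (CcU 𝕜 E M) m) (hn : NormalisedOn 𝕜 E m W)
    (p₀ : SpectralSheaf 𝕜 E M C) {x : M} (hx : x ∈ W) :
    sectionFun m W p₀ x = ⟨x, germAt 𝕜 E x m, germAt_mem_grouplikeAt hm hW hx hn⟩ :=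
  dif_pos ⟨hx, germAt_mem_grouplikeAt hm hW hx hn⟩

theorem sectionFun_spec {m : C} {W : Set M} (hW : IsOpen W)
    (hm : WeaklyGrouplike (CcU 𝕜 E M) m) (hn : NormalisedOn 𝕜 E m W)
    (p₀ : SpectralSheaf 𝕜 E M C) {x : M} (hx : x ∈ W) :
    (sectionFun m W p₀ x).pt = x ∧
      (sectionFun m W p₀ x).val = germAt 𝕜 E (sectionFun m W p₀ x).pt m := by
  rw [sectionFun_eq hW hm hn p₀ hx]
  exact ⟨rfl, rfl⟩

theorem sectionFun_pt {m : C} {W : Set M} (hW : IsOpen W)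
    (hm : WeaklyGrouplike (CcU 𝕜 E M) m) (hn : NormalisedOn 𝕜 E m W)
    (p₀ p : SpectralSheaf 𝕜 E M C) (hp : p.pt ∈ W) (h : p.val = germAt 𝕜 E p.pt m) :
    sectionFun m W p₀ p.pt = p := by
  rw [sectionFun_eq hW hm hn p₀ hp]
  obtain ⟨x, ζ, hζ⟩ := p
  exact SpectralSheaf.ext rfl (heq_of_eq h.symm)

theorem eventually_mem_basicSet {m : C} {W : Set M} (hW : IsOpen W)
    (hm : WeaklyGrouplike (CcU 𝕜 E M) m) (hn : NormalisedOn 𝕜 E m W)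
    {p : SpectralSheaf 𝕜 E M C} (hp : p.pt ∈ W) (h : p.val = germAt 𝕜 E p.pt m) :
    ∀ᶠ q : SpectralSheaf 𝕜 E M C in 𝓝 p, q.pt ∈ W ∧ q.val = germAt 𝕜 E q.pt m :=
  (isOpen_basicSet hW hm hn).mem_nhds ⟨hp, h⟩

theorem ext_of_val_eq {p q : SpectralSheaf 𝕜 E M C} {m : C} (h : p.pt = q.pt)
    (hp : p.val = germAt 𝕜 E p.pt m) (hq : q.val = germAt 𝕜 E q.pt m) : p = q := by
  obtain ⟨x, ζ, hζ⟩ := p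
  obtain ⟨y, η, hη⟩ := q
  cases h
  exact SpectralSheaf.ext rfl (heq_of_eq (hp.trans hq.symm))

end SpectralSheaf

end SheafSections

section SheafManifold

variable {𝕜 : Type*} [RCLike 𝕜]
  {E : Type*} [NormedAddCommGroup E] [NormedSpace ℝ E] [FiniteDimensional ℝ E]
  {M : Type*} [TopologicalSpace M] [T2Space M] [ChartedSpace E M] [IsManifold 𝓘(ℝ, E) ∞ M]
  {C : Type*} [AddCommGroup C] [Module (CcU 𝕜 E M) C] [Coalgebra (CcU 𝕜 E M) C]

namespace SpectralSheaf

instance : IsManifold 𝓘(ℝ, E) ∞ (SpectralSheaf 𝕜 E M C) := by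
  refine isManifold_of_contDiffOn _ _ _ ?_
  rintro _ _ ⟨f, c, hf, hc, rfl⟩ ⟨f', c', hf', hc', rfl⟩
  have hcc : ContDiffOn ℝ ∞ (c.symm ≫ₕ c') (c.symm ≫ₕ c').source := by
    have h := (mem_groupoid_of_pregroupoid.1
      ((contDiffGroupoid ∞ 𝓘(ℝ, E)).compatible hc hc')).1
    simpa [contDiffPregroupoid] using h
  have key : ∀ y ∈ ((f.trans c).symm ≫ₕ (f'.trans c')).source,
      y ∈ (c.symm ≫ₕ c').source ∧ ((f.trans c).symm ≫ₕ (f'.trans c')) y = (c.symm ≫ₕ c') y := by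
    intro y hy
    simp only [mfld_simps] at hy ⊢
    have h1 : f (f.symm (c.symm y)) = c.symm y := f.right_inv hy.1.2
    have h2 : f' (f.symm (c.symm y)) = c.symm y := by
      rw [hf'] ; rwa [hf] at h1
    rw [h2] at hy ⊢
    exact ⟨⟨hy.1.1, hy.2.2⟩, rfl⟩
  simp only [modelWithCornersSelf_coe, modelWithCornersSelf_coe_symm, Function.id_comp,
    Function.comp_id, preimage_id, range_id, inter_univ]
  exact (hcc.mono fun y hy => (key y hy).1).congr fun y hy => (key y hy).2

theorem chartAt_apply (p q : SpectralSheaf 𝕜 E M C) : chartAt E p q = chartAt E p.pt q.pt := by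
  have h := (isLocalHomeomorph_pt p).choose_spec
  change chartAt E p.pt ((isLocalHomeomorph_pt p).choose q) = _
  rw [← h.2]

theorem contMDiff_pt :
    ContMDiff 𝓘(ℝ, E) 𝓘(ℝ, E) ∞ (pt : SpectralSheaf 𝕜 E M C → M) := by
  intro p
  refine contMDiffAt_iff_target.2 ⟨continuous_pt.continuousAt, ?_⟩
  refine (contMDiffAt_extChartAt (I := 𝓘(ℝ, E)) (n := ∞) (x := p)).congr_of_eventuallyEq ?_
  refine Eventually.of_forall fun q => ?_
  simp [chartAt_apply]

theorem contMDiffOn_sectionFun {m : C} {W : Set M} (hW : IsOpen W)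
    (hm : WeaklyGrouplike (CcU 𝕜 E M) m) (hn : NormalisedOn 𝕜 E m W)
    (p₀ : SpectralSheaf 𝕜 E M C) :
    ContMDiffOn 𝓘(ℝ, E) 𝓘(ℝ, E) ∞ (sectionFun m W p₀) W := by
  intro x hx
  refine ContMDiffAt.contMDiffWithinAt (contMDiffAt_iff_target.2 ⟨?_, ?_⟩)
  · exact (sectionHomeo m W p₀ hW hm hn).continuousOn_invFun.continuousAt (hW.mem_nhds hx)
  · refine (contMDiffAt_extChartAt (I := 𝓘(ℝ, E)) (n := ∞) (x := x)).congr_of_eventuallyEq ?_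
    filter_upwards [hW.mem_nhds hx] with y hy
    simp [chartAt_apply, sectionFun_eq hW hm hn p₀ hx, sectionFun_eq hW hm hn p₀ hy]

theorem contMDiffAt_sectionFun {m : C} {W : Set M} (hW : IsOpen W)
    (hm : WeaklyGrouplike (CcU 𝕜 E M) m) (hn : NormalisedOn 𝕜 E m W)
    (p₀ : SpectralSheaf 𝕜 E M C) {x : M} (hx : x ∈ W) :
    ContMDiffAt 𝓘(ℝ, E) 𝓘(ℝ, E) ∞ (sectionFun m W p₀) x :=
  (contMDiffOn_sectionFun hW hm hn p₀).contMDiffAt (hW.mem_nhds hx)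

variable (𝕜 E M C) in
theorem isLocalDiffeomorph_pt :
    IsLocalDiffeomorph 𝓘(ℝ, E) 𝓘(ℝ, E) ∞ (pt : SpectralSheaf 𝕜 E M C → M) := by
  intro p
  obtain ⟨m, hm, ⟨W, hW, hpW, hn⟩, hpm⟩ := p.exists_isGermOf
  let e := sectionHomeo m W p hW hm hn
  exact ⟨⟨e.toPartialEquiv, e.open_source, e.open_target, contMDiff_pt.contMDiffOn,
    contMDiffOn_sectionFun hW hm hn p⟩, ⟨hpW, hpm⟩, fun _ _ => rfl⟩

variable (𝕜 E M C) in
theorem isSubmersion_pt :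
    Manifold.IsSubmersion 𝓘(ℝ, E) 𝓘(ℝ, E) ∞ (pt : SpectralSheaf 𝕜 E M C → M) := by
  refine ⟨PUnit, inferInstance, inferInstance, fun p => ?_⟩
  refine Manifold.IsSubmersionAtOfComplement.mk_of_continuousAt continuous_pt.continuousAt
    (ContinuousLinearEquiv.prodUnique ℝ E _).symm (chartAt E p) (chartAt E p.pt)
    (mem_chart_source E p) (mem_chart_source E p.pt)
    (IsManifold.chart_mem_maximalAtlas p) (IsManifold.chart_mem_maximalAtlas p.pt) ?_
  intro y hy
  have h : chartAt E p ((chartAt E p).symm y) = y := (chartAt E p).right_inv (by simpa using hy)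
  rw [chartAt_apply] at h
  simpa using h

end SpectralSheaf

end SheafManifold

/-! ### Weakly grouplike elements of bimodules -/

section WeaklyGrouplikeAlgebra

open TensorProduct (map map₂)
open Coalgebra (comul)

variable {𝕜 : Type*} [Field 𝕜] {R A R' B : Type*}
  [NonUnitalCommRing R] [Module 𝕜 R] [IsScalarTower 𝕜 R R] [SMulCommClass 𝕜 R R]
  [NonUnitalRing A] [Module 𝕜 A] [IsScalarTower 𝕜 A A] [SMulCommClass 𝕜 A A]
  [Module (Unitization 𝕜 R) A] [IsScalarTower 𝕜 (Unitization 𝕜 R) A]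
  [Coalgebra (Unitization 𝕜 R) A]
  [NonUnitalCommRing R'] [Module 𝕜 R'] [IsScalarTower 𝕜 R' R'] [SMulCommClass 𝕜 R' R']
  [NonUnitalRing B] [Module 𝕜 B] [IsScalarTower 𝕜 B B] [SMulCommClass 𝕜 B B]
  [Module (Unitization 𝕜 R') B] [IsScalarTower 𝕜 (Unitization 𝕜 R') B]
  [Coalgebra (Unitization 𝕜 R') B]

@[simp]
theorem toBase_tmul {X Y : Type*}
    [AddCommGroup X] [Module 𝕜 X] [Module (Unitization 𝕜 R) X]
    [IsScalarTower 𝕜 (Unitization 𝕜 R) X]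
    [AddCommGroup Y] [Module 𝕜 Y] [Module (Unitization 𝕜 R) Y]
    [IsScalarTower 𝕜 (Unitization 𝕜 R) Y] (x : X) (y : Y) :
    toBase 𝕜 R (x ⊗ₜ[𝕜] y) = x ⊗ₜ[Unitization 𝕜 R] y := rfl

theorem toBase_surjective {X Y : Type*}
    [AddCommGroup X] [Module 𝕜 X] [Module (Unitization 𝕜 R) X]
    [IsScalarTower 𝕜 (Unitization 𝕜 R) X]
    [AddCommGroup Y] [Module 𝕜 Y] [Module (Unitization 𝕜 R) Y]
    [IsScalarTower 𝕜 (Unitization 𝕜 R) Y] :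
    Function.Surjective (toBase 𝕜 R : X ⊗[𝕜] Y → X ⊗[Unitization 𝕜 R] Y) := by
  intro z
  induction z with
  | zero => exact ⟨0, map_zero _⟩
  | tmul x y => exact ⟨x ⊗ₜ y, rfl⟩
  | add a b ha hb =>
    obtain ⟨s, rfl⟩ := ha
    obtain ⟨t, rfl⟩ := hb
    exact ⟨s + t, map_add _ _ _⟩

theorem inr_smul_inr_smul {X : Type*} [AddCommGroup X] [Module (Unitization 𝕜 R) X]
    (r s : R) (m : X) :
    (r : Unitization 𝕜 R) • (s : Unitization 𝕜 R) • m = ((r * s : R) : Unitization 𝕜 R) • m := by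
  rw [smul_smul, Unitization.inr_mul]

section Counit

variable {X : Type*} [AddCommGroup X] [Module (Unitization 𝕜 R) X] [Coalgebra (Unitization 𝕜 R) X]

theorem counitR_add (m n : X) : counitR 𝕜 R (m + n) = counitR 𝕜 R m + counitR 𝕜 R n := by
  simp [counitR]

theorem counitR_smul [Module 𝕜 X] [IsScalarTower 𝕜 (Unitization 𝕜 R) X] (c : 𝕜) (m : X) :
    counitR 𝕜 R (c • m) = c • counitR 𝕜 R m := by
  have h : c • m = (algebraMap 𝕜 (Unitization 𝕜 R) c) • m := (algebraMap_smul _ c m).symm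
  rw [counitR, counitR, h, map_smul]
  simp [Unitization.algebraMap_eq_inl]

/-- Both counit axioms for an element with decomposable comultiplication. -/
theorem counit_smul_of_comul_eq_tmul {m p q : X}
    (h : comul (R := Unitization 𝕜 R) m = p ⊗ₜ[Unitization 𝕜 R] q) :
    Coalgebra.counit (R := Unitization 𝕜 R) p • q = m ∧
      Coalgebra.counit (R := Unitization 𝕜 R) q • p = m := by
  constructor
  · have := Coalgebra.rTensor_counit_comul (R := Unitization 𝕜 R) m
    rw [h, LinearMap.rTensor_tmul] at this
    simpa using congrArg (TensorProduct.lid (Unitization 𝕜 R) X) this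
  · have := Coalgebra.lTensor_counit_comul (R := Unitization 𝕜 R) m
    rw [h, LinearMap.lTensor_tmul] at this
    simpa using congrArg (TensorProduct.rid (Unitization 𝕜 R) X) this

end Counit

/-- An algebra with a bialgebroid structure, as a bimodule over itself. -/
def Bialgebroid.selfBimodule (𝓐 : Bialgebroid 𝕜 R A) : PreprincipalBimodule 𝓐 𝓐 A where
  lact := LinearMap.mul 𝕜 A
  ract := (LinearMap.mul 𝕜 A).flip
  mul_lact a a' m := mul_assoc a a' m
  mul_ract b b' m := (mul_assoc m b b').symm
  lact_ract a b m := (mul_assoc a m b).symm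
  smul_eq := 𝓐.smul_eq
  local_unitary s := by
    obtain ⟨u, hu⟩ := 𝓐.local_identities s
    exact ⟨u, u, fun m hm => hu m hm⟩
  comul_right m v t ht := 𝓐.comul_right m v t ht
  counit_ract m b := 𝓐.counit_mul m b
  counit_lact a m := 𝓐.counit_mul a m
  comul_lact a m s t hs ht := 𝓐.comul_mul a m s t hs ht
  comul_ract m b t s ht hs := by
    refine (𝓐.comul_mul m b t s ht hs).trans (congrArg _ ?_)
    clear hs ht
    induction t with
    | zero => simp
    | add t t' h h' => rw [map_add, LinearMap.add_apply, h, h', map_add]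
    | tmul m₁ m₂ =>
      induction s with
      | zero => simp
      | add s s' h h' => rw [map_add, h, h', map_add, LinearMap.add_apply]
      | tmul b₁ b₂ => simp

namespace PreprincipalBimodule

variable {𝓐 : Bialgebroid 𝕜 R A} {𝓑 : Bialgebroid 𝕜 R' B} {X : Type*}
  [AddCommGroup X] [Module 𝕜 X] [Module (Unitization 𝕜 R) X]
  [IsScalarTower 𝕜 (Unitization 𝕜 R) X] [Coalgebra (Unitization 𝕜 R) X]
  (𝓧 : PreprincipalBimodule 𝓐 𝓑 X)

include 𝓧 in
theorem counit_eq (m : X) : Coalgebra.counit (R := Unitization 𝕜 R) m = (counitR 𝕜 R m : R) := by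
  obtain ⟨u, _, h⟩ := 𝓧.local_unitary {m}
  exact counit_eq_inr m ⟨u, (𝓧.smul_eq u m).trans (h m (by simp)).1⟩

include 𝓧 in
theorem counitR_smul_of_comul_eq_tmul {m p q : X}
    (h : comul (R := Unitization 𝕜 R) m = p ⊗ₜ[Unitization 𝕜 R] q) :
    ((counitR 𝕜 R p : R) : Unitization 𝕜 R) • q = m ∧
      ((counitR 𝕜 R q : R) : Unitization 𝕜 R) • p = m := by
  rw [← 𝓧.counit_eq, ← 𝓧.counit_eq]
  exact counit_smul_of_comul_eq_tmul h

include 𝓧 in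
theorem counitR_inr_smul (r : R) (m : X) :
    counitR 𝕜 R ((r : Unitization 𝕜 R) • m) = r * counitR 𝕜 R m := by
  rw [counitR, map_smul, 𝓧.counit_eq]
  simp

theorem ract_inr_smul (b : B) (r : R) (m : X) :
    𝓧.ract b ((r : Unitization 𝕜 R) • m) = (r : Unitization 𝕜 R) • 𝓧.ract b m := by
  rw [𝓧.smul_eq, 𝓧.smul_eq, 𝓧.lact_ract]

theorem inr_smul_lact (r : R) (a : A) (m : X) :
    (r : Unitization 𝕜 R) • 𝓧.lact a m = 𝓧.lact ((r : Unitization 𝕜 R) • a) m := by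
  rw [𝓧.smul_eq, 𝓐.smul_eq, 𝓧.mul_lact]

/-- There is a right local identity of `m` which is also an identity of `v`. -/
theorem exists_ract_eq_and_mul_eq (m : X) (v : R') :
    ∃ e : R', 𝓧.ract (𝓑.incl e) m = m ∧ e * v = v := by
  obtain ⟨_, e₀, h₀⟩ := 𝓧.local_unitary {m}
  obtain ⟨e, he⟩ := by
    classical exact 𝓑.local_identities {𝓑.incl e₀, 𝓑.incl v}
  have hinj : ∀ u w : R', 𝓑.incl u = 𝓑.incl w → u = w := fun u w h => by
    rw [← 𝓑.counit_incl u, h, 𝓑.counit_incl]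
  have h1 := (he (𝓑.incl e₀) (by simp)).2
  have h2 := (he (𝓑.incl v) (by simp)).1
  refine ⟨e, ?_, hinj _ _ (by rw [map_mul, h2])⟩
  have h3 := (h₀ m (by simp)).2
  conv_lhs => rw [← h3]
  rw [← 𝓧.mul_ract, h1, h3]

variable {m m' : X} (h : comul (R := Unitization 𝕜 R) m = m ⊗ₜ[Unitization 𝕜 R] m')

include h in
theorem comul_ract_incl (v : R') : comul (R := Unitization 𝕜 R) (𝓧.ract (𝓑.incl v) m) =
    𝓧.ract (𝓑.incl v) m ⊗ₜ[Unitization 𝕜 R] m' := by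
  obtain ⟨e, he, hev⟩ := 𝓧.exists_ract_eq_and_mul_eq m' v
  rw [𝓧.comul_ract m (𝓑.incl v) (m ⊗ₜ m') (𝓑.incl v ⊗ₜ 𝓑.incl e) h.symm
    (𝓑.comul_incl v e hev).symm]
  simp [he]

include h in
/-- The right action of `R'` on a weakly grouplike element is the left multiplication by functions
from `R`. -/
theorem ract_incl_eq_smul (v : R') : 𝓧.ract (𝓑.incl v) m =
    ((counitR 𝕜 R (𝓧.ract (𝓑.incl v) m') : R) : Unitization 𝕜 R) • m := by
  have h1 := 𝓧.comul_right m v (m ⊗ₜ m') h.symm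
  simp only [TensorProduct.map_tmul, LinearMap.id_apply, toBase_tmul] at h1
  exact (𝓧.counitR_smul_of_comul_eq_tmul ((𝓧.comul_ract_incl h v).trans h1)).2.symm

include h in
theorem comul_lact_eq_tmul {a a' : A}
    (ha : comul (R := Unitization 𝕜 R) a = a ⊗ₜ[Unitization 𝕜 R] a') :
    comul (R := Unitization 𝕜 R) (𝓧.lact a m) =
      𝓧.lact a m ⊗ₜ[Unitization 𝕜 R] 𝓧.lact a' m' := by
  rw [𝓧.comul_lact a m (a ⊗ₜ a') (m ⊗ₜ m') ha.symm h.symm]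
  simp

include h in
theorem comul_ract_eq_tmul {b b' : B}
    (hb : comul (R := Unitization 𝕜 R') b = b ⊗ₜ[Unitization 𝕜 R'] b') :
    comul (R := Unitization 𝕜 R) (𝓧.ract b m) =
      𝓧.ract b m ⊗ₜ[Unitization 𝕜 R] 𝓧.ract b' m' := by
  rw [𝓧.comul_ract m b (m ⊗ₜ m') (b ⊗ₜ b') h.symm hb.symm]
  simp

end PreprincipalBimodule

end WeaklyGrouplikeAlgebra

/-! ### The moment map of a bimodule -/

section Moment

variable {𝕜 : Type*} [RCLike 𝕜]
  {E : Type*} [NormedAddCommGroup E] [NormedSpace ℝ E] [FiniteDimensional ℝ E]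
  {M : Type*} [TopologicalSpace M] [T2Space M] [ChartedSpace E M] [IsManifold 𝓘(ℝ, E) ∞ M]

variable (𝕜 E) in
/-- The counit of `c`, as a function on `M`. -/
def counitFun {C : Type*} [AddCommGroup C] [Module (CcU 𝕜 E M) C] [Coalgebra (CcU 𝕜 E M) C]
    (c : C) : M → 𝕜 :=
  (counitR 𝕜 (Cc 𝕜 E M) c : Cc 𝕜 E M)

omit [FiniteDimensional ℝ E] [T2Space M] [IsManifold 𝓘(ℝ, E) ∞ M] in
theorem isOpen_counitFun_ne_zero {C : Type*} [AddCommGroup C] [Module (CcU 𝕜 E M) C]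
    [Coalgebra (CcU 𝕜 E M) C] (c : C) : IsOpen {y : M | counitFun 𝕜 E c y ≠ (0 : 𝕜)} :=
  (Cc.contMDiff _).continuous.isOpen_preimage _ isOpen_compl_singleton

section Germs

variable {C : Type*} [AddCommGroup C] [Module (CcU 𝕜 E M) C]

omit [FiniteDimensional ℝ E] [T2Space M] [IsManifold 𝓘(ℝ, E) ∞ M] in
theorem germAt_smul_congr {x : M} {r s : CcU 𝕜 E M} (h : ∀ᶠ y in 𝓝 x, r.toFun y = s.toFun y)
    (c : C) : germAt 𝕜 E x (r • c) = germAt 𝕜 E x (s • c) := by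
  rw [germAt, germAt, one_tmul_smul, one_tmul_smul, (algebraMap_eq_iff x r s).2 h]

omit [FiniteDimensional ℝ E] [T2Space M] [IsManifold 𝓘(ℝ, E) ∞ M] in
theorem germAt_inr_smul_of_eventually_one {x : M} {u : Cc 𝕜 E M}
    (h : ∀ᶠ y in 𝓝 x, (u : M → 𝕜) y = 1) (c : C) :
    germAt 𝕜 E x ((u : CcU 𝕜 E M) • c) = germAt 𝕜 E x c := by
  conv_rhs => rw [← one_smul (CcU 𝕜 E M) c]
  exact germAt_smul_congr (by simpa [CcU.toFun] using h) c

omit [FiniteDimensional ℝ E] [T2Space M] [IsManifold 𝓘(ℝ, E) ∞ M] in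
theorem germAt_tmul_congr {x : M} {m m' n n' : C} (hm : germAt 𝕜 E x m = germAt 𝕜 E x m')
    (hn : germAt 𝕜 E x n = germAt 𝕜 E x n') :
    germAt 𝕜 E x (m ⊗ₜ[CcU 𝕜 E M] n) = germAt 𝕜 E x (m' ⊗ₜ[CcU 𝕜 E M] n') := by
  refine (TensorProduct.AlgebraTensorModule.distribBaseChange (CcU 𝕜 E M)
    (SmoothGerm 𝕜 E x) C C).injective ?_
  rw [germAt, germAt, distrib_one_tmul, distrib_one_tmul]
  exact congrArg₂ _ hm hn

end Germs

variable
  {E' : Type*} [NormedAddCommGroup E'] [NormedSpace ℝ E'] [FiniteDimensional ℝ E']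
  {N : Type*} [TopologicalSpace N] [T2Space N] [ChartedSpace E' N] [IsManifold 𝓘(ℝ, E') ∞ N]
  {A : Type*} [NonUnitalRing A] [Module 𝕜 A] [IsScalarTower 𝕜 A A] [SMulCommClass 𝕜 A A]
  [Module (CcU 𝕜 E M) A] [IsScalarTower 𝕜 (CcU 𝕜 E M) A] [Coalgebra (CcU 𝕜 E M) A]
  {B : Type*} [NonUnitalRing B] [Module 𝕜 B] [IsScalarTower 𝕜 B B] [SMulCommClass 𝕜 B B]
  [Module (CcU 𝕜 E' N) B] [IsScalarTower 𝕜 (CcU 𝕜 E' N) B] [Coalgebra (CcU 𝕜 E' N) B]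
  {X : Type*} [AddCommGroup X] [Module 𝕜 X]
  [Module (CcU 𝕜 E M) X] [IsScalarTower 𝕜 (CcU 𝕜 E M) X] [Coalgebra (CcU 𝕜 E M) X]
  {𝓐 : Bialgebroid 𝕜 (Cc 𝕜 E M) A} {𝓑 : Bialgebroid 𝕜 (Cc 𝕜 E' N) B}

namespace PreprincipalBimodule

variable (𝓧 : PreprincipalBimodule 𝓐 𝓑 X)

omit [FiniteDimensional ℝ E] [T2Space M] [IsManifold 𝓘(ℝ, E) ∞ M]
  [FiniteDimensional ℝ E'] [T2Space N] [IsManifold 𝓘(ℝ, E') ∞ N] in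
include 𝓧 in
theorem counitFun_inr_smul (r : Cc 𝕜 E M) (m : X) (y : M) :
    counitFun 𝕜 E ((r : CcU 𝕜 E M) • m) y = (r : M → 𝕜) y * counitFun 𝕜 E m y := by
  rw [counitFun, 𝓧.counitR_inr_smul]
  rfl

omit [FiniteDimensional ℝ E] [T2Space M] [IsManifold 𝓘(ℝ, E) ∞ M]
  [FiniteDimensional ℝ E'] [T2Space N] [IsManifold 𝓘(ℝ, E') ∞ N] in
include 𝓧 in
theorem toFun_counit (m : X) (y : M) :
    CcU.toFun (Coalgebra.counit (R := CcU 𝕜 E M) m) y = counitFun 𝕜 E m y := by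
  rw [𝓧.counit_eq, CcU.toFun_inr, counitFun]

omit [FiniteDimensional ℝ E] [T2Space M] [IsManifold 𝓘(ℝ, E) ∞ M]
  [FiniteDimensional ℝ E'] [T2Space N] [IsManifold 𝓘(ℝ, E') ∞ N] in
include 𝓧 in
theorem normalisedOn_iff {m : X} {W : Set M} :
    NormalisedOn 𝕜 E m W ↔ ∀ y ∈ W, counitFun 𝕜 E m y = 1 := by
  simp only [NormalisedOn, 𝓧.toFun_counit]

omit [FiniteDimensional ℝ E'] [T2Space N] [IsManifold 𝓘(ℝ, E') ∞ N] in
include 𝓧 in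
theorem counitFun_eventuallyEq {x : M} {m n : X} (h : germAt 𝕜 E x m = germAt 𝕜 E x n) :
    ∀ᶠ y in 𝓝 x, counitFun 𝕜 E m y = counitFun 𝕜 E n y := by
  obtain ⟨u, hu, h⟩ := (germAt_eq_iff x m n).1 h
  filter_upwards [hu] with y hy
  have := congrArg (fun c => counitFun 𝕜 E c y) h
  simpa only [𝓧.counitFun_inr_smul, hy, one_mul] using this

omit [FiniteDimensional ℝ E'] [T2Space N] [IsManifold 𝓘(ℝ, E') ∞ N] in
theorem germAt_ract (b : B) {x : M} {m n : X} (h : germAt 𝕜 E x m = germAt 𝕜 E x n) :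
    germAt 𝕜 E x (𝓧.ract b m) = germAt 𝕜 E x (𝓧.ract b n) := by
  obtain ⟨u, hu, h⟩ := (germAt_eq_iff x m n).1 h
  refine (germAt_eq_iff x _ _).2 ⟨u, hu, ?_⟩
  rw [← 𝓧.ract_inr_smul, h, 𝓧.ract_inr_smul]

omit [FiniteDimensional ℝ E'] [T2Space N] [IsManifold 𝓘(ℝ, E') ∞ N] in
theorem germAt_lact (m : X) {x : M} {a a' : A} (h : germAt 𝕜 E x a = germAt 𝕜 E x a') :
    germAt 𝕜 E x (𝓧.lact a m) = germAt 𝕜 E x (𝓧.lact a' m) := by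
  obtain ⟨u, hu, h⟩ := (germAt_eq_iff x a a').1 h
  refine (germAt_eq_iff x _ _).2 ⟨u, hu, ?_⟩
  rw [𝓧.inr_smul_lact, h, 𝓧.inr_smul_lact]

omit [FiniteDimensional ℝ E] [T2Space M] [IsManifold 𝓘(ℝ, E) ∞ M] in
/-- The right action of functions on a weakly grouplike element `m` defines, at each point where
`ε(m)` does not vanish, a character of `Cc N`. -/
theorem exists_moment {m : X} (hm : WeaklyGrouplike (CcU 𝕜 E M) m) {x : M}
    (hx : counitFun 𝕜 E m x ≠ 0) : ∃ z : N, ∀ v : Cc 𝕜 E' N,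
      counitFun 𝕜 E (𝓧.ract (𝓑.incl v) m) x = (v : N → 𝕜) z * counitFun 𝕜 E m x := by
  obtain ⟨m', hm'⟩ := hm
  let χ : Cc 𝕜 E' N →ₗ[𝕜] 𝕜 :=
    { toFun := fun v => counitFun 𝕜 E (𝓧.ract (𝓑.incl v) m') x
      map_add' := fun u v => by
        simp only [counitFun, map_add, LinearMap.add_apply, counitR_add, Cc.add_apply]
      map_smul' := fun c v => by
        simp only [counitFun, map_smul, LinearMap.smul_apply, counitR_smul, Cc.smul_apply,
          RingHom.id_apply, smul_eq_mul] }
  have hχ : ∀ (v : Cc 𝕜 E' N) (c : Cc 𝕜 E' N),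
      counitFun 𝕜 E (𝓧.ract (𝓑.incl c) (𝓧.ract (𝓑.incl v) m)) x =
        χ v * counitFun 𝕜 E (𝓧.ract (𝓑.incl c) m) x := fun v c => by
    rw [𝓧.ract_incl_eq_smul hm' v, 𝓧.ract_inr_smul, 𝓧.counitFun_inr_smul]
    rfl
  have hχ1 : ∀ v : Cc 𝕜 E' N,
      counitFun 𝕜 E (𝓧.ract (𝓑.incl v) m) x = χ v * counitFun 𝕜 E m x := fun v => by
    rw [𝓧.ract_incl_eq_smul hm' v, 𝓧.counitFun_inr_smul]
    rfl
  obtain ⟨z, hz⟩ := Cc.exists_eq_eval χ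
    (fun u v => by
      refine mul_right_cancel₀ hx ?_
      rw [← hχ1, map_mul, 𝓧.mul_ract, hχ, hχ1, mul_assoc])
    (by
      obtain ⟨e, he, -⟩ := 𝓧.exists_ract_eq_and_mul_eq m 0
      refine ⟨e, fun h => hx ?_⟩
      rw [← he, hχ1, h, zero_mul])
  exact ⟨z, fun v => by rw [hχ1, hz]⟩

omit [FiniteDimensional ℝ E'] [T2Space N] [IsManifold 𝓘(ℝ, E') ∞ N] in
include 𝓧 in
theorem counitFun_eventually_one (p : SpectralSheaf 𝕜 E M X) {m : X}
    (h : p.val = germAt 𝕜 E p.pt m) : ∀ᶠ y in 𝓝 p.pt, counitFun 𝕜 E m y = 1 := by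
  obtain ⟨n, -, ⟨W, hW, hpW, hn⟩, hpn⟩ := p.exists_isGermOf
  filter_upwards [𝓧.counitFun_eventuallyEq (h.symm.trans hpn), hW.mem_nhds hpW] with y h1 h2
  rw [h1, 𝓧.normalisedOn_iff.1 hn y h2]

omit [FiniteDimensional ℝ E'] [T2Space N] [IsManifold 𝓘(ℝ, E') ∞ N] in
include 𝓧 in
theorem isGermOf_iff {p : SpectralSheaf 𝕜 E M X} {m : X} :
    p.IsGermOf m ↔ p.val = germAt 𝕜 E p.pt m := by
  refine ⟨fun h => h.2, fun h => ⟨?_, h⟩⟩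
  obtain ⟨W, hW, hWo, hpW⟩ := eventually_nhds_iff.1 (𝓧.counitFun_eventually_one p h)
  exact ⟨W, hWo, hpW, 𝓧.normalisedOn_iff.2 hW⟩

omit [FiniteDimensional ℝ E] [T2Space M] [IsManifold 𝓘(ℝ, E) ∞ M]
  [FiniteDimensional ℝ E'] [T2Space N] [IsManifold 𝓘(ℝ, E') ∞ N] in
include 𝓧 in
/-- A weakly grouplike element which is normalised near `x` defines a point over `x`. -/
theorem germAt_mem {x : M} {m : X} (hm : WeaklyGrouplike (CcU 𝕜 E M) m)
    (h : ∀ᶠ y in 𝓝 x, counitFun 𝕜 E m y = 1) : germAt 𝕜 E x m ∈ grouplikeAt 𝕜 E X x := by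
  obtain ⟨W, hW, hWo, hpW⟩ := eventually_nhds_iff.1 h
  exact germAt_mem_grouplikeAt hm hWo hpW (𝓧.normalisedOn_iff.2 hW)

theorem exists_moment_spectralSheaf (p : SpectralSheaf 𝕜 E M X) :
    ∃ z : N, ∀ m : X, p.val = germAt 𝕜 E p.pt m → ∀ v : Cc 𝕜 E' N,
      counitFun 𝕜 E (𝓧.ract (𝓑.incl v) m) p.pt = (v : N → 𝕜) z := by
  obtain ⟨n, hn, hpn⟩ := p.exists_isGermOf
  have h1 := (𝓧.counitFun_eventually_one p hpn.2).self_of_nhds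
  obtain ⟨z, hz⟩ := 𝓧.exists_moment hn (x := p.pt) (by rw [h1]; exact one_ne_zero)
  refine ⟨z, fun m hm v => ?_⟩
  rw [(𝓧.counitFun_eventuallyEq (𝓧.germAt_ract (𝓑.incl v) (hm.symm.trans hpn.2))).self_of_nhds,
    hz, h1, mul_one]

/-- The moment map of the bimodule: `φ(m_x)` is the point with `ε(m v)(x) = v(φ(m_x))`. -/
def moment (p : SpectralSheaf 𝕜 E M X) : N := (𝓧.exists_moment_spectralSheaf p).choose

theorem counitFun_ract_incl {p : SpectralSheaf 𝕜 E M X} {m : X}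
    (h : p.val = germAt 𝕜 E p.pt m) (v : Cc 𝕜 E' N) :
    counitFun 𝕜 E (𝓧.ract (𝓑.incl v) m) p.pt = (v : N → 𝕜) (𝓧.moment p) :=
  (𝓧.exists_moment_spectralSheaf p).choose_spec m h v

theorem moment_eq {p : SpectralSheaf 𝕜 E M X} {m : X} (h : p.val = germAt 𝕜 E p.pt m) {z : N}
    (hz : ∀ v : Cc 𝕜 E' N, counitFun 𝕜 E (𝓧.ract (𝓑.incl v) m) p.pt = (v : N → 𝕜) z) :
    𝓧.moment p = z :=
  Cc.eq_of_forall_apply_eq 𝕜 E' fun v => by rw [← 𝓧.counitFun_ract_incl h, hz]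

theorem contMDiff_moment : ContMDiff 𝓘(ℝ, E) 𝓘(ℝ, E') ∞ 𝓧.moment := by
  intro p
  obtain ⟨m, hm, ⟨W, hW, hpW, hn⟩, hpm⟩ := p.exists_isGermOf
  refine contMDiffAt_of_forall_Cc (𝕜 := 𝕜) fun v => ?_
  have h1 : ContMDiffAt 𝓘(ℝ, E) 𝓘(ℝ, 𝕜) ∞
      (fun q : SpectralSheaf 𝕜 E M X => counitFun 𝕜 E (𝓧.ract (𝓑.incl v) m) q.pt) p :=
    ContMDiffAt.comp p (Cc.contMDiff _ p.pt) (SpectralSheaf.contMDiff_pt p)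
  refine h1.congr_of_eventuallyEq ?_
  filter_upwards [SpectralSheaf.eventually_mem_basicSet hW hm hn hpW hpm] with q hq
  exact (𝓧.counitFun_ract_incl hq.2 v).symm

/-- If a property holds near `φ(p)`, then it holds at the points `φ(m_y)` for all `y` near the base
point of `p = m_x`. -/
theorem eventually_moment {p : SpectralSheaf 𝕜 E M X} {m : X}
    (hm : WeaklyGrouplike (CcU 𝕜 E M) m) (hp : p.val = germAt 𝕜 E p.pt m) {Q : N → Prop}
    (hQ : ∀ᶠ z in 𝓝 (𝓧.moment p), Q z) :
    ∀ᶠ y in 𝓝 p.pt, ∃ q : SpectralSheaf 𝕜 E M X, q.pt = y ∧ q.val = germAt 𝕜 E q.pt m ∧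
      Q (𝓧.moment q) := by
  obtain ⟨W, hW, hpW, hn⟩ := (𝓧.isGermOf_iff.2 hp).1
  have h1 : ContinuousAt (𝓧.moment ∘ SpectralSheaf.sectionFun m W p) p.pt := by
    refine ContinuousAt.comp ?_ ?_
    · exact (𝓧.contMDiff_moment _).continuousAt
    · exact (SpectralSheaf.contMDiffAt_sectionFun hW hm hn p hpW).continuousAt
  have h2 : (𝓧.moment ∘ SpectralSheaf.sectionFun m W p) p.pt = 𝓧.moment p :=
    congrArg 𝓧.moment (SpectralSheaf.sectionFun_pt hW hm hn p p hpW hp)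
  rw [← h2] at hQ
  filter_upwards [h1.eventually hQ, hW.mem_nhds hpW] with y hy hyW
  refine ⟨SpectralSheaf.sectionFun m W p y, ?_, ?_, hy⟩ <;>
    rw [SpectralSheaf.sectionFun_eq hW hm hn p hyW]

/-- For a weakly grouplike element `m`, the right multiplication by `v` is the left
multiplication by a function which agrees with `v ∘ φ` on the points defined by `m`. -/
theorem exists_ract_incl_eq_smul {m : X} (hm : WeaklyGrouplike (CcU 𝕜 E M) m) (v : Cc 𝕜 E' N) :
    ∃ t : Cc 𝕜 E M, 𝓧.ract (𝓑.incl v) m = (t : CcU 𝕜 E M) • m ∧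
      ∀ q : SpectralSheaf 𝕜 E M X, q.val = germAt 𝕜 E q.pt m →
        (t : M → 𝕜) q.pt = (v : N → 𝕜) (𝓧.moment q) := by
  obtain ⟨m', hm'⟩ := hm
  refine ⟨_, 𝓧.ract_incl_eq_smul hm' v, fun q hq => ?_⟩
  rw [← 𝓧.counitFun_ract_incl hq v, 𝓧.ract_incl_eq_smul hm' v, 𝓧.counitFun_inr_smul,
    (𝓧.counitFun_eventually_one q hq).self_of_nhds, mul_one]

theorem germAt_ract_incl {p : SpectralSheaf 𝕜 E M X} {m : X}
    (hm : WeaklyGrouplike (CcU 𝕜 E M) m) (hp : p.val = germAt 𝕜 E p.pt m) {v : Cc 𝕜 E' N}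
    (hv : ∀ᶠ z in 𝓝 (𝓧.moment p), (v : N → 𝕜) z = 1) :
    germAt 𝕜 E p.pt (𝓧.ract (𝓑.incl v) m) = germAt 𝕜 E p.pt m := by
  obtain ⟨t, ht, htq⟩ := 𝓧.exists_ract_incl_eq_smul hm v
  rw [ht]
  refine germAt_inr_smul_of_eventually_one ?_ m
  filter_upwards [𝓧.eventually_moment hm hp hv] with y hy
  obtain ⟨q, rfl, hq, h⟩ := hy
  rw [htq q hq, h]

/-- The germ of `m b` depends only on the germs of `m` and `b`. -/
theorem germAt_ract_congr {p : SpectralSheaf 𝕜 E M X} {m : X}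
    (hm : WeaklyGrouplike (CcU 𝕜 E M) m) (hp : p.val = germAt 𝕜 E p.pt m) {b c : B}
    (h : germAt 𝕜 E' (𝓧.moment p) b = germAt 𝕜 E' (𝓧.moment p) c) :
    germAt 𝕜 E p.pt (𝓧.ract b m) = germAt 𝕜 E p.pt (𝓧.ract c m) := by
  obtain ⟨w, hw, h⟩ := (germAt_eq_iff _ b c).1 h
  rw [𝓑.smul_eq, 𝓑.smul_eq] at h
  have h1 := 𝓧.germAt_ract_incl hm hp hw
  rw [← 𝓧.germAt_ract b h1, ← 𝓧.germAt_ract c h1, ← 𝓧.mul_ract, ← 𝓧.mul_ract, h]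

omit [FiniteDimensional ℝ E'] [T2Space N] [IsManifold 𝓘(ℝ, E') ∞ N] in
/-- The germ of `a m` depends only on the germs of `a` and `m`. -/
theorem germAt_lact_congr {g : SpectralSheaf 𝕜 E M A} {a : A}
    (ha : WeaklyGrouplike (CcU 𝕜 E M) a) (hg : g.val = germAt 𝕜 E g.pt a) {m n : X}
    (h : germAt 𝕜 E (𝓐.selfBimodule.moment g) m = germAt 𝕜 E (𝓐.selfBimodule.moment g) n) :
    germAt 𝕜 E g.pt (𝓧.lact a m) = germAt 𝕜 E g.pt (𝓧.lact a n) := by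
  obtain ⟨u, hu, h⟩ := (germAt_eq_iff _ m n).1 h
  rw [𝓧.smul_eq, 𝓧.smul_eq] at h
  have h1 := 𝓐.selfBimodule.germAt_ract_incl ha hg hu
  rw [← 𝓧.germAt_lact m h1, ← 𝓧.germAt_lact n h1]
  change germAt 𝕜 E g.pt (𝓧.lact (a * 𝓐.incl u) m) = germAt 𝕜 E g.pt (𝓧.lact (a * 𝓐.incl u) n)
  rw [𝓧.mul_lact, 𝓧.mul_lact, h]

omit [FiniteDimensional ℝ E'] [T2Space N] [IsManifold 𝓘(ℝ, E') ∞ N] in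
theorem counitFun_lact {g : SpectralSheaf 𝕜 E M A} {a : A} (hg : g.val = germAt 𝕜 E g.pt a)
    (m : X) :
    counitFun 𝕜 E (𝓧.lact a m) g.pt = counitFun 𝕜 E m (𝓐.selfBimodule.moment g) := by
  rw [counitFun, 𝓧.counit_lact]
  exact 𝓐.selfBimodule.counitFun_ract_incl hg _

theorem counitFun_ract {p : SpectralSheaf 𝕜 E M X} {m : X} (hp : p.val = germAt 𝕜 E p.pt m)
    (b : B) :
    counitFun 𝕜 E (𝓧.ract b m) p.pt = counitFun 𝕜 E' b (𝓧.moment p) := by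
  rw [counitFun, 𝓧.counit_ract]
  exact 𝓧.counitFun_ract_incl hp _

omit [FiniteDimensional ℝ E] [T2Space M] [IsManifold 𝓘(ℝ, E) ∞ M]
  [FiniteDimensional ℝ E'] [T2Space N] [IsManifold 𝓘(ℝ, E') ∞ N] in
theorem weaklyGrouplike_lact {a : A} {m : X} (ha : WeaklyGrouplike (CcU 𝕜 E M) a)
    (hm : WeaklyGrouplike (CcU 𝕜 E M) m) : WeaklyGrouplike (CcU 𝕜 E M) (𝓧.lact a m) :=
  let ⟨_, ha'⟩ := ha
  let ⟨_, hm'⟩ := hm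
  ⟨_, 𝓧.comul_lact_eq_tmul hm' ha'⟩

omit [FiniteDimensional ℝ E] [T2Space M] [IsManifold 𝓘(ℝ, E) ∞ M]
  [FiniteDimensional ℝ E'] [T2Space N] [IsManifold 𝓘(ℝ, E') ∞ N] in
theorem weaklyGrouplike_ract {b : B} {m : X} (hm : WeaklyGrouplike (CcU 𝕜 E M) m)
    (hb : WeaklyGrouplike (CcU 𝕜 E' N) b) : WeaklyGrouplike (CcU 𝕜 E M) (𝓧.ract b m) :=
  let ⟨_, hb'⟩ := hb
  let ⟨_, hm'⟩ := hm
  ⟨_, 𝓧.comul_ract_eq_tmul hm' hb'⟩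

end PreprincipalBimodule

end Moment

/-! ### Grouplike elements of a free coalgebra -/

section Grouplike

/-- The basis given by a freely generating set. -/
def FreelyGenerates.basis {R X : Type*} [Ring R] [AddCommGroup X] [Module R X] {S : Set X}
    (hS : FreelyGenerates R S) : Module.Basis S R X :=
  Module.Basis.mk hS.1 (by rw [Subtype.range_coe]; exact hS.2.ge)

@[simp]
theorem FreelyGenerates.basis_apply {R X : Type*} [Ring R] [AddCommGroup X] [Module R X] {S : Set X}
    (hS : FreelyGenerates R S) (i : S) : hS.basis i = i := by
  simp [FreelyGenerates.basis]

/-- If a coalgebra over a ring without nontrivial idempotents is freely generated by grouplike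
elements, then every grouplike element is one of them: its coordinates are orthogonal idempotents
with sum `1`. -/
theorem FreelyGenerates.mem_of_isGroupLikeElem {R C : Type*} [CommRing R] [Nontrivial R]
    (hR : ∀ r : R, r * r = r → r = 0 ∨ r = 1) [AddCommGroup C] [Module R C] [Coalgebra R C]
    {S : Set C} (hS : FreelyGenerates R S) (hgl : ∀ s ∈ S, IsGroupLikeElem R s) {ζ : C}
    (hζ : IsGroupLikeElem R ζ) : ζ ∈ S := by
  classical
  let b : Module.Basis S R C := hS.basis
  have hb : ∀ i : S, b i = i := hS.basis_apply
  have hcomul : ∀ i j : S, b.coord i ζ * b.coord j ζ = if i = j then b.coord i ζ else 0 := by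
    intro i j
    have key : (LinearMap.mul' R R ∘ₗ TensorProduct.map (b.coord i) (b.coord j)) ∘ₗ
        Coalgebra.comul = if i = j then b.coord i else 0 := by
      refine b.ext fun k => ?_
      have hk : Coalgebra.comul (R := R) (b k) = b k ⊗ₜ[R] b k := by
        rw [hb]; exact (hgl k k.2).comul_eq_tmul_self
      rw [LinearMap.comp_apply, hk]
      by_cases hij : i = j
      · subst hij
        by_cases hik : k = i
        · subst hik; simp
        · simp [hik]
      · by_cases hik : k = i
        · subst hik; simp [hij]
        · simp [hik, hij]
    have := congrArg (fun l => l ζ) key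
    simp only [LinearMap.comp_apply, hζ.comul_eq_tmul_self, TensorProduct.map_tmul,
      LinearMap.mul'_apply] at this
    rw [this]
    split_ifs <;> rfl
  have hex : ∃ i : S, b.coord i ζ = 1 := by
    by_contra! hne
    have h0 : ζ = 0 := by
      refine b.ext_elem fun i => ?_
      have h1 := hcomul i i
      rw [if_pos rfl] at h1
      simpa using (hR _ h1).resolve_right (hne i)
    have := hζ.counit_eq_one
    rw [h0, map_zero] at this
    exact zero_ne_one this
  obtain ⟨i, hi⟩ := hex
  have : ζ = b i := by
    refine b.ext_elem fun j => ?_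
    have h1 := hcomul i j
    rw [hi, one_mul, Module.Basis.coord_apply] at h1
    rw [h1, b.repr_self, Finsupp.single_apply]
  rw [this, hb]
  exact i.2

variable {𝕜 : Type*} [RCLike 𝕜]
  {E : Type*} [NormedAddCommGroup E] [NormedSpace ℝ E]
  {M : Type*} [TopologicalSpace M] [ChartedSpace E M]

/-- The ring of germs has no nontrivial idempotents: a continuous function with values in `{0, 1}`
is locally constant. -/
theorem SmoothGerm.eq_zero_or_one_of_mul_self {x : M} (r : SmoothGerm 𝕜 E x) (h : r * r = r) :
    r = 0 ∨ r = 1 := by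
  obtain ⟨_, f, hf, rfl⟩ := r
  have h1 : ∀ᶠ y in 𝓝 x, f y * f y = f y := Germ.coe_eq.1 (congrArg Subtype.val h)
  have hc : ContinuousAt f x := hf.self_of_nhds.continuousAt
  have h2 : ∀ c : 𝕜, c * c = c → c = 0 ∨ c = 1 := fun c hc => by
    have : c * (c - 1) = 0 := by linear_combination hc
    exact (mul_eq_zero.1 this).imp_right sub_eq_zero.1
  rcases h2 _ h1.self_of_nhds with h0 | h0
  · refine Or.inl (Subtype.ext (Germ.coe_eq.2 ?_))
    filter_upwards [h1, hc.eventually_ne (y := 1) (by rw [h0]; exact zero_ne_one)] with y h3 h4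
    exact (h2 _ h3).resolve_right h4
  · refine Or.inr (Subtype.ext (Germ.coe_eq.2 ?_))
    filter_upwards [h1, hc.eventually_ne (y := 0) (by rw [h0]; exact one_ne_zero)] with y h3 h4
    exact (h2 _ h3).resolve_left h4

instance (x : M) : Nontrivial (SmoothGerm 𝕜 E x) :=
  ⟨0, 1, fun h => by
    have h1 : ∀ᶠ y in 𝓝 x, (0 : 𝕜) = 1 := Germ.coe_eq.1 (congrArg Subtype.val h)
    exact zero_ne_one h1.self_of_nhds⟩

variable {A : Type*} [NonUnitalRing A] [Module 𝕜 A] [IsScalarTower 𝕜 A A] [SMulCommClass 𝕜 A A]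
  [Module (CcU 𝕜 E M) A] [IsScalarTower 𝕜 (CcU 𝕜 E M) A] [Coalgebra (CcU 𝕜 E M) A]

theorem HopfAlgebroid.SInvariant.weaklyGrouplike {𝓐 : HopfAlgebroid 𝕜 (Cc 𝕜 E M) A} {a : A}
    (ha : 𝓐.SInvariant a) : WeaklyGrouplike (CcU 𝕜 E M) a :=
  let ⟨a', h, _⟩ := ha
  ⟨a', h⟩

theorem HopfAlgebroid.IsLocallyGrouplike.exists_isGermOf {𝓐 : HopfAlgebroid 𝕜 (Cc 𝕜 E M) A}
    (h𝓐 : 𝓐.IsLocallyGrouplike) (g : SpectralSheaf 𝕜 E M A) :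
    ∃ a : A, 𝓐.SInvariant a ∧ g.IsGermOf a := by
  obtain ⟨a, ha, hW, h⟩ := (h𝓐 g.pt).mem_of_isGroupLikeElem
    SmoothGerm.eq_zero_or_one_of_mul_self (by
      rintro _ ⟨a, ha, ⟨W, hW, hx, hn⟩, rfl⟩
      exact germAt_mem_grouplikeAt ha.weaklyGrouplike hW hx hn) g.mem
  exact ⟨a, ha, hW, h⟩

end Grouplike

/-! ### The diffeomorphism defined by an `S`-invariant weakly grouplike element -/

section SInvariant

variable {𝕜 : Type*} [RCLike 𝕜]
  {E : Type*} [NormedAddCommGroup E] [NormedSpace ℝ E]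
  {M : Type*} [TopologicalSpace M] [ChartedSpace E M]
  {A : Type*} [NonUnitalRing A] [Module 𝕜 A] [IsScalarTower 𝕜 A A] [SMulCommClass 𝕜 A A]
  [Module (CcU 𝕜 E M) A] [IsScalarTower 𝕜 (CcU 𝕜 E M) A] [Coalgebra (CcU 𝕜 E M) A]

namespace HopfAlgebroid

variable {𝓐 : HopfAlgebroid 𝕜 (Cc 𝕜 E M) A}

/-- For an `S`-invariant element with `Δ(a) = a ⊗ a'`, the tensors `Δ(a)` and `Δ(S(a))` are
symmetric. -/
theorem SInvariant.comul_eq {a a' : A}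
    (h : Coalgebra.comul (R := CcU 𝕜 E M) a = a ⊗ₜ[CcU 𝕜 E M] a')
    (hS : Coalgebra.comul (R := CcU 𝕜 E M) (𝓐.antipode a) =
      𝓐.antipode a' ⊗ₜ[CcU 𝕜 E M] 𝓐.antipode a) :
    Coalgebra.comul (R := CcU 𝕜 E M) a = a' ⊗ₜ[CcU 𝕜 E M] a ∧
    Coalgebra.comul (R := CcU 𝕜 E M) (𝓐.antipode a) =
      𝓐.antipode a ⊗ₜ[CcU 𝕜 E M] 𝓐.antipode a' := by
  have h1 := (𝓐.selfBimodule.counitR_smul_of_comul_eq_tmul h).1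
  have h2 := (𝓐.selfBimodule.counitR_smul_of_comul_eq_tmul hS).2
  constructor
  · rw [h]
    conv_lhs => rw [← h1]
    rw [TensorProduct.smul_tmul, h1]
  · rw [hS]
    conv_rhs => rw [← h2]
    rw [TensorProduct.smul_tmul, h2]

theorem SInvariant.antipode {a : A} (ha : 𝓐.SInvariant a) : 𝓐.SInvariant (𝓐.antipode a) := by
  obtain ⟨a', h, hS⟩ := ha
  obtain ⟨h1, h2⟩ := SInvariant.comul_eq h hS
  exact ⟨𝓐.antipode a', h2, by rw [𝓐.antipode_antipode, 𝓐.antipode_antipode, h1]⟩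

variable [FiniteDimensional ℝ E] [T2Space M] [IsManifold 𝓘(ℝ, E) ∞ M]

/-- The point `x` is the source of the germ of `a` at `y`: the character `u ↦ ε(a u)(y)` is a
multiple of the evaluation at `x`. The element `a` is not assumed to be normalised. -/
def IsSource (𝓐 : HopfAlgebroid 𝕜 (Cc 𝕜 E M) A) (a : A) (y x : M) : Prop :=
  ∀ u : Cc 𝕜 E M, counitFun 𝕜 E (a * 𝓐.incl u) y = (u : M → 𝕜) x * counitFun 𝕜 E a y

theorem IsSource.unique {a : A} {y x x' : M} (hy : counitFun 𝕜 E a y ≠ 0)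
    (h : 𝓐.IsSource a y x) (h' : 𝓐.IsSource a y x') : x = x' :=
  Cc.eq_of_forall_apply_eq 𝕜 E fun u => mul_right_cancel₀ hy ((h u).symm.trans (h' u))

omit [FiniteDimensional ℝ E] [T2Space M] [IsManifold 𝓘(ℝ, E) ∞ M] in
/-- The antipode exchanges sources and targets. -/
theorem SInvariant.isSource_antipode {a : A} (ha : 𝓐.SInvariant a) {y x : M}
    (hy : counitFun 𝕜 E a y ≠ 0) (h : 𝓐.IsSource a y x) :
    counitFun 𝕜 E (𝓐.antipode a) x = counitFun 𝕜 E a y ∧ 𝓐.IsSource (𝓐.antipode a) x y := by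
  obtain ⟨a', hΔ, hS⟩ := ha
  obtain ⟨h1, h2⟩ := SInvariant.comul_eq hΔ hS
  constructor
  · -- the function `f = ε(S(a))` satisfies `ε(a) = ε(a' f)`, since `a' S(a) = ε(a)`
    have h3 : a' * 𝓐.antipode a = 𝓐.incl (counitR 𝕜 (Cc 𝕜 E M) a) := by
      have := 𝓐.antipode_comul (𝓐.antipode a) (𝓐.antipode a' ⊗ₜ 𝓐.antipode a) hS.symm
      simpa [𝓐.antipode_antipode] using this
    have h4 : counitR 𝕜 (Cc 𝕜 E M) a =
        counitR 𝕜 (Cc 𝕜 E M) (a' * 𝓐.incl (counitR 𝕜 (Cc 𝕜 E M) (𝓐.antipode a))) := by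
      rw [← 𝓐.counit_mul, h3, 𝓐.counit_incl]
    have h5 : a * 𝓐.incl (counitR 𝕜 (Cc 𝕜 E M) (𝓐.antipode a)) =
        ((counitR 𝕜 (Cc 𝕜 E M) a : Cc 𝕜 E M) : CcU 𝕜 E M) • a := by
      rw [h4]
      exact 𝓐.selfBimodule.ract_incl_eq_smul hΔ _
    have h6 := h (counitR 𝕜 (Cc 𝕜 E M) (𝓐.antipode a))
    rw [h5, 𝓐.selfBimodule.counitFun_inr_smul] at h6
    exact (mul_right_cancel₀ hy h6).symm
  · intro u
    have h3 : 𝓐.antipode a * 𝓐.incl u = _ := 𝓐.selfBimodule.ract_incl_eq_smul h2 u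
    rw [h3, 𝓐.selfBimodule.counitFun_inr_smul]
    congr 1
    have h4 := congrArg 𝓐.antipode h3
    rw [𝓐.antipode_mul, 𝓐.smul_eq, 𝓐.antipode_mul, 𝓐.antipode_antipode, 𝓐.antipode_incl,
      𝓐.antipode_incl, ← 𝓐.smul_eq] at h4
    have h5 := congrArg (fun c => counitFun 𝕜 E c y) h4
    simp only [𝓐.selfBimodule.counitFun_inr_smul] at h5
    rw [h] at h5
    exact (mul_right_cancel₀ hy h5).symm

theorem SInvariant.exists_isSource {a : A} (ha : 𝓐.SInvariant a) {y : M}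
    (hy : counitFun 𝕜 E a y ≠ 0) : ∃ x, 𝓐.IsSource a y x :=
  𝓐.selfBimodule.exists_moment ha.weaklyGrouplike hy

open Classical in
/-- The map which assigns to `y` the source of the germ of `a` at `y`, where `ε(a)(y) ≠ 0`. -/
def sourceMap (𝓐 : HopfAlgebroid 𝕜 (Cc 𝕜 E M) A) (a : A) (y : M) : M :=
  if h : ∃ x, 𝓐.IsSource a y x then h.choose else y

theorem SInvariant.isSource_sourceMap {a : A} (ha : 𝓐.SInvariant a) {y : M}
    (hy : counitFun 𝕜 E a y ≠ 0) : 𝓐.IsSource a y (𝓐.sourceMap a y) := by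
  have h := ha.exists_isSource hy
  rw [sourceMap, dif_pos h]
  exact h.choose_spec

theorem SInvariant.contMDiffAt_sourceMap {a : A} (ha : 𝓐.SInvariant a) {y : M}
    (hy : counitFun 𝕜 E a y ≠ 0) :
    ContMDiffAt 𝓘(ℝ, E) 𝓘(ℝ, E) ∞ (𝓐.sourceMap a) y := by
  refine contMDiffAt_of_forall_Cc (𝕜 := 𝕜) fun v => ?_
  have h1 : ContMDiffAt 𝓘(ℝ, E) 𝓘(ℝ, 𝕜) ∞
      ((counitFun 𝕜 E (a * 𝓐.incl v)) * fun z => (counitFun 𝕜 E a z)⁻¹) y :=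
    contMDiffAt_mul (Cc.contMDiff _ y)
      (((contDiffAt_inv (𝕜 := ℝ) hy (n := ∞)).contMDiffAt).comp y (Cc.contMDiff _ y))
  refine h1.congr_of_eventuallyEq ?_
  filter_upwards [(isOpen_counitFun_ne_zero a).mem_nhds hy] with z hz
  rw [Pi.mul_apply, ha.isSource_sourceMap hz v]
  exact (mul_inv_cancel_right₀ hz _).symm

/-- The source map of `a` as a partial homeomorphism of `M`. Its inverse is the source map of
`S(a)`. -/
def SInvariant.sourceHomeo {a : A} (ha : 𝓐.SInvariant a) : OpenPartialHomeomorph M M where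
  toFun := 𝓐.sourceMap a
  invFun := 𝓐.sourceMap (𝓐.antipode a)
  source := {y | counitFun 𝕜 E a y ≠ (0 : 𝕜)}
  target := {y | counitFun 𝕜 E (𝓐.antipode a) y ≠ (0 : 𝕜)}
  map_source' y hy := by
    have := (ha.isSource_antipode hy (ha.isSource_sourceMap hy)).1
    rwa [mem_ofPred_eq, this]
  map_target' y hy := by
    have := (ha.antipode.isSource_antipode hy (ha.antipode.isSource_sourceMap hy)).1
    rw [𝓐.antipode_antipode] at this
    rwa [mem_ofPred_eq, this]
  left_inv' y hy := by
    have h := ha.isSource_antipode hy (ha.isSource_sourceMap hy)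
    have h1 : counitFun 𝕜 E (𝓐.antipode a) (𝓐.sourceMap a y) ≠ 0 := by rw [h.1]; exact hy
    exact (ha.antipode.isSource_sourceMap h1).unique h1 h.2
  right_inv' y hy := by
    have h := ha.antipode.isSource_antipode hy (ha.antipode.isSource_sourceMap hy)
    rw [𝓐.antipode_antipode] at h
    have h1 : counitFun 𝕜 E a (𝓐.sourceMap (𝓐.antipode a) y) ≠ 0 := by rw [h.1]; exact hy
    exact (ha.isSource_sourceMap h1).unique h1 h.2
  open_source := isOpen_counitFun_ne_zero a
  open_target := isOpen_counitFun_ne_zero _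
  continuousOn_toFun y hy :=
    (ha.contMDiffAt_sourceMap hy).continuousAt.continuousWithinAt
  continuousOn_invFun y hy :=
    (ha.antipode.contMDiffAt_sourceMap hy).continuousAt.continuousWithinAt

/-- The source of an arrow is computed by any of its representatives. -/
theorem SInvariant.sourceMap_pt {a : A} (ha : 𝓐.SInvariant a) {g : SpectralSheaf 𝕜 E M A}
    (hg : g.val = germAt 𝕜 E g.pt a) : 𝓐.sourceMap a g.pt = 𝓐.selfBimodule.moment g := by
  have h1 := (𝓐.selfBimodule.counitFun_eventually_one g hg).self_of_nhds
  refine (𝓐.selfBimodule.moment_eq hg fun v => ?_).symm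
  have := ha.isSource_sourceMap (by rw [h1]; exact one_ne_zero) v
  rwa [h1, mul_one] at this

/-- Near the source of an arrow, the antipode of a representative is normalised. -/
theorem SInvariant.counitFun_antipode_eventually_one {a : A} (ha : 𝓐.SInvariant a)
    {g : SpectralSheaf 𝕜 E M A} (hg : g.val = germAt 𝕜 E g.pt a) :
    ∀ᶠ x in 𝓝 (𝓐.selfBimodule.moment g), counitFun 𝕜 E (𝓐.antipode a) x = (1 : 𝕜) := by
  have h1 := 𝓐.selfBimodule.counitFun_eventually_one g hg
  have hy : g.pt ∈ ha.sourceHomeo.source := by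
    change counitFun 𝕜 E a g.pt ≠ 0
    rw [h1.self_of_nhds]; exact one_ne_zero
  have hx : 𝓐.selfBimodule.moment g ∈ ha.sourceHomeo.target := by
    rw [← ha.sourceMap_pt hg]; exact ha.sourceHomeo.map_source hy
  have h2 : ha.sourceHomeo.symm (𝓐.selfBimodule.moment g) = g.pt := by
    rw [← ha.sourceMap_pt hg]; exact ha.sourceHomeo.left_inv hy
  rw [← h2] at h1
  filter_upwards [(ha.sourceHomeo.continuousAt_symm hx).eventually h1,
    ha.sourceHomeo.open_target.mem_nhds hx] with x h3 h4
  have h5 := (ha.antipode.isSource_antipode h4 (ha.antipode.isSource_sourceMap h4)).1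
  rw [𝓐.antipode_antipode] at h5
  rw [← h5]
  exact h3

end HopfAlgebroid

end SInvariant

/-! ### Actions on spectral sheaves -/

section SheafActions

variable {𝕜 : Type*} [RCLike 𝕜]
  {E : Type*} [NormedAddCommGroup E] [NormedSpace ℝ E] [FiniteDimensional ℝ E]
  {M : Type*} [TopologicalSpace M] [T2Space M] [ChartedSpace E M] [IsManifold 𝓘(ℝ, E) ∞ M]
  {E' : Type*} [NormedAddCommGroup E'] [NormedSpace ℝ E'] [FiniteDimensional ℝ E']
  {N : Type*} [TopologicalSpace N] [T2Space N] [ChartedSpace E' N] [IsManifold 𝓘(ℝ, E') ∞ N]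
  {A : Type*} [NonUnitalRing A] [Module 𝕜 A] [IsScalarTower 𝕜 A A] [SMulCommClass 𝕜 A A]
  [Module (CcU 𝕜 E M) A] [IsScalarTower 𝕜 (CcU 𝕜 E M) A] [Coalgebra (CcU 𝕜 E M) A]
  {B : Type*} [NonUnitalRing B] [Module 𝕜 B] [IsScalarTower 𝕜 B B] [SMulCommClass 𝕜 B B]
  [Module (CcU 𝕜 E' N) B] [IsScalarTower 𝕜 (CcU 𝕜 E' N) B] [Coalgebra (CcU 𝕜 E' N) B]
  {X : Type*} [AddCommGroup X] [Module 𝕜 X]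
  [Module (CcU 𝕜 E M) X] [IsScalarTower 𝕜 (CcU 𝕜 E M) X] [Coalgebra (CcU 𝕜 E M) X]

section Smoothness

variable {F H Y : Type*} [NormedAddCommGroup F] [NormedSpace ℝ F] [TopologicalSpace H]
  {I : ModelWithCorners ℝ F H} [TopologicalSpace Y] [ChartedSpace H Y]
  {C : Type*} [AddCommGroup C] [Module (CcU 𝕜 E M) C] [Coalgebra (CcU 𝕜 E M) C]

/-- A map into a spectral sheaf which is locally given by the germs of a single element along a
smooth map into the base is smooth. -/
theorem smoothOnSubset_of_val_eq {S : Set Y} {f : S → SpectralSheaf 𝕜 E M C}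
    (h : ∀ p : S, ∃ (c : C) (U : Set Y) (r : Y → M), WeaklyGrouplike (CcU 𝕜 E M) c ∧ IsOpen U ∧
      (p : Y) ∈ U ∧ ContMDiffOn I 𝓘(ℝ, E) ∞ r U ∧ (f p).IsGermOf c ∧
      ∀ q : S, (q : Y) ∈ U → (f q).pt = r q ∧ (f q).val = germAt 𝕜 E (f q).pt c) :
    SmoothOnSubset I 𝓘(ℝ, E) f := by
  intro p
  obtain ⟨c, U, r, hc, hU, hpU, hr, hp, hq⟩ := h p
  obtain ⟨⟨W, hW, hpW, hn⟩, hpv⟩ := hp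
  have hrp : r p ∈ W := by rw [← (hq p hpU).1]; exact hpW
  refine ⟨U ∩ r ⁻¹' W, SpectralSheaf.sectionFun c W (f p) ∘ r,
    hr.continuousOn.isOpen_inter_preimage hU hW, ⟨hpU, hrp⟩, ?_, ?_⟩
  · exact (SpectralSheaf.contMDiffOn_sectionFun hW hc hn (f p)).comp
      (hr.mono inter_subset_left) inter_subset_right
  · rintro q ⟨hqU, hqW⟩
    obtain ⟨h1, h2⟩ := hq q hqU
    have hqW : r q ∈ W := hqW
    rw [Function.comp_apply, ← h1]
    exact SpectralSheaf.sectionFun_pt hW hc hn _ _ (by rwa [h1]) h2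

end Smoothness

namespace PreprincipalBimodule

variable {𝓐 : Bialgebroid 𝕜 (Cc 𝕜 E M) A} {𝓑 : Bialgebroid 𝕜 (Cc 𝕜 E' N) B}
  (𝓧 : PreprincipalBimodule 𝓐 𝓑 X)

omit [FiniteDimensional ℝ E'] [T2Space N] [IsManifold 𝓘(ℝ, E') ∞ N] in
theorem counitFun_lact_eventually_one {g : SpectralSheaf 𝕜 E M A} {a : A} {m : X}
    (ha : WeaklyGrouplike (CcU 𝕜 E M) a) (hg : g.val = germAt 𝕜 E g.pt a)
    (hm : ∀ᶠ y in 𝓝 (𝓐.selfBimodule.moment g), counitFun 𝕜 E m y = 1) :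
    ∀ᶠ y in 𝓝 g.pt, counitFun 𝕜 E (𝓧.lact a m) y = 1 := by
  filter_upwards [𝓐.selfBimodule.eventually_moment ha hg hm] with y hy
  obtain ⟨q, rfl, hq, h⟩ := hy
  rw [𝓧.counitFun_lact hq, h]

theorem counitFun_ract_eventually_one {p : SpectralSheaf 𝕜 E M X} {b : B} {m : X}
    (hm : WeaklyGrouplike (CcU 𝕜 E M) m) (hp : p.val = germAt 𝕜 E p.pt m)
    (hb : ∀ᶠ z in 𝓝 (𝓧.moment p), counitFun 𝕜 E' b z = 1) :
    ∀ᶠ y in 𝓝 p.pt, counitFun 𝕜 E (𝓧.ract b m) y = 1 := by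
  filter_upwards [𝓧.eventually_moment hm hp hb] with y hy
  obtain ⟨q, rfl, hq, h⟩ := hy
  rw [𝓧.counitFun_ract hq, h]

omit [FiniteDimensional ℝ E'] [T2Space N] [IsManifold 𝓘(ℝ, E') ∞ N] in
theorem exists_sheafLact (g : SpectralSheaf 𝕜 E M A) (p : SpectralSheaf 𝕜 E M X)
    (e : 𝓐.selfBimodule.moment g = p.pt) :
    ∃ q : SpectralSheaf 𝕜 E M X, q.pt = g.pt ∧ ∀ (a : A) (m : X),
      WeaklyGrouplike (CcU 𝕜 E M) a → g.val = germAt 𝕜 E g.pt a → p.val = germAt 𝕜 E p.pt m →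
        q.val = germAt 𝕜 E q.pt (𝓧.lact a m) := by
  obtain ⟨a₀, ha₀, hg₀⟩ := g.exists_isGermOf
  obtain ⟨m₀, hm₀, hp₀⟩ := p.exists_isGermOf
  refine ⟨⟨g.pt, germAt 𝕜 E g.pt (𝓧.lact a₀ m₀), 𝓧.germAt_mem (𝓧.weaklyGrouplike_lact ha₀ hm₀)
    (𝓧.counitFun_lact_eventually_one ha₀ hg₀.2 ?_)⟩, rfl, fun a m ha hg hp => ?_⟩
  · rw [e]
    exact 𝓧.counitFun_eventually_one p hp₀.2
  · exact (𝓧.germAt_lact m₀ (hg₀.2.symm.trans hg)).trans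
      (𝓧.germAt_lact_congr ha hg (by rw [e]; exact hp₀.2.symm.trans hp))

/-- The action `a_y · m_x = (am)_y` of the spectral sheaf of `A` on the spectral sheaf of `X`. -/
def sheafLact (g : SpectralSheaf 𝕜 E M A) (p : SpectralSheaf 𝕜 E M X)
    (e : 𝓐.selfBimodule.moment g = p.pt) : SpectralSheaf 𝕜 E M X :=
  (𝓧.exists_sheafLact g p e).choose

variable {g : SpectralSheaf 𝕜 E M A} {p : SpectralSheaf 𝕜 E M X}

omit [FiniteDimensional ℝ E'] [T2Space N] [IsManifold 𝓘(ℝ, E') ∞ N] in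
theorem sheafLact_pt (e : 𝓐.selfBimodule.moment g = p.pt) : (𝓧.sheafLact g p e).pt = g.pt :=
  (𝓧.exists_sheafLact g p e).choose_spec.1

omit [FiniteDimensional ℝ E'] [T2Space N] [IsManifold 𝓘(ℝ, E') ∞ N] in
theorem sheafLact_val (e : 𝓐.selfBimodule.moment g = p.pt) {a : A} {m : X}
    (ha : WeaklyGrouplike (CcU 𝕜 E M) a) (hg : g.val = germAt 𝕜 E g.pt a)
    (hp : p.val = germAt 𝕜 E p.pt m) :
    (𝓧.sheafLact g p e).val = germAt 𝕜 E (𝓧.sheafLact g p e).pt (𝓧.lact a m) :=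
  (𝓧.exists_sheafLact g p e).choose_spec.2 a m ha hg hp

theorem moment_sheafLact (e : 𝓐.selfBimodule.moment g = p.pt) :
    𝓧.moment (𝓧.sheafLact g p e) = 𝓧.moment p := by
  obtain ⟨a, ha, hg⟩ := g.exists_isGermOf
  obtain ⟨m, hm, hp⟩ := p.exists_isGermOf
  refine 𝓧.moment_eq (𝓧.sheafLact_val e ha hg.2 hp.2) fun v => ?_
  rw [← 𝓧.lact_ract, 𝓧.sheafLact_pt, 𝓧.counitFun_lact hg.2, e, 𝓧.counitFun_ract_incl hp.2]

theorem exists_sheafRact (p : SpectralSheaf 𝕜 E M X) (h : SpectralSheaf 𝕜 E' N B)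
    (e : 𝓧.moment p = h.pt) :
    ∃ q : SpectralSheaf 𝕜 E M X, q.pt = p.pt ∧ ∀ (b : B) (m : X),
      WeaklyGrouplike (CcU 𝕜 E M) m → h.val = germAt 𝕜 E' h.pt b → p.val = germAt 𝕜 E p.pt m →
        q.val = germAt 𝕜 E q.pt (𝓧.ract b m) := by
  obtain ⟨b₀, hb₀, hh₀⟩ := h.exists_isGermOf
  obtain ⟨m₀, hm₀, hp₀⟩ := p.exists_isGermOf
  refine ⟨⟨p.pt, germAt 𝕜 E p.pt (𝓧.ract b₀ m₀), 𝓧.germAt_mem (𝓧.weaklyGrouplike_ract hm₀ hb₀)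
    (𝓧.counitFun_ract_eventually_one hm₀ hp₀.2 ?_)⟩, rfl, fun b m hm hh hp => ?_⟩
  · rw [e]
    exact 𝓑.selfBimodule.counitFun_eventually_one h hh₀.2
  · exact (𝓧.germAt_ract b₀ (hp₀.2.symm.trans hp)).trans
      (𝓧.germAt_ract_congr hm hp (by rw [e]; exact hh₀.2.symm.trans hh))

/-- The action `m_x · b_z = (mb)_x` of the spectral sheaf of `B` on the spectral sheaf of `X`. -/
def sheafRact (p : SpectralSheaf 𝕜 E M X) (h : SpectralSheaf 𝕜 E' N B) (e : 𝓧.moment p = h.pt) :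
    SpectralSheaf 𝕜 E M X :=
  (𝓧.exists_sheafRact p h e).choose

variable {h : SpectralSheaf 𝕜 E' N B}

theorem sheafRact_pt (e : 𝓧.moment p = h.pt) : (𝓧.sheafRact p h e).pt = p.pt :=
  (𝓧.exists_sheafRact p h e).choose_spec.1

theorem sheafRact_val (e : 𝓧.moment p = h.pt) {b : B} {m : X}
    (hm : WeaklyGrouplike (CcU 𝕜 E M) m) (hp : p.val = germAt 𝕜 E p.pt m)
    (hh : h.val = germAt 𝕜 E' h.pt b) :
    (𝓧.sheafRact p h e).val = germAt 𝕜 E (𝓧.sheafRact p h e).pt (𝓧.ract b m) :=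
  (𝓧.exists_sheafRact p h e).choose_spec.2 b m hm hh hp

theorem moment_sheafRact (e : 𝓧.moment p = h.pt) :
    𝓧.moment (𝓧.sheafRact p h e) = 𝓑.selfBimodule.moment h := by
  obtain ⟨b, hb, hh⟩ := h.exists_isGermOf
  obtain ⟨m, hm, hp⟩ := p.exists_isGermOf
  refine 𝓧.moment_eq (𝓧.sheafRact_val e hm hp.2 hh.2) fun v => ?_
  rw [← 𝓧.mul_ract, 𝓧.sheafRact_pt, 𝓧.counitFun_ract hp.2, e]
  exact 𝓑.selfBimodule.counitFun_ract_incl hh.2 v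

omit [FiniteDimensional ℝ E'] [T2Space N] [IsManifold 𝓘(ℝ, E') ∞ N] in
theorem sheafLact_sheafLact {g' : SpectralSheaf 𝕜 E M A} (e : 𝓐.selfBimodule.moment g = p.pt)
    (e' : 𝓐.selfBimodule.moment g' = g.pt)
    (h₁ : 𝓐.selfBimodule.moment g' = (𝓧.sheafLact g p e).pt)
    (h₂ : 𝓐.selfBimodule.moment (𝓐.selfBimodule.sheafLact g' g e') = p.pt) :
    𝓧.sheafLact g' (𝓧.sheafLact g p e) h₁ =
      𝓧.sheafLact (𝓐.selfBimodule.sheafLact g' g e') p h₂ := by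
  obtain ⟨a', ha', hg'⟩ := g'.exists_isGermOf
  obtain ⟨a, ha, hg⟩ := g.exists_isGermOf
  obtain ⟨m, hm, hp⟩ := p.exists_isGermOf
  refine SpectralSheaf.ext_of_val_eq (m := 𝓧.lact (a' * a) m) ?_ ?_ ?_
  · rw [𝓧.sheafLact_pt, 𝓧.sheafLact_pt, sheafLact_pt]
  · rw [𝓧.mul_lact]
    exact 𝓧.sheafLact_val h₁ ha' hg'.2 (𝓧.sheafLact_val e ha hg.2 hp.2)
  · exact 𝓧.sheafLact_val h₂ (𝓐.selfBimodule.weaklyGrouplike_lact ha' ha)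
      (𝓐.selfBimodule.sheafLact_val e' ha' hg'.2 hg.2) hp.2

theorem sheafRact_sheafRact {h' : SpectralSheaf 𝕜 E' N B} (e : 𝓧.moment p = h.pt)
    (e' : 𝓑.selfBimodule.moment h = h'.pt)
    (h₁ : 𝓧.moment (𝓧.sheafRact p h e) = h'.pt)
    (h₂ : 𝓧.moment p = (𝓑.selfBimodule.sheafLact h h' e').pt) :
    𝓧.sheafRact (𝓧.sheafRact p h e) h' h₁ =
      𝓧.sheafRact p (𝓑.selfBimodule.sheafLact h h' e') h₂ := by
  obtain ⟨b', hb', hh'⟩ := h'.exists_isGermOf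
  obtain ⟨b, hb, hh⟩ := h.exists_isGermOf
  obtain ⟨m, hm, hp⟩ := p.exists_isGermOf
  refine SpectralSheaf.ext_of_val_eq (m := 𝓧.ract (b * b') m) ?_ ?_ ?_
  · rw [𝓧.sheafRact_pt, 𝓧.sheafRact_pt, 𝓧.sheafRact_pt]
  · rw [𝓧.mul_ract]
    exact 𝓧.sheafRact_val h₁ (𝓧.weaklyGrouplike_ract hm hb) (𝓧.sheafRact_val e hm hp.2 hh.2) hh'.2
  · exact 𝓧.sheafRact_val h₂ hm hp.2 (𝓑.selfBimodule.sheafLact_val e' hb hh.2 hh'.2)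

theorem sheafLact_sheafRact (e : 𝓐.selfBimodule.moment g = p.pt) (e' : 𝓧.moment p = h.pt)
    (h₁ : 𝓐.selfBimodule.moment g = (𝓧.sheafRact p h e').pt)
    (h₂ : 𝓧.moment (𝓧.sheafLact g p e) = h.pt) :
    𝓧.sheafLact g (𝓧.sheafRact p h e') h₁ = 𝓧.sheafRact (𝓧.sheafLact g p e) h h₂ := by
  obtain ⟨a, ha, hg⟩ := g.exists_isGermOf
  obtain ⟨b, hb, hh⟩ := h.exists_isGermOf
  obtain ⟨m, hm, hp⟩ := p.exists_isGermOf
  refine SpectralSheaf.ext_of_val_eq (m := 𝓧.lact a (𝓧.ract b m)) ?_ ?_ ?_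
  · rw [𝓧.sheafLact_pt, 𝓧.sheafRact_pt, 𝓧.sheafLact_pt]
  · exact 𝓧.sheafLact_val h₁ ha hg.2 (𝓧.sheafRact_val e' hm hp.2 hh.2)
  · rw [𝓧.lact_ract]
    exact 𝓧.sheafRact_val h₂ (𝓧.weaklyGrouplike_lact ha hm) (𝓧.sheafLact_val e ha hg.2 hp.2) hh.2

omit [FiniteDimensional ℝ E'] [T2Space N] [IsManifold 𝓘(ℝ, E') ∞ N] in
theorem smooth_sheafLact : SmoothOnSubset (𝓘(ℝ, E).prod 𝓘(ℝ, E)) 𝓘(ℝ, E)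
    (S := {q : SpectralSheaf 𝕜 E M A × SpectralSheaf 𝕜 E M X |
      𝓐.selfBimodule.moment q.1 = q.2.pt})
    (fun q => 𝓧.sheafLact q.1.1 q.1.2 q.2) := by
  refine smoothOnSubset_of_val_eq ?_
  rintro ⟨⟨g, p⟩, e⟩
  obtain ⟨a, ha, ⟨W, hW, hgW, hna⟩, hg⟩ := g.exists_isGermOf
  obtain ⟨m, hm, ⟨V, hV, hpV, hnm⟩, hp⟩ := p.exists_isGermOf
  refine ⟨𝓧.lact a m, SpectralSheaf.basicSet a W ×ˢ SpectralSheaf.basicSet m V,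
    fun q => q.1.pt, 𝓧.weaklyGrouplike_lact ha hm,
    (SpectralSheaf.isOpen_basicSet hW ha hna).prod (SpectralSheaf.isOpen_basicSet hV hm hnm),
    ⟨⟨hgW, hg⟩, ⟨hpV, hp⟩⟩, (SpectralSheaf.contMDiff_pt.comp contMDiff_fst).contMDiffOn,
    𝓧.isGermOf_iff.2 (𝓧.sheafLact_val e ha hg hp), ?_⟩
  rintro ⟨⟨g', p'⟩, e'⟩ ⟨hg', hp'⟩
  exact ⟨𝓧.sheafLact_pt e', 𝓧.sheafLact_val e' ha hg'.2 hp'.2⟩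

theorem smooth_sheafRact : SmoothOnSubset (𝓘(ℝ, E).prod 𝓘(ℝ, E')) 𝓘(ℝ, E)
    (S := {q : SpectralSheaf 𝕜 E M X × SpectralSheaf 𝕜 E' N B | 𝓧.moment q.1 = q.2.pt})
    (fun q => 𝓧.sheafRact q.1.1 q.1.2 q.2) := by
  refine smoothOnSubset_of_val_eq ?_
  rintro ⟨⟨p, h⟩, e⟩
  obtain ⟨b, hb, ⟨W, hW, hhW, hnb⟩, hh⟩ := h.exists_isGermOf
  obtain ⟨m, hm, ⟨V, hV, hpV, hnm⟩, hp⟩ := p.exists_isGermOf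
  refine ⟨𝓧.ract b m, SpectralSheaf.basicSet m V ×ˢ SpectralSheaf.basicSet b W,
    fun q => q.1.pt, 𝓧.weaklyGrouplike_ract hm hb,
    (SpectralSheaf.isOpen_basicSet hV hm hnm).prod (SpectralSheaf.isOpen_basicSet hW hb hnb),
    ⟨⟨hpV, hp⟩, ⟨hhW, hh⟩⟩, (SpectralSheaf.contMDiff_pt.comp contMDiff_fst).contMDiffOn,
    𝓧.isGermOf_iff.2 (𝓧.sheafRact_val e hm hp hh), ?_⟩
  rintro ⟨⟨p', h'⟩, e'⟩ ⟨hp', hh'⟩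
  exact ⟨𝓧.sheafRact_pt e', 𝓧.sheafRact_val e' hm hp'.2 hh'.2⟩

end PreprincipalBimodule

/-! ### Units and multiplication of the spectral sheaf -/

namespace Bialgebroid

variable (𝓐 : Bialgebroid 𝕜 (Cc 𝕜 E M) A)

omit [FiniteDimensional ℝ E] [T2Space M] [IsManifold 𝓘(ℝ, E) ∞ M] in
theorem weaklyGrouplike_incl (u : Cc 𝕜 E M) : WeaklyGrouplike (CcU 𝕜 E M) (𝓐.incl u) := by
  obtain ⟨e, -, he⟩ := 𝓐.selfBimodule.exists_ract_eq_and_mul_eq 0 u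
  exact ⟨𝓐.incl e, 𝓐.comul_incl u e he⟩

omit [FiniteDimensional ℝ E] [T2Space M] [IsManifold 𝓘(ℝ, E) ∞ M] in
theorem counitFun_incl (u : Cc 𝕜 E M) : counitFun 𝕜 E (𝓐.incl u) = (u : M → 𝕜) := by
  rw [counitFun, 𝓐.counit_incl]

theorem exists_sheafUnit (x : M) : ∃ g : SpectralSheaf 𝕜 E M A, g.pt = x ∧
    ∀ u : Cc 𝕜 E M, (∀ᶠ y in 𝓝 x, (u : M → 𝕜) y = 1) →
      g.val = germAt 𝕜 E g.pt (𝓐.incl u) := by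
  obtain ⟨u, hu⟩ := Cc.exists_eq_one (𝕜 := 𝕜) (E := E) x
  refine ⟨⟨x, germAt 𝕜 E x (𝓐.incl u), 𝓐.selfBimodule.germAt_mem (𝓐.weaklyGrouplike_incl u)
    (by rwa [𝓐.counitFun_incl])⟩, rfl, fun v hv => ?_⟩
  change germAt 𝕜 E x (𝓐.incl u) = germAt 𝕜 E x (𝓐.incl v)
  have h1 := germAt_inr_smul_of_eventually_one hu (𝓐.incl v)
  have h2 := germAt_inr_smul_of_eventually_one hv (𝓐.incl u)
  rw [𝓐.smul_eq, ← map_mul] at h1 h2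
  rw [← h1, ← h2, mul_comm]

/-- The germ at `x` of the functions which are equal to `1` near `x`. -/
def sheafUnit (x : M) : SpectralSheaf 𝕜 E M A := (𝓐.exists_sheafUnit x).choose

theorem sheafUnit_pt (x : M) : (𝓐.sheafUnit x).pt = x := (𝓐.exists_sheafUnit x).choose_spec.1

theorem sheafUnit_val {x : M} {u : Cc 𝕜 E M} (hu : ∀ᶠ y in 𝓝 x, (u : M → 𝕜) y = 1) :
    (𝓐.sheafUnit x).val = germAt 𝕜 E (𝓐.sheafUnit x).pt (𝓐.incl u) :=
  (𝓐.exists_sheafUnit x).choose_spec.2 u hu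

theorem moment_sheafUnit (x : M) : 𝓐.selfBimodule.moment (𝓐.sheafUnit x) = x := by
  obtain ⟨u, hu⟩ := Cc.exists_eq_one (𝕜 := 𝕜) (E := E) x
  refine 𝓐.selfBimodule.moment_eq (𝓐.sheafUnit_val hu) fun v => ?_
  change counitFun 𝕜 E (𝓐.incl u * 𝓐.incl v) _ = _
  rw [← map_mul, 𝓐.counitFun_incl, 𝓐.sheafUnit_pt, Cc.mul_apply, hu.self_of_nhds, one_mul]

theorem isLocalDiffeomorph_sheafUnit :
    IsLocalDiffeomorph 𝓘(ℝ, E) 𝓘(ℝ, E) ∞ 𝓐.sheafUnit := by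
  intro x
  obtain ⟨u, hu⟩ := Cc.exists_eq_one (𝕜 := 𝕜) (E := E) x
  obtain ⟨W, hW, hWo, hxW⟩ := eventually_nhds_iff.1 hu
  have hn : NormalisedOn 𝕜 E (𝓐.incl u) W :=
    𝓐.selfBimodule.normalisedOn_iff.2 (by rwa [𝓐.counitFun_incl])
  have hwg := 𝓐.weaklyGrouplike_incl u
  let e := SpectralSheaf.sectionHomeo (𝓐.incl u) W (𝓐.sheafUnit x) hWo hwg hn
  refine ⟨⟨e.symm.toPartialEquiv, e.open_target, e.open_source,
    SpectralSheaf.contMDiffOn_sectionFun hWo hwg hn _, SpectralSheaf.contMDiff_pt.contMDiffOn⟩,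
    hxW, fun y hy => ?_⟩
  have hy : y ∈ W := hy
  change 𝓐.sheafUnit y = SpectralSheaf.sectionFun _ _ _ y
  have h1 : ∀ᶠ z in 𝓝 y, (u : M → 𝕜) z = 1 := by
    filter_upwards [hWo.mem_nhds hy] with z hz using hW z hz
  have h2 := SpectralSheaf.sectionFun_pt hWo hwg hn (𝓐.sheafUnit x) (𝓐.sheafUnit y)
    (by rwa [𝓐.sheafUnit_pt]) (𝓐.sheafUnit_val h1)
  rw [← h2, 𝓐.sheafUnit_pt]

theorem localDiffeo_sheafMul : LocalDiffeoOnSubset (𝓘(ℝ, E).prod 𝓘(ℝ, E)) 𝓘(ℝ, E)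
    (S := {q : SpectralSheaf 𝕜 E M A × SpectralSheaf 𝕜 E M A |
      𝓐.selfBimodule.moment q.1 = q.2.pt})
    (fun q => 𝓐.selfBimodule.sheafLact q.1.1 q.1.2 q.2) := by
  refine ⟨𝓐.selfBimodule.smooth_sheafLact, ?_⟩
  rintro ⟨⟨g', g⟩, e⟩
  obtain ⟨a', ha', ⟨W', hW', hgW', hna'⟩, hg'⟩ := g'.exists_isGermOf
  obtain ⟨a, ha, ⟨W, hW, hgW, hna⟩, hg⟩ := g.exists_isGermOf
  have haa := 𝓐.selfBimodule.weaklyGrouplike_lact ha' ha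
  obtain ⟨⟨O, hO, hgO, hnO⟩, -⟩ :=
    𝓐.selfBimodule.isGermOf_iff.2 (𝓐.selfBimodule.sheafLact_val e ha' hg' hg)
  rw [PreprincipalBimodule.sheafLact_pt] at hgO
  have e : 𝓐.selfBimodule.moment g' = g.pt := e
  -- `s` is the local section through `g'`, and `r` is its composition with the source map
  let s := SpectralSheaf.sectionFun a' W' g'
  let r : M → M := fun y => 𝓐.selfBimodule.moment (s y)
  have hs : ContMDiffOn 𝓘(ℝ, E) 𝓘(ℝ, E) ∞ s W' :=
    SpectralSheaf.contMDiffOn_sectionFun hW' ha' hna' g'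
  have hr : ContMDiffOn 𝓘(ℝ, E) 𝓘(ℝ, E) ∞ r W' :=
    𝓐.selfBimodule.contMDiff_moment.comp_contMDiffOn hs
  have hsq : ∀ q : SpectralSheaf 𝕜 E M A, q.pt ∈ W' → q.val = germAt 𝕜 E q.pt a' → s q.pt = q :=
    fun q h1 h2 => SpectralSheaf.sectionFun_pt hW' ha' hna' g' q h1 h2
  let W₂ : Set M := (W' ∩ r ⁻¹' W) ∩ O
  have hW₂ : IsOpen W₂ := (hr.continuousOn.isOpen_inter_preimage hW' hW).inter hO
  have hgW₂ : g'.pt ∈ W₂ := by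
    refine ⟨⟨hgW', ?_⟩, hgO⟩
    change 𝓐.selfBimodule.moment (s g'.pt) ∈ W
    rw [hsq g' hgW' hg', e]
    exact hgW
  have hn₂ : NormalisedOn 𝕜 E (a' * a) W₂ := fun y hy => hnO y hy.2
  refine ⟨SpectralSheaf.basicSet a' W₂ ×ˢ SpectralSheaf.basicSet a W,
    SpectralSheaf.basicSet (a' * a) W₂,
    fun q => (s q.pt, SpectralSheaf.sectionFun a W g (r q.pt)),
    (SpectralSheaf.isOpen_basicSet hW₂ ha' fun y hy => hna' y hy.1.1).prod
      (SpectralSheaf.isOpen_basicSet hW ha hna), ⟨⟨hgW₂, hg'⟩, hgW, hg⟩,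
    SpectralSheaf.isOpen_basicSet hW₂ haa hn₂, ?_, ?_, ?_⟩
  · have hpt : ContMDiffOn 𝓘(ℝ, E) 𝓘(ℝ, E) ∞ (SpectralSheaf.pt : SpectralSheaf 𝕜 E M A → M)
        (SpectralSheaf.basicSet (a' * a) W₂) := SpectralSheaf.contMDiff_pt.contMDiffOn
    refine ContMDiffOn.prodMk (hs.comp hpt fun q hq => hq.1.1.1) ?_
    exact (SpectralSheaf.contMDiffOn_sectionFun hW ha hna g).comp
      (hr.comp hpt fun q hq => hq.1.1.1) fun q hq => hq.1.1.2
  · rintro ⟨⟨q', q⟩, eq⟩ ⟨⟨h1, h2⟩, h3, h4⟩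
    have eq' : 𝓐.selfBimodule.moment q' = q.pt := eq
    have hpt := 𝓐.selfBimodule.sheafLact_pt eq
    refine ⟨⟨?_, 𝓐.selfBimodule.sheafLact_val eq ha' h2 h4⟩, ?_⟩
    · rw [hpt]; exact h1
    · have h5 : s q'.pt = q' := hsq q' h1.1.1 h2
      have h6 : SpectralSheaf.sectionFun a W g (r q'.pt) = q := by
        change SpectralSheaf.sectionFun a W g (𝓐.selfBimodule.moment (s q'.pt)) = q
        rw [h5, eq']
        exact SpectralSheaf.sectionFun_pt hW ha hna g q h3 h4
      change (s (𝓐.selfBimodule.sheafLact q' q eq).pt, _) = (q', q)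
      rw [hpt, h5, h6]
  · rintro y ⟨hy, hyv⟩
    obtain ⟨h1, h2⟩ : (s y.pt).pt = y.pt ∧ (s y.pt).val = germAt 𝕜 E (s y.pt).pt a' :=
      SpectralSheaf.sectionFun_spec hW' ha' hna' g' hy.1.1
    obtain ⟨h3, h4⟩ := SpectralSheaf.sectionFun_spec hW ha hna g (x := r y.pt) hy.1.2
    refine ⟨⟨⟨by rw [h1]; exact hy, h2⟩, ⟨by rw [h3]; exact hy.1.2, h4⟩⟩, h3.symm, ?_⟩
    exact SpectralSheaf.ext_of_val_eq ((𝓐.selfBimodule.sheafLact_pt _).trans h1)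
      (𝓐.selfBimodule.sheafLact_val _ ha' h2 h4) hyv

end Bialgebroid

end SheafActions

/-! ### The spectral groupoid -/

section Groupoid

variable {𝕜 : Type*} [RCLike 𝕜]
  {E : Type*} [NormedAddCommGroup E] [NormedSpace ℝ E] [FiniteDimensional ℝ E]
  {M : Type*} [TopologicalSpace M] [T2Space M] [ChartedSpace E M] [IsManifold 𝓘(ℝ, E) ∞ M]
  {A : Type*} [NonUnitalRing A] [Module 𝕜 A] [IsScalarTower 𝕜 A A] [SMulCommClass 𝕜 A A]
  [Module (CcU 𝕜 E M) A] [IsScalarTower 𝕜 (CcU 𝕜 E M) A] [Coalgebra (CcU 𝕜 E M) A]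

/-- The fibres of a local homeomorphism are discrete. -/
theorem IsLocalHomeomorph.discreteTopology_fiber {X Y : Type*} [TopologicalSpace X]
    [TopologicalSpace Y] {f : X → Y} (hf : IsLocalHomeomorph f) (y : Y) :
    DiscreteTopology (f ⁻¹' {y}) := by
  refine discreteTopology_iff_isOpen_singleton.2 fun p => ?_
  obtain ⟨e, hp, rfl⟩ := hf p
  refine ⟨e.source, e.open_source, ?_⟩
  ext q
  refine ⟨fun hq => Subtype.ext (e.injOn hq hp (q.2.trans p.2.symm)), ?_⟩
  rintro rfl
  exact hp

omit [FiniteDimensional ℝ E] [IsManifold 𝓘(ℝ, E) ∞ M] in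
/-- The extension by `0` of the composition of a compactly supported function with a partial
diffeomorphism is smooth. -/
theorem Cc.exists_comp (τ : OpenPartialHomeomorph M M)
    (hτ : ContMDiffOn 𝓘(ℝ, E) 𝓘(ℝ, E) ∞ τ τ.source) (u : Cc 𝕜 E M)
    (hu : tsupport (u : M → 𝕜) ⊆ τ.target) :
    ∃ u' : Cc 𝕜 E M, EqOn (u' : M → 𝕜) ((u : M → 𝕜) ∘ τ) τ.source ∧
      ∀ x, x ∉ τ.source → (u' : M → 𝕜) x = 0 := by
  classical
  let K := τ.symm '' tsupport (u : M → 𝕜)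
  have hK : IsCompact K := u.2.2.isCompact.image_of_continuousOn (τ.continuousOn_symm.mono hu)
  have hKs : K ⊆ τ.source := by
    rintro _ ⟨y, hy, rfl⟩
    exact τ.map_target (hu hy)
  let f : M → 𝕜 := fun x => if x ∈ τ.source then (u : M → 𝕜) (τ x) else 0
  have hfK : ∀ x, x ∉ K → f x = 0 := fun x hx => by
    by_cases hxs : x ∈ τ.source
    · have : f x = (u : M → 𝕜) (τ x) := if_pos hxs
      rw [this]
      exact image_eq_zero_of_notMem_tsupport fun h => hx ⟨τ x, h, τ.left_inv hxs⟩
    · exact if_neg hxs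
  refine ⟨⟨f, fun x => ?_, HasCompactSupport.intro hK hfK⟩, fun x hx => if_pos hx,
    fun x hx => if_neg hx⟩
  by_cases hx : x ∈ τ.source
  · refine ((u.2.1 _).comp x (hτ.contMDiffAt (τ.open_source.mem_nhds hx))).congr_of_eventuallyEq ?_
    filter_upwards [τ.open_source.mem_nhds hx] with z hz
    exact if_pos hz
  · refine (contMDiffAt_const (c := (0 : 𝕜))).congr_of_eventuallyEq ?_
    filter_upwards [hK.isClosed.isOpen_compl.mem_nhds fun h => hx (hKs h)] with z hz
    exact hfK z hz

namespace HopfAlgebroid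

variable {𝓐 : HopfAlgebroid 𝕜 (Cc 𝕜 E M) A}

theorem IsLocallyGrouplike.exists_sheafInv (h𝓐 : 𝓐.IsLocallyGrouplike)
    (g : SpectralSheaf 𝕜 E M A) :
    ∃ q : SpectralSheaf 𝕜 E M A, q.pt = 𝓐.selfBimodule.moment g ∧ ∀ a : A, 𝓐.SInvariant a →
      g.val = germAt 𝕜 E g.pt a → q.val = germAt 𝕜 E q.pt (𝓐.antipode a) := by
  have key : ∀ a, 𝓐.SInvariant a → g.val = germAt 𝕜 E g.pt a →
      ∃ q : SpectralSheaf 𝕜 E M A, q.pt = 𝓐.selfBimodule.moment g ∧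
        q.val = germAt 𝕜 E q.pt (𝓐.antipode a) ∧ 𝓐.selfBimodule.moment q = g.pt := by
    intro a ha hg
    have hy := (𝓐.selfBimodule.counitFun_eventually_one g hg).self_of_nhds
    have hy0 : counitFun 𝕜 E a g.pt ≠ 0 := by rw [hy]; exact one_ne_zero
    have hs := ha.isSource_antipode hy0 (ha.isSource_sourceMap hy0)
    rw [ha.sourceMap_pt hg, hy] at hs
    refine ⟨⟨𝓐.selfBimodule.moment g, germAt 𝕜 E _ (𝓐.antipode a), 𝓐.selfBimodule.germAt_mem
      ha.antipode.weaklyGrouplike (ha.counitFun_antipode_eventually_one hg)⟩, rfl, rfl, ?_⟩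
    refine 𝓐.selfBimodule.moment_eq rfl fun v => ?_
    have := hs.2 v
    rwa [hs.1, mul_one] at this
  obtain ⟨a, ha, hg⟩ := h𝓐.exists_isGermOf g
  obtain ⟨q, hq1, hq2, hq3⟩ := key a ha hg.2
  refine ⟨q, hq1, fun b hb hgb => ?_⟩
  obtain ⟨q', hq1', hq2', hq3'⟩ := key b hb hgb
  obtain ⟨u, hu, h⟩ := (germAt_eq_iff _ a b).1 (hg.2.symm.trans hgb)
  rw [𝓐.smul_eq, 𝓐.smul_eq] at h
  -- the antipode turns `u a = u b` into `S(a) u = S(b) u`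
  have h1 := congrArg 𝓐.antipode h
  rw [𝓐.antipode_mul, 𝓐.antipode_mul, 𝓐.antipode_incl] at h1
  have h2 : germAt 𝕜 E q.pt (𝓐.antipode a * 𝓐.incl u) = germAt 𝕜 E q.pt (𝓐.antipode a) :=
    𝓐.selfBimodule.germAt_ract_incl ha.antipode.weaklyGrouplike hq2 (by rwa [hq3])
  have h3 : germAt 𝕜 E q'.pt (𝓐.antipode b * 𝓐.incl u) = germAt 𝕜 E q'.pt (𝓐.antipode b) :=
    𝓐.selfBimodule.germAt_ract_incl hb.antipode.weaklyGrouplike hq2' (by rwa [hq3'])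
  rw [hq1', ← hq1] at h3
  rw [hq2, ← h2, h1, h3]

/-- The inverse of an arrow: the germ of `S(a)` at the source of `a_y`. -/
def IsLocallyGrouplike.sheafInv (h𝓐 : 𝓐.IsLocallyGrouplike) (g : SpectralSheaf 𝕜 E M A) :
    SpectralSheaf 𝕜 E M A :=
  (h𝓐.exists_sheafInv g).choose

variable (h𝓐 : 𝓐.IsLocallyGrouplike)

theorem IsLocallyGrouplike.sheafInv_pt (g : SpectralSheaf 𝕜 E M A) :
    (h𝓐.sheafInv g).pt = 𝓐.selfBimodule.moment g :=
  (h𝓐.exists_sheafInv g).choose_spec.1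

theorem IsLocallyGrouplike.sheafInv_val {g : SpectralSheaf 𝕜 E M A} {a : A}
    (ha : 𝓐.SInvariant a) (hg : g.val = germAt 𝕜 E g.pt a) :
    (h𝓐.sheafInv g).val = germAt 𝕜 E (h𝓐.sheafInv g).pt (𝓐.antipode a) :=
  (h𝓐.exists_sheafInv g).choose_spec.2 a ha hg

theorem IsLocallyGrouplike.moment_sheafInv (g : SpectralSheaf 𝕜 E M A) :
    𝓐.selfBimodule.moment (h𝓐.sheafInv g) = g.pt := by
  obtain ⟨a, ha, hg⟩ := h𝓐.exists_isGermOf g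
  have hy := (𝓐.selfBimodule.counitFun_eventually_one g hg.2).self_of_nhds
  have hy0 : counitFun 𝕜 E a g.pt ≠ 0 := by rw [hy]; exact one_ne_zero
  have hs := ha.isSource_antipode hy0 (ha.isSource_sourceMap hy0)
  rw [ha.sourceMap_pt hg.2, hy, ← h𝓐.sheafInv_pt g] at hs
  refine 𝓐.selfBimodule.moment_eq (h𝓐.sheafInv_val ha hg.2) fun v => ?_
  have := hs.2 v
  rwa [hs.1, mul_one] at this

theorem IsLocallyGrouplike.sheafInv_sheafInv (g : SpectralSheaf 𝕜 E M A) :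
    h𝓐.sheafInv (h𝓐.sheafInv g) = g := by
  obtain ⟨a, ha, hg⟩ := h𝓐.exists_isGermOf g
  refine SpectralSheaf.ext_of_val_eq (m := a) ?_ ?_ hg.2
  · rw [h𝓐.sheafInv_pt, h𝓐.moment_sheafInv]
  · have := h𝓐.sheafInv_val ha.antipode (h𝓐.sheafInv_val ha hg.2)
    rwa [𝓐.antipode_antipode] at this

/-- The product of an arrow and its inverse is a unit, since `a S(a') = ε(a)` for
`Δ(a) = a ⊗ a'`. -/
theorem IsLocallyGrouplike.sheafMul_sheafInv (g : SpectralSheaf 𝕜 E M A)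
    (e : 𝓐.selfBimodule.moment g = (h𝓐.sheafInv g).pt) :
    𝓐.selfBimodule.sheafLact g (h𝓐.sheafInv g) e = 𝓐.sheafUnit g.pt := by
  obtain ⟨a, ha, hg⟩ := h𝓐.exists_isGermOf g
  obtain ⟨a', hΔ, hS⟩ := id ha
  obtain ⟨h1, h2⟩ := SInvariant.comul_eq hΔ hS
  have h3 : a' * 𝓐.antipode a = 𝓐.incl (counitR 𝕜 (Cc 𝕜 E M) a) := by
    have := 𝓐.antipode_comul (𝓐.antipode a) (𝓐.antipode a' ⊗ₜ 𝓐.antipode a) hS.symm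
    simpa [𝓐.antipode_antipode] using this
  have h4 := 𝓐.selfBimodule.counitFun_eventually_one g hg.2
  have h5 : germAt 𝕜 E g.pt a' = germAt 𝕜 E g.pt a := by
    have := (𝓐.selfBimodule.counitR_smul_of_comul_eq_tmul hΔ).1
    conv_rhs => rw [← this]
    exact (germAt_inr_smul_of_eventually_one h4 a').symm
  have h6 : germAt 𝕜 E g.pt (a * 𝓐.antipode a) = germAt 𝕜 E g.pt (a' * 𝓐.antipode a) :=
    𝓐.selfBimodule.germAt_lact (𝓐.antipode a) h5.symm
  have hpt := 𝓐.selfBimodule.sheafLact_pt e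
  refine SpectralSheaf.ext_of_val_eq (m := 𝓐.incl (counitR 𝕜 (Cc 𝕜 E M) a)) ?_ ?_ ?_
  · rw [hpt, 𝓐.sheafUnit_pt]
  · rw [𝓐.selfBimodule.sheafLact_val e ha.weaklyGrouplike hg.2 (h𝓐.sheafInv_val ha hg.2), hpt,
      ← h3]
    exact h6
  · exact 𝓐.sheafUnit_val h4

theorem IsLocallyGrouplike.contMDiff_sheafInv :
    ContMDiff 𝓘(ℝ, E) 𝓘(ℝ, E) ∞ h𝓐.sheafInv := by
  intro g
  obtain ⟨a, ha, ⟨W, hW, hgW, hn⟩, hg⟩ := h𝓐.exists_isGermOf g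
  obtain ⟨⟨V, hV, hgV, hnV⟩, -⟩ :=
    𝓐.selfBimodule.isGermOf_iff.2 (h𝓐.sheafInv_val ha hg)
  rw [h𝓐.sheafInv_pt] at hgV
  have hwg := ha.antipode.weaklyGrouplike
  have h1 : ContMDiffAt 𝓘(ℝ, E) 𝓘(ℝ, E) ∞
      (SpectralSheaf.sectionFun (𝓐.antipode a) V g ∘ 𝓐.selfBimodule.moment) g :=
    (SpectralSheaf.contMDiffAt_sectionFun hV hwg hnV g hgV).comp g
      (𝓐.selfBimodule.contMDiff_moment g)
  refine h1.congr_of_eventuallyEq ?_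
  filter_upwards [SpectralSheaf.eventually_mem_basicSet hW ha.weaklyGrouplike hn hgW hg,
    (𝓐.selfBimodule.contMDiff_moment g).continuousAt.eventually (hV.mem_nhds hgV)] with q hq hqV
  have h2 := SpectralSheaf.sectionFun_pt hV hwg hnV g (h𝓐.sheafInv q)
    (by rw [h𝓐.sheafInv_pt]; exact hqV) (h𝓐.sheafInv_val ha hq.2)
  rw [Function.comp_apply, ← h2, h𝓐.sheafInv_pt]

theorem IsLocallyGrouplike.isLocalDiffeomorph_sheafInv :
    IsLocalDiffeomorph 𝓘(ℝ, E) 𝓘(ℝ, E) ∞ h𝓐.sheafInv :=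
  Diffeomorph.isLocalDiffeomorph
    { toFun := h𝓐.sheafInv
      invFun := h𝓐.sheafInv
      left_inv := h𝓐.sheafInv_sheafInv
      right_inv := h𝓐.sheafInv_sheafInv
      contMDiff_toFun := h𝓐.contMDiff_sheafInv
      contMDiff_invFun := h𝓐.contMDiff_sheafInv }

include h𝓐 in
theorem IsLocallyGrouplike.isLocalDiffeomorph_moment :
    IsLocalDiffeomorph 𝓘(ℝ, E) 𝓘(ℝ, E) ∞ 𝓐.selfBimodule.moment := by
  have h : 𝓐.selfBimodule.moment = SpectralSheaf.pt ∘ h𝓐.sheafInv :=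
    funext fun g => (h𝓐.sheafInv_pt g).symm
  intro g
  rw [h]
  exact IsLocalDiffeomorphAt.comp (hf := h𝓐.isLocalDiffeomorph_sheafInv g)
    (hg := SpectralSheaf.isLocalDiffeomorph_pt 𝕜 E M A _)

theorem sheafMul_sheafUnit (𝓐 : Bialgebroid 𝕜 (Cc 𝕜 E M) A) (g : SpectralSheaf 𝕜 E M A)
    (e : 𝓐.selfBimodule.moment g = (𝓐.sheafUnit (𝓐.selfBimodule.moment g)).pt) :
    𝓐.selfBimodule.sheafLact g (𝓐.sheafUnit (𝓐.selfBimodule.moment g)) e = g := by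
  obtain ⟨a, ha, hg⟩ := g.exists_isGermOf
  obtain ⟨u, hu⟩ := Cc.exists_eq_one (𝕜 := 𝕜) (E := E) (𝓐.selfBimodule.moment g)
  have hpt := 𝓐.selfBimodule.sheafLact_pt e
  refine SpectralSheaf.ext_of_val_eq (m := a) hpt ?_ hg.2
  rw [𝓐.selfBimodule.sheafLact_val e ha hg.2 (𝓐.sheafUnit_val hu), hpt]
  exact 𝓐.selfBimodule.germAt_ract_incl ha hg.2 hu

end HopfAlgebroid

section UnitActions

variable {E' : Type*} [NormedAddCommGroup E'] [NormedSpace ℝ E'] [FiniteDimensional ℝ E']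
  {N : Type*} [TopologicalSpace N] [T2Space N] [ChartedSpace E' N] [IsManifold 𝓘(ℝ, E') ∞ N]
  {B : Type*} [NonUnitalRing B] [Module 𝕜 B] [IsScalarTower 𝕜 B B] [SMulCommClass 𝕜 B B]
  [Module (CcU 𝕜 E' N) B] [IsScalarTower 𝕜 (CcU 𝕜 E' N) B] [Coalgebra (CcU 𝕜 E' N) B]
  {X : Type*} [AddCommGroup X] [Module 𝕜 X]
  [Module (CcU 𝕜 E M) X] [IsScalarTower 𝕜 (CcU 𝕜 E M) X] [Coalgebra (CcU 𝕜 E M) X]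
  {𝓐 : Bialgebroid 𝕜 (Cc 𝕜 E M) A} {𝓑 : Bialgebroid 𝕜 (Cc 𝕜 E' N) B}
  (𝓧 : PreprincipalBimodule 𝓐 𝓑 X)

namespace PreprincipalBimodule

omit [FiniteDimensional ℝ E'] [T2Space N] [IsManifold 𝓘(ℝ, E') ∞ N] in
theorem sheafUnit_sheafLact (p : SpectralSheaf 𝕜 E M X)
    (e : 𝓐.selfBimodule.moment (𝓐.sheafUnit p.pt) = p.pt) :
    𝓧.sheafLact (𝓐.sheafUnit p.pt) p e = p := by
  obtain ⟨m, hm, hp⟩ := p.exists_isGermOf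
  obtain ⟨u, hu⟩ := Cc.exists_eq_one (𝕜 := 𝕜) (E := E) p.pt
  have hpt := (𝓧.sheafLact_pt e).trans (𝓐.sheafUnit_pt p.pt)
  refine SpectralSheaf.ext_of_val_eq (m := m) hpt ?_ hp.2
  rw [𝓧.sheafLact_val e (𝓐.weaklyGrouplike_incl u) (𝓐.sheafUnit_val hu) hp.2, hpt, ← 𝓧.smul_eq]
  exact germAt_inr_smul_of_eventually_one hu m

theorem sheafRact_sheafUnit (p : SpectralSheaf 𝕜 E M X)
    (e : 𝓧.moment p = (𝓑.sheafUnit (𝓧.moment p)).pt) :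
    𝓧.sheafRact p (𝓑.sheafUnit (𝓧.moment p)) e = p := by
  obtain ⟨m, hm, hp⟩ := p.exists_isGermOf
  obtain ⟨v, hv⟩ := Cc.exists_eq_one (𝕜 := 𝕜) (E := E') (𝓧.moment p)
  have hpt := 𝓧.sheafRact_pt e
  refine SpectralSheaf.ext_of_val_eq (m := m) hpt ?_ hp.2
  rw [𝓧.sheafRact_val e hm hp.2 (𝓑.sheafUnit_val hv), hpt]
  exact 𝓧.germAt_ract_incl hm hp.2 hv

end PreprincipalBimodule

end UnitActions

namespace HopfAlgebroid

variable {𝓐 : HopfAlgebroid 𝕜 (Cc 𝕜 E M) A}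

/-- The spectral étale groupoid of a locally grouplike Hopf algebroid. -/
def IsLocallyGrouplike.spectralGroupoid (h𝓐 : 𝓐.IsLocallyGrouplike) :
    EtaleLieGroupoid E M (SpectralSheaf 𝕜 E M A) where
  isManifold := inferInstance
  src := 𝓐.selfBimodule.moment
  tgt := SpectralSheaf.pt
  mul g' g e := 𝓐.selfBimodule.sheafLact g' g e
  uni := 𝓐.sheafUnit
  inv := h𝓐.sheafInv
  src_mul g' g e := 𝓐.selfBimodule.moment_sheafLact e
  tgt_mul g' g e := 𝓐.selfBimodule.sheafLact_pt e
  mul_assoc g'' g' g e' e := (𝓐.selfBimodule.sheafLact_sheafLact e e' _ _).symm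
  src_uni := 𝓐.moment_sheafUnit
  tgt_uni := 𝓐.sheafUnit_pt
  uni_mul g := 𝓐.selfBimodule.sheafUnit_sheafLact g _
  mul_uni g := sheafMul_sheafUnit 𝓐.toBialgebroid g _
  src_inv := h𝓐.moment_sheafInv
  tgt_inv := h𝓐.sheafInv_pt
  inv_mul g := by
    have h := h𝓐.sheafMul_sheafInv (h𝓐.sheafInv g)
    simp only [h𝓐.sheafInv_sheafInv, h𝓐.sheafInv_pt] at h
    exact h (h𝓐.moment_sheafInv g)
  mul_inv g := h𝓐.sheafMul_sheafInv g _
  src_etale := h𝓐.isLocalDiffeomorph_moment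
  tgt_etale := SpectralSheaf.isLocalDiffeomorph_pt 𝕜 E M A
  uni_etale := 𝓐.isLocalDiffeomorph_sheafUnit
  inv_etale := h𝓐.isLocalDiffeomorph_sheafInv
  mul_etale := 𝓐.localDiffeo_sheafMul
  t2_fiber x := by
    have := h𝓐.isLocalDiffeomorph_moment.isLocalHomeomorph.discreteTopology_fiber x
    infer_instance

/-- The diffeomorphism `τ` onto `W` defined by an `S`-invariant weakly grouplike element which is
normalised on `W`: the inverse of the source map. -/
theorem SInvariant.exists_diffeo {a : A} (ha : 𝓐.SInvariant a) {W : Set M} (hW : IsOpen W)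
    (hn : NormalisedOn 𝕜 E a W) :
    ∃ τ : OpenPartialHomeomorph M M, τ.target = W ∧
      ContMDiffOn 𝓘(ℝ, E) 𝓘(ℝ, E) ∞ τ τ.source ∧
      ContMDiffOn 𝓘(ℝ, E) 𝓘(ℝ, E) ∞ τ.symm τ.target ∧
      (∀ u u' : Cc 𝕜 E M, tsupport (u : M → 𝕜) ⊆ W →
        EqOn (u' : M → 𝕜) ((u : M → 𝕜) ∘ τ) τ.source →
        (∀ x, x ∉ τ.source → (u' : M → 𝕜) x = 0) → 𝓐.incl u * a = a * 𝓐.incl u') ∧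
      ∀ g : SpectralSheaf 𝕜 E M A, g.pt ∈ W → g.val = germAt 𝕜 E g.pt a →
        𝓐.selfBimodule.moment g = τ.symm g.pt := by
  have hWs : W ⊆ ha.sourceHomeo.source := fun y hy => by
    change counitFun 𝕜 E a y ≠ 0
    rw [𝓐.selfBimodule.normalisedOn_iff.1 hn y hy]
    exact one_ne_zero
  let σ := ha.sourceHomeo.restrOpen W hW
  have hσ : σ.source = W := inter_eq_self_of_subset_right hWs
  have hσt : σ.target ⊆ ha.sourceHomeo.target := fun x hx => hx.1
  refine ⟨σ.symm, hσ, fun x hx => ?_, fun y hy => ?_, fun u u' hu hu' hu0 => ?_,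
    fun g hg hga => (ha.sourceMap_pt hga).symm⟩
  · exact (ha.antipode.contMDiffAt_sourceMap (hσt hx)).contMDiffWithinAt
  · exact (ha.contMDiffAt_sourceMap (hWs (hσ.subset hy))).contMDiffWithinAt
  · obtain ⟨a', hΔ, -⟩ := id ha
    have h1 : a * 𝓐.incl u' = _ := 𝓐.selfBimodule.ract_incl_eq_smul hΔ u'
    have h2 := (𝓐.selfBimodule.counitR_smul_of_comul_eq_tmul hΔ).1
    rw [h1, ← 𝓐.smul_eq]
    -- since `a = ε(a) a'`, it suffices to compare the products of both functions with `ε(a)`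
    conv_lhs => rw [← h2]
    conv_rhs => rw [← h2]
    rw [inr_smul_inr_smul, inr_smul_inr_smul]
    congr 2
    refine Cc.ext fun y => ?_
    have h3 := 𝓐.selfBimodule.counitFun_inr_smul
      (counitR 𝕜 (Cc 𝕜 E M) (𝓐.selfBimodule.ract (𝓐.incl u') a')) a y
    rw [← h1] at h3
    rw [Cc.mul_apply, Cc.mul_apply]
    refine Eq.trans ?_ h3
    change (u : M → 𝕜) y * counitFun 𝕜 E a y = _
    by_cases hy : counitFun 𝕜 E a y = 0
    · rw [h3, hy, mul_zero, mul_zero]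
    · rw [ha.isSource_sourceMap hy u']
      congr 1
      have hl : ha.sourceHomeo.symm (𝓐.sourceMap a y) = y := ha.sourceHomeo.left_inv hy
      by_cases hyW : y ∈ W
      · have h4 : 𝓐.sourceMap a y ∈ σ.symm.source := σ.map_source (hσ.symm ▸ hyW)
        rw [hu' h4]
        exact congrArg (u : M → 𝕜) hl.symm
      · rw [hu0, image_eq_zero_of_notMem_tsupport fun h => hyW (hu h)]
        intro h4
        have h5 := σ.symm.map_source h4
        have h6 : σ.symm (𝓐.sourceMap a y) = y := hl
        rw [h6] at h5
        exact hyW (hσ.subset h5)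

theorem IsLocallyGrouplike.isSpectralGroupoid (h𝓐 : 𝓐.IsLocallyGrouplike) :
    𝓐.IsSpectralGroupoid h𝓐.spectralGroupoid where
  exists_isGermOf := h𝓐.exists_isGermOf
  tgt_eq _ := rfl
  src_eq _ _ ha hW hn := ha.exists_diffeo hW hn
  mul_eq _ _ _ _ e ha' _ hg' hg := 𝓐.selfBimodule.isGermOf_iff.2
    (𝓐.selfBimodule.sheafLact_val e ha'.weaklyGrouplike hg'.2 hg.2)
  uni_eq _ _ hu := 𝓐.selfBimodule.isGermOf_iff.2 (𝓐.sheafUnit_val hu)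
  inv_eq _ _ ha hg := 𝓐.selfBimodule.isGermOf_iff.2 (h𝓐.sheafInv_val ha hg.2)

/-- The source map of a spectral groupoid is the moment map: for `g = a_y`, the relation
`u a = a (u ∘ τ)` shows that no function `u` with `u(y) = 1` and support near `y` separates
`τ(φ(g))` from `y`. -/
theorem IsSpectralGroupoid.src_eq_moment {G : EtaleLieGroupoid E M (SpectralSheaf 𝕜 E M A)}
    (hG : 𝓐.IsSpectralGroupoid G) (g : SpectralSheaf 𝕜 E M A) :
    G.src g = 𝓐.selfBimodule.moment g := by
  obtain ⟨a, ha, ⟨W, hW, hgW, hn⟩, hg⟩ := hG.exists_isGermOf g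
  obtain ⟨τ, hτ, hτs, -, hu, hsrc⟩ := hG.src_eq a W ha hW hn
  rw [hsrc g hgW hg]
  have key : ∀ u : Cc 𝕜 E M, tsupport (u : M → 𝕜) ⊆ W → (u : M → 𝕜) g.pt = 1 →
      𝓐.selfBimodule.moment g ∈ τ.source ∧
        (u : M → 𝕜) (τ (𝓐.selfBimodule.moment g)) = 1 := by
    intro u huW hu1
    obtain ⟨u', h1, h2⟩ := Cc.exists_comp τ hτs u (by rwa [hτ])
    have h3 := congrArg (fun c => counitFun 𝕜 E c g.pt) (hu u u' huW h1 h2)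
    have h4 : counitFun 𝕜 E (a * 𝓐.incl u') g.pt =
        (u' : M → 𝕜) (𝓐.selfBimodule.moment g) := 𝓐.selfBimodule.counitFun_ract_incl hg u'
    simp only [← 𝓐.smul_eq, 𝓐.selfBimodule.counitFun_inr_smul, h4, hu1,
      (𝓐.selfBimodule.counitFun_eventually_one g hg).self_of_nhds, mul_one] at h3
    have h5 : 𝓐.selfBimodule.moment g ∈ τ.source := by
      by_contra h
      rw [h2 _ h] at h3
      exact one_ne_zero h3
    exact ⟨h5, (h1 h5).symm.trans h3.symm⟩
  obtain ⟨u, hu1, huW⟩ := Cc.exists_eventually_one (𝕜 := 𝕜) (E := E) g.pt (hW.mem_nhds hgW)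
  have hs := (key u huW hu1.self_of_nhds).1
  have hτg : τ (𝓐.selfBimodule.moment g) = g.pt := by
    by_contra hne
    obtain ⟨w, hw1, hwW⟩ := Cc.exists_eventually_one (𝕜 := 𝕜) (E := E) g.pt
      (inter_mem (hW.mem_nhds hgW) (isOpen_compl_singleton.mem_nhds (Ne.symm hne)))
    have h1 := (key w (hwW.trans inter_subset_left) hw1.self_of_nhds).2
    rw [image_eq_zero_of_notMem_tsupport fun h => (hwW h).2 rfl] at h1
    exact zero_ne_one h1
  rw [← hτg, τ.left_inv hs]

theorem IsSpectralGroupoid.eq {G G' : EtaleLieGroupoid E M (SpectralSheaf 𝕜 E M A)}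
    (hG : 𝓐.IsSpectralGroupoid G) (hG' : 𝓐.IsSpectralGroupoid G') : G = G' := by
  have hsrc : G.src = G'.src :=
    funext fun g => (hG.src_eq_moment g).trans (hG'.src_eq_moment g).symm
  have htgt : G.tgt = G'.tgt := funext fun g => (hG.tgt_eq g).trans (hG'.tgt_eq g).symm
  have hmul : ∀ g' g (e : G.src g' = G.tgt g) (e' : G'.src g' = G'.tgt g),
      G.mul g' g e = G'.mul g' g e' := by
    intro g' g e e'
    obtain ⟨a', ha', hg'⟩ := hG.exists_isGermOf g'
    obtain ⟨a, ha, hg⟩ := hG.exists_isGermOf g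
    refine SpectralSheaf.ext_of_val_eq ?_ (hG.mul_eq a' a g' g e ha' ha hg' hg).2
      (hG'.mul_eq a' a g' g e' ha' ha hg' hg).2
    rw [← hG.tgt_eq, ← hG'.tgt_eq, G.tgt_mul, G'.tgt_mul, htgt]
  have huni : G.uni = G'.uni := by
    funext x
    obtain ⟨u, hu⟩ := Cc.exists_eq_one (𝕜 := 𝕜) (E := E) x
    refine SpectralSheaf.ext_of_val_eq ?_ (hG.uni_eq x u hu).2 (hG'.uni_eq x u hu).2
    rw [← hG.tgt_eq, ← hG'.tgt_eq, G.tgt_uni, G'.tgt_uni]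
  have hinv : G.inv = G'.inv := by
    funext g
    obtain ⟨a, ha, hg⟩ := hG.exists_isGermOf g
    refine SpectralSheaf.ext_of_val_eq ?_ (hG.inv_eq a g ha hg).2 (hG'.inv_eq a g ha hg).2
    rw [← hG.tgt_eq, ← hG'.tgt_eq, G.tgt_inv, G'.tgt_inv, hsrc]
  clear hG hG'
  cases G
  cases G'
  cases hsrc
  cases htgt
  cases huni
  cases hinv
  congr
  funext g' g e
  exact hmul g' g e e

end HopfAlgebroid

end Groupoid

/-! ### The canonical map of a principal bimodule -/

section Canonical

open TensorProduct (map map₂)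
open Coalgebra (comul)

variable {𝕜 : Type*} [Field 𝕜] {R A R' B : Type*}
  [NonUnitalCommRing R] [Module 𝕜 R] [IsScalarTower 𝕜 R R] [SMulCommClass 𝕜 R R]
  [NonUnitalRing A] [Module 𝕜 A] [IsScalarTower 𝕜 A A] [SMulCommClass 𝕜 A A]
  [Module (Unitization 𝕜 R) A] [IsScalarTower 𝕜 (Unitization 𝕜 R) A]
  [Coalgebra (Unitization 𝕜 R) A]
  [NonUnitalCommRing R'] [Module 𝕜 R'] [IsScalarTower 𝕜 R' R'] [SMulCommClass 𝕜 R' R']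
  [NonUnitalRing B] [Module 𝕜 B] [IsScalarTower 𝕜 B B] [SMulCommClass 𝕜 B B]
  [Module (Unitization 𝕜 R') B] [IsScalarTower 𝕜 (Unitization 𝕜 R') B]
  [Coalgebra (Unitization 𝕜 R') B]
  {𝓐 : Bialgebroid 𝕜 R A} {𝓑 : Bialgebroid 𝕜 R' B} {X : Type*}
  [AddCommGroup X] [Module 𝕜 X] [Module (Unitization 𝕜 R) X]
  [IsScalarTower 𝕜 (Unitization 𝕜 R) X] [Coalgebra (Unitization 𝕜 R) X]

namespace PreprincipalBimodule

variable (𝓧 : PreprincipalBimodule 𝓐 𝓑 X)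

/-- The right multiplication by `b` is linear over the base algebra which acts on the left. -/
def ractLin (b : B) : X →ₗ[Unitization 𝕜 R] X where
  toFun := 𝓧.ract b
  map_add' := map_add _
  map_smul' r m := by
    have h : ∀ n : X, r • n = r.fst • n + (r.snd : Unitization 𝕜 R) • n := fun n => by
      conv_lhs => rw [← Unitization.inl_fst_add_inr_snd_eq r, add_smul]
      rw [← Unitization.algebraMap_eq_inl, algebraMap_smul]
    rw [RingHom.id_apply, h, h, map_add, map_smul, 𝓧.ract_inr_smul]

@[simp]
theorem ractLin_apply (b : B) (m : X) : 𝓧.ractLin b m = 𝓧.ract b m := rfl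

/-- The map `m ↦ m₁ ⊗ m₂ b`, where `Δ(m) = m₁ ⊗ m₂`. -/
def canonical (b : B) : X →ₗ[Unitization 𝕜 R] X ⊗[Unitization 𝕜 R] X :=
  (𝓧.ractLin b).lTensor X ∘ₗ comul

theorem canonical_eq_tmul {m m' : X}
    (h : comul (R := Unitization 𝕜 R) m = m ⊗ₜ[Unitization 𝕜 R] m') (b : B) :
    𝓧.canonical b m = m ⊗ₜ[Unitization 𝕜 R] 𝓧.ract b m' := by
  simp [canonical, h]

theorem toBase_map_ract (b : B) (t : X ⊗[𝕜] X) :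
    toBase 𝕜 R (map LinearMap.id (𝓧.ract b) t) = (𝓧.ractLin b).lTensor X (toBase 𝕜 R t) := by
  induction t with
  | zero => simp
  | tmul x y => simp
  | add s t hs ht => simp only [map_add, hs, ht]

/-- The expression `Δ(m) (v ⊗ b)` in the definition of a principal bimodule is `m₁ ⊗ m₂ b`. -/
theorem toBase_map_ract_ract {m : X} {b : B} {v : R'} (hv : 𝓑.incl v * b = b) {t : X ⊗[𝕜] X}
    (ht : toBase 𝕜 R t = comul m) :
    toBase 𝕜 R (map (𝓧.ract (𝓑.incl v)) (𝓧.ract b) t) = 𝓧.canonical b m := by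
  have h1 : map (𝓧.ract (𝓑.incl v)) (𝓧.ract b) t =
      map LinearMap.id (𝓧.ract b) (map (𝓧.ract (𝓑.incl v)) LinearMap.id t) := by
    rw [← LinearMap.comp_apply, ← TensorProduct.map_comp]
    rfl
  have h2 : map LinearMap.id (𝓧.ract b) (map LinearMap.id (𝓧.ract (𝓑.incl v)) t) =
      map LinearMap.id (𝓧.ract b) t := by
    rw [← LinearMap.comp_apply, ← TensorProduct.map_comp]
    congr 2
    ext n
    rw [LinearMap.comp_apply, ← 𝓧.mul_ract, hv]
  rw [h1, 𝓧.toBase_map_ract, 𝓧.comul_right m v t ht, ← 𝓧.toBase_map_ract, h2,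
    𝓧.toBase_map_ract, ht]
  rfl

theorem IsPrincipal.exists_equiv {𝓧 : PreprincipalBimodule 𝓐 𝓑 X} (h𝓧 : 𝓧.IsPrincipal) :
    ∃ D : 𝓧.TensorB ≃ₗ[𝕜] X ⊗[Unitization 𝕜 R] X, ∀ (m : X) (b : B),
      D (Submodule.Quotient.mk (m ⊗ₜ[𝕜] b)) = 𝓧.canonical b m := by
  obtain ⟨-, D, hD⟩ := h𝓧
  refine ⟨D, fun m b => ?_⟩
  obtain ⟨v, hv⟩ := 𝓑.local_identities {b}
  obtain ⟨t, ht⟩ := toBase_surjective (𝕜 := 𝕜) (R := R) (comul (R := Unitization 𝕜 R) m)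
  have hv := (hv b (by simp)).1
  rw [hD m b v t hv ht, 𝓧.toBase_map_ract_ract hv ht]

end PreprincipalBimodule

end Canonical

/-! ### The fibres of the spectral sheaf of a principal bimodule -/

section Fibres

variable {𝕜 : Type*} [RCLike 𝕜]
  {E : Type*} [NormedAddCommGroup E] [NormedSpace ℝ E]
  {M : Type*} [TopologicalSpace M] [ChartedSpace E M]

/-- The value of a germ at its base point. -/
def germEval (x : M) : SmoothGerm 𝕜 E x →+* 𝕜 :=
  Germ.valueRingHom.comp (SmoothGerm 𝕜 E x).subtype

theorem germEval_algebraMap (x : M) (r : CcU 𝕜 E M) :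
    germEval x (algebraMap (CcU 𝕜 E M) (SmoothGerm 𝕜 E x) r) = r.toFun x := rfl

/-- The functional on a module over `Cc M` which maps `c` to the value at `x` of `l(c_x)`. -/
def fibreFunctional {C : Type*} [AddCommGroup C] [Module 𝕜 C] [Module (CcU 𝕜 E M) C]
    [IsScalarTower 𝕜 (CcU 𝕜 E M) C] {x : M}
    (l : LocalAt 𝕜 E C x →ₗ[SmoothGerm 𝕜 E x] SmoothGerm 𝕜 E x) : C →ₗ[𝕜] 𝕜 where
  toFun c := germEval x (l (germAt 𝕜 E x c))
  map_add' c d := by rw [germAt, TensorProduct.tmul_add, map_add, map_add]; rfl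
  map_smul' k c := by
    rw [← algebraMap_smul (CcU 𝕜 E M) k c, germAt, one_tmul_smul, map_smul, smul_eq_mul, map_mul,
      germEval_algebraMap]
    simp [CcU.toFun, Unitization.algebraMap_eq_inl, germAt]

theorem fibreFunctional_apply {C : Type*} [AddCommGroup C] [Module 𝕜 C] [Module (CcU 𝕜 E M) C]
    [IsScalarTower 𝕜 (CcU 𝕜 E M) C] {x : M}
    (l : LocalAt 𝕜 E C x →ₗ[SmoothGerm 𝕜 E x] SmoothGerm 𝕜 E x) (c : C) :
    fibreFunctional l c = germEval x (l (germAt 𝕜 E x c)) := rfl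

theorem fibreFunctional_inr_smul {C : Type*} [AddCommGroup C] [Module 𝕜 C] [Module (CcU 𝕜 E M) C]
    [IsScalarTower 𝕜 (CcU 𝕜 E M) C] {x : M}
    (l : LocalAt 𝕜 E C x →ₗ[SmoothGerm 𝕜 E x] SmoothGerm 𝕜 E x) (u : Cc 𝕜 E M) (c : C) :
    fibreFunctional l ((u : CcU 𝕜 E M) • c) = (u : M → 𝕜) x * fibreFunctional l c := by
  rw [fibreFunctional_apply, germAt, one_tmul_smul, map_smul, smul_eq_mul, map_mul,
    germEval_algebraMap, CcU.toFun_inr]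
  rfl

/-- The functional on `(C ⊗ C)_x` given by the product of two functionals on `C_x`. -/
def tensorFunctional {C : Type*} [AddCommGroup C]
    [Module (CcU 𝕜 E M) C] {x : M} (f g : LocalAt 𝕜 E C x →ₗ[SmoothGerm 𝕜 E x] SmoothGerm 𝕜 E x) :
    LocalAt 𝕜 E (C ⊗[CcU 𝕜 E M] C) x →ₗ[SmoothGerm 𝕜 E x] SmoothGerm 𝕜 E x :=
  LinearMap.mul' (SmoothGerm 𝕜 E x) (SmoothGerm 𝕜 E x) ∘ₗ TensorProduct.map f g ∘ₗ
    (TensorProduct.AlgebraTensorModule.distribBaseChange (CcU 𝕜 E M)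
      (SmoothGerm 𝕜 E x) C C).toLinearMap

theorem tensorFunctional_germAt_tmul {C : Type*} [AddCommGroup C]
    [Module (CcU 𝕜 E M) C] {x : M}
    (f g : LocalAt 𝕜 E C x →ₗ[SmoothGerm 𝕜 E x] SmoothGerm 𝕜 E x) (c d : C) :
    tensorFunctional f g (germAt 𝕜 E x (c ⊗ₜ[CcU 𝕜 E M] d)) =
      f (germAt 𝕜 E x c) * g (germAt 𝕜 E x d) := by
  refine (congrArg (fun t => LinearMap.mul' (SmoothGerm 𝕜 E x) (SmoothGerm 𝕜 E x)
    (TensorProduct.map f g t)) (distrib_one_tmul c d)).trans ?_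
  rw [TensorProduct.map_tmul, LinearMap.mul'_apply]
  rfl

variable [FiniteDimensional ℝ E] [T2Space M] [IsManifold 𝓘(ℝ, E) ∞ M]
  {E' : Type*} [NormedAddCommGroup E'] [NormedSpace ℝ E'] [FiniteDimensional ℝ E']
  {N : Type*} [TopologicalSpace N] [T2Space N] [ChartedSpace E' N] [IsManifold 𝓘(ℝ, E') ∞ N]
  {A : Type*} [NonUnitalRing A] [Module 𝕜 A] [IsScalarTower 𝕜 A A] [SMulCommClass 𝕜 A A]
  [Module (CcU 𝕜 E M) A] [IsScalarTower 𝕜 (CcU 𝕜 E M) A] [Coalgebra (CcU 𝕜 E M) A]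
  {B : Type*} [NonUnitalRing B] [Module 𝕜 B] [IsScalarTower 𝕜 B B] [SMulCommClass 𝕜 B B]
  [Module (CcU 𝕜 E' N) B] [IsScalarTower 𝕜 (CcU 𝕜 E' N) B] [Coalgebra (CcU 𝕜 E' N) B]
  {X : Type*} [AddCommGroup X] [Module 𝕜 X]
  [Module (CcU 𝕜 E M) X] [IsScalarTower 𝕜 (CcU 𝕜 E M) X] [Coalgebra (CcU 𝕜 E M) X]
  {𝓐 : Bialgebroid 𝕜 (Cc 𝕜 E M) A} {𝓑 : HopfAlgebroid 𝕜 (Cc 𝕜 E' N) B}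
  {𝓧 : PreprincipalBimodule 𝓐 𝓑.toBialgebroid X}

theorem exists_Cc_algebraMap_eq {x : M} (s : SmoothGerm 𝕜 E x) :
    ∃ v : Cc 𝕜 E M, algebraMap (CcU 𝕜 E M) (SmoothGerm 𝕜 E x) v = s := by
  obtain ⟨_, f, hf, rfl⟩ := s
  obtain ⟨v, hv, -⟩ := exists_Cc_eventuallyEq x f univ univ_mem hf
  refine ⟨v, Subtype.ext (Germ.coe_eq.2 ?_)⟩
  filter_upwards [hv] with y hy
  rw [← hy, CcU.toFun_inr]

namespace PreprincipalBimodule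

/-- The germs at `x` of the tensors `m ⊗ n`, where `m_x` and `n_x` are grouplike with
`n_x = m_x · h` for an arrow `h`. -/
def orbitTensors (𝓧 : PreprincipalBimodule 𝓐 𝓑.toBialgebroid X) (x : M) :
    Set (LocalAt 𝕜 E (X ⊗[CcU 𝕜 E M] X) x) :=
  {z | ∃ (p : SpectralSheaf 𝕜 E M X) (h : SpectralSheaf 𝕜 E' N B) (e : 𝓧.moment p = h.pt)
    (m n : X), p.pt = x ∧ p.val = germAt 𝕜 E p.pt m ∧
      (𝓧.sheafRact p h e).val = germAt 𝕜 E (𝓧.sheafRact p h e).pt n ∧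
      z = germAt 𝕜 E x (m ⊗ₜ[CcU 𝕜 E M] n)}

/-- For a grouplike germ `m_x` and any `b`, the germ of `m ⊗ m b` is a combination of tensors
`m ⊗ n` with `n_x` in the orbit of `m_x`: only the germ of `b` at `φ(m_x)` matters, and it is a
combination of arrows. -/
theorem germAt_tmul_ract_mem_span (h𝓑 : 𝓑.IsLocallyGrouplike) {p : SpectralSheaf 𝕜 E M X} {m : X}
    (hm : WeaklyGrouplike (CcU 𝕜 E M) m) (hp : p.val = germAt 𝕜 E p.pt m) (b : B) :
    germAt 𝕜 E p.pt (m ⊗ₜ[CcU 𝕜 E M] 𝓧.ract b m) ∈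
      Submodule.span (SmoothGerm 𝕜 E p.pt) (𝓧.orbitTensors p.pt) := by
  have hcongr : ∀ b c : B,
      germAt 𝕜 E' (𝓧.moment p) b = germAt 𝕜 E' (𝓧.moment p) c →
      germAt 𝕜 E p.pt (m ⊗ₜ[CcU 𝕜 E M] 𝓧.ract b m) =
        germAt 𝕜 E p.pt (m ⊗ₜ[CcU 𝕜 E M] 𝓧.ract c m) := fun b c h =>
    germAt_tmul_congr rfl (𝓧.germAt_ract_congr hm hp h)
  suffices key : ∀ β : LocalAt 𝕜 E' B (𝓧.moment p), ∀ b : B, germAt 𝕜 E' (𝓧.moment p) b = β →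
      germAt 𝕜 E p.pt (m ⊗ₜ[CcU 𝕜 E M] 𝓧.ract b m) ∈
        Submodule.span (SmoothGerm 𝕜 E p.pt) (𝓧.orbitTensors p.pt) from key _ b rfl
  intro β
  have hβ : β ∈ Submodule.span (SmoothGerm 𝕜 E' (𝓧.moment p)) (𝓑.arrowsAt (𝓧.moment p)) := by
    rw [(h𝓑 (𝓧.moment p)).2]
    exact Submodule.mem_top
  induction hβ using Submodule.span_induction with
  | mem β hβ =>
    rintro b rfl
    obtain ⟨c, hc, ⟨W, hW, hz, hn⟩, hbc⟩ := hβ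
    let h : SpectralSheaf 𝕜 E' N B := ⟨𝓧.moment p, germAt 𝕜 E' _ b, by
      rw [hbc]; exact germAt_mem_grouplikeAt hc.weaklyGrouplike hW hz hn⟩
    exact Submodule.subset_span
      ⟨p, h, rfl, m, 𝓧.ract b m, rfl, hp, 𝓧.sheafRact_val rfl hm hp rfl, rfl⟩
  | zero =>
    intro b hb
    rw [hcongr b 0 (hb.trans (TensorProduct.tmul_zero _ _).symm), map_zero, LinearMap.zero_apply,
      TensorProduct.tmul_zero, germAt, TensorProduct.tmul_zero]
    exact Submodule.zero_mem _
  | add β γ _ _ hβ hγ =>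
    intro b hb
    obtain ⟨b₁, rfl⟩ := germAt_surjective _ β
    obtain ⟨b₂, rfl⟩ := germAt_surjective _ γ
    rw [hcongr b (b₁ + b₂) (hb.trans (TensorProduct.tmul_add _ _ _).symm), map_add,
      LinearMap.add_apply, TensorProduct.tmul_add, germAt, TensorProduct.tmul_add]
    exact Submodule.add_mem _ (hβ b₁ rfl) (hγ b₂ rfl)
  | smul s β _ hβ =>
    intro b hb
    obtain ⟨b₁, rfl⟩ := germAt_surjective _ β
    obtain ⟨v, rfl⟩ := exists_Cc_algebraMap_eq s
    obtain ⟨t, ht, -⟩ := 𝓧.exists_ract_incl_eq_smul hm v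
    rw [hcongr b ((v : CcU 𝕜 E' N) • b₁) (hb.trans (one_tmul_smul _ _).symm), 𝓑.smul_eq,
      𝓧.mul_ract, ht, 𝓧.ract_inr_smul, TensorProduct.tmul_smul, germAt, one_tmul_smul]
    exact Submodule.smul_mem _ _ (hβ b₁ rfl)

/-- All values of the canonical map lie, locally at `x`, in the span of the orbit tensors, because
`X_x` is spanned by its grouplike elements. -/
theorem germAt_canonical_mem_span (h𝓑 : 𝓑.IsLocallyGrouplike) (h𝓧 : IsLocallyGrouplike 𝕜 E M X)
    (x : M) (b : B) (m : X) :
    germAt 𝕜 E x (𝓧.canonical b m) ∈ Submodule.span (SmoothGerm 𝕜 E x) (𝓧.orbitTensors x) := by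
  have key : ∀ ξ : LocalAt 𝕜 E X x, (𝓧.canonical b).baseChange (SmoothGerm 𝕜 E x) ξ ∈
      Submodule.span (SmoothGerm 𝕜 E x) (𝓧.orbitTensors x) := by
    intro ξ
    have hξ : ξ ∈ Submodule.span (SmoothGerm 𝕜 E x) (grouplikeAt 𝕜 E X x) := by
      rw [(h𝓧 x).2]
      exact Submodule.mem_top
    induction hξ using Submodule.span_induction with
    | zero => rw [map_zero]; exact Submodule.zero_mem _
    | add ξ η _ _ hξ hη => rw [map_add]; exact Submodule.add_mem _ hξ hη
    | smul s ξ _ hξ => rw [map_smul]; exact Submodule.smul_mem _ _ hξ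
    | mem ξ hξ =>
      let p : SpectralSheaf 𝕜 E M X := ⟨x, ξ, hξ⟩
      obtain ⟨n, ⟨n', hn⟩, hpn⟩ := p.exists_isGermOf
      have hξn : ξ = germAt 𝕜 E x n := hpn.2
      have h1 : germAt 𝕜 E x n' = germAt 𝕜 E x n := by
        have h2 := (𝓧.counitR_smul_of_comul_eq_tmul hn).1
        conv_rhs => rw [← h2]
        exact (germAt_inr_smul_of_eventually_one (𝓧.counitFun_eventually_one p hpn.2) n').symm
      rw [hξn, germAt, LinearMap.baseChange_tmul, 𝓧.canonical_eq_tmul hn]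
      have h2 := germAt_tmul_congr (m := n) rfl (𝓧.germAt_ract b h1)
      rw [germAt] at h2
      rw [h2]
      exact germAt_tmul_ract_mem_span h𝓑 ⟨n', hn⟩ hpn.2 b
  exact key (germAt 𝕜 E x m)

/-- The structure groupoid acts transitively on the fibres of the spectral sheaf: the canonical
map is onto and its values are spanned by orbit tensors, while the tensors of grouplike elements
are linearly independent. -/
theorem IsPrincipal.exists_sheafRact_eq (h : 𝓧.IsPrincipal) (h𝓑 : 𝓑.IsLocallyGrouplike)
    (h𝓧 : IsLocallyGrouplike 𝕜 E M X) (p q : SpectralSheaf 𝕜 E M X) (hpq : p.pt = q.pt) :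
    ∃ (h : SpectralSheaf 𝕜 E' N B) (e : 𝓧.moment p = h.pt), 𝓧.sheafRact p h e = q := by
  classical
  obtain ⟨D, hD⟩ := h.exists_equiv
  obtain ⟨x, ζ, hζ⟩ := p
  obtain ⟨y, η, hη⟩ := q
  obtain rfl : x = y := hpq
  have hspan : ∀ z : X ⊗[CcU 𝕜 E M] X,
      germAt 𝕜 E x z ∈ Submodule.span (SmoothGerm 𝕜 E x) (𝓧.orbitTensors x) := by
    intro z
    obtain ⟨y, rfl⟩ := D.surjective z
    obtain ⟨t, rfl⟩ := Submodule.Quotient.mk_surjective _ y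
    induction t with
    | zero =>
      rw [Submodule.Quotient.mk_zero, map_zero, germAt, TensorProduct.tmul_zero]
      exact Submodule.zero_mem _
    | tmul m b =>
      rw [hD]
      exact germAt_canonical_mem_span h𝓑 h𝓧 x b m
    | add s t hs ht =>
      rw [Submodule.Quotient.mk_add, map_add, germAt, TensorProduct.tmul_add]
      exact Submodule.add_mem _ hs ht
  obtain ⟨m, rfl⟩ := germAt_surjective x ζ
  obtain ⟨n, rfl⟩ := germAt_surjective x η
  let b := (h𝓧 x).basis
  -- the coordinate of `m_x ⊗ n_x` in `(X ⊗ X)_x`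
  let l := tensorFunctional (b.coord ⟨_, hζ⟩) (b.coord ⟨_, hη⟩)
  have hl : ∀ m' n' : X, l (germAt 𝕜 E x (m' ⊗ₜ[CcU 𝕜 E M] n')) =
      b.coord ⟨_, hζ⟩ (germAt 𝕜 E x m') * b.coord ⟨_, hη⟩ (germAt 𝕜 E x n') :=
    tensorFunctional_germAt_tmul _ _
  have hb : ∀ (ξ θ : LocalAt 𝕜 E X x) (hξ : ξ ∈ grouplikeAt 𝕜 E X x)
      (hθ : θ ∈ grouplikeAt 𝕜 E X x), b.coord ⟨ξ, hξ⟩ θ = if θ = ξ then 1 else 0 := by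
    intro ξ θ hξ hθ
    have h1 : b ⟨θ, hθ⟩ = θ := (h𝓧 x).basis_apply _
    conv_lhs => rw [← h1]
    rw [Module.Basis.coord_apply, b.repr_self, Finsupp.single_apply]
    exact if_congr Subtype.ext_iff rfl rfl
  by_contra! hne
  have hzero : ∀ z ∈ Submodule.span (SmoothGerm 𝕜 E x) (𝓧.orbitTensors x), l z = 0 := by
    intro z hz
    induction hz using Submodule.span_induction with
    | zero => exact map_zero _
    | add z w _ _ hz hw => rw [map_add, hz, hw, add_zero]
    | smul s z _ hz => rw [map_smul, hz, smul_zero]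
    | mem z hz =>
      obtain ⟨p, h, e, m', n', hpx, hpm, hn', rfl⟩ := hz
      obtain ⟨x', ζ', hζ'⟩ := p
      obtain rfl : x' = x := hpx
      have hpt := 𝓧.sheafRact_pt e
      have hmem := (𝓧.sheafRact ⟨x', ζ', hζ'⟩ h e).mem
      rw [hn', hpt] at hmem
      have hpm : ζ' = germAt 𝕜 E x' m' := hpm
      subst hpm
      rw [hl, hb _ _ _ hζ', hb _ _ _ hmem]
      by_cases h1 : germAt 𝕜 E x' m' = germAt 𝕜 E x' m
      · by_cases h2 : germAt 𝕜 E x' n' = germAt 𝕜 E x' n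
        · have hp : (⟨x', _, hζ⟩ : SpectralSheaf 𝕜 E M X) = ⟨x', _, hζ'⟩ :=
            SpectralSheaf.ext rfl (heq_of_eq h1.symm)
          have key : ∀ p₁ : SpectralSheaf 𝕜 E M X, p₁ = ⟨x', _, hζ'⟩ →
              ∀ e₁ : 𝓧.moment p₁ = h.pt, (𝓧.sheafRact p₁ h e₁).val =
                germAt 𝕜 E (𝓧.sheafRact p₁ h e₁).pt n' := by
            rintro _ rfl _
            exact hn'
          have e₁ : 𝓧.moment ⟨x', _, hζ⟩ = h.pt := by rw [hp]; exact e
          exact absurd (SpectralSheaf.ext_of_val_eq (q := ⟨x', _, hη⟩) (𝓧.sheafRact_pt e₁)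
            (key _ hp e₁) h2.symm) (hne h e₁)
        · rw [if_neg h2, mul_zero]
      · rw [if_neg h1, zero_mul]
  have h1 := hzero _ (hspan (m ⊗ₜ[CcU 𝕜 E M] n))
  rw [hl, hb _ _ _ hζ, hb _ _ _ hη, if_pos rfl, if_pos rfl, mul_one] at h1
  exact one_ne_zero h1

/-- The structure groupoid acts freely. If `m_x · b_z = m_x · c_z`, then `u m ⊗ b = u m ⊗ c` for a
function `u` with germ `1` at `x`, by the injectivity of the canonical map. The product of the
coordinate of `m_x` and the coordinate of `b_z`, evaluated at `x` and `z = φ(m_x)`, is a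
well-defined functional on the tensor product over `Cc N`, and detects `b_z`. -/
theorem IsPrincipal.sheafRact_injective (h : 𝓧.IsPrincipal) (h𝓑 : 𝓑.IsLocallyGrouplike)
    (h𝓧 : IsLocallyGrouplike 𝕜 E M X) {p : SpectralSheaf 𝕜 E M X} {h₁ h₂ : SpectralSheaf 𝕜 E' N B}
    (e₁ : 𝓧.moment p = h₁.pt) (e₂ : 𝓧.moment p = h₂.pt)
    (heq : 𝓧.sheafRact p h₁ e₁ = 𝓧.sheafRact p h₂ e₂) : h₁ = h₂ := by
  classical
  obtain ⟨D, hD⟩ := h.exists_equiv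
  obtain ⟨m, hm, hp⟩ := p.exists_isGermOf
  obtain ⟨m', hΔ⟩ := id hm
  obtain ⟨b₁, hb₁, hh₁⟩ := h𝓑.exists_isGermOf h₁
  obtain ⟨b₂, hb₂, hh₂⟩ := h𝓑.exists_isGermOf h₂
  have hm' : germAt 𝕜 E p.pt m' = germAt 𝕜 E p.pt m := by
    have h2 := (𝓧.counitR_smul_of_comul_eq_tmul hΔ).1
    conv_rhs => rw [← h2]
    exact (germAt_inr_smul_of_eventually_one (𝓧.counitFun_eventually_one p hp.2) m').symm
  have hmb : germAt 𝕜 E p.pt (𝓧.ract b₁ m') = germAt 𝕜 E p.pt (𝓧.ract b₂ m') := by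
    rw [𝓧.germAt_ract b₁ hm', 𝓧.germAt_ract b₂ hm']
    have h1 := 𝓧.sheafRact_val e₁ hm hp.2 hh₁.2
    have h2 := 𝓧.sheafRact_val e₂ hm hp.2 hh₂.2
    rw [← heq, h1, 𝓧.sheafRact_pt] at h2
    exact h2
  obtain ⟨u, hu, hub⟩ := (germAt_eq_iff p.pt _ _).1 hmb
  have hquot : (Submodule.Quotient.mk (((u : CcU 𝕜 E M) • m) ⊗ₜ[𝕜] b₁) : 𝓧.TensorB) =
      Submodule.Quotient.mk (((u : CcU 𝕜 E M) • m) ⊗ₜ[𝕜] b₂) := by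
    refine D.injective ?_
    rw [hD, hD, map_smul, map_smul, 𝓧.canonical_eq_tmul hΔ, 𝓧.canonical_eq_tmul hΔ,
      ← TensorProduct.tmul_smul, ← TensorProduct.tmul_smul, hub]
  obtain ⟨z, β₁, hβ₁⟩ := h₁
  obtain ⟨z₂, β₂, hβ₂⟩ := h₂
  have e₁ : 𝓧.moment p = z := e₁
  obtain rfl : z = z₂ := e₁.symm.trans e₂
  let b := (h𝓧 p.pt).basis
  let c := (h𝓑 z).basis
  have hβ₁' : β₁ = germAt 𝕜 E' z b₁ := hh₁.2
  have hβ₂' : β₂ = germAt 𝕜 E' z b₂ := hh₂.2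
  have ha₁ : β₁ ∈ 𝓑.arrowsAt z := ⟨b₁, hb₁, hh₁.1, hβ₁'⟩
  have ha₂ : β₂ ∈ 𝓑.arrowsAt z := ⟨b₂, hb₂, hh₂.1, hβ₂'⟩
  let l := fibreFunctional (C := X) (b.coord ⟨p.val, p.mem⟩)
  let k := fibreFunctional (C := B) (c.coord ⟨β₁, ha₁⟩)
  -- the coordinate functional intertwines the right multiplication by `v` with the value `v(φ(p))`
  have hl : ∀ (v : Cc 𝕜 E' N) (n : X), l (𝓧.ract (𝓑.incl v) n) = (v : N → 𝕜) z * l n := by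
    intro v n
    obtain ⟨t, ht, htq⟩ := 𝓧.exists_ract_incl_eq_smul hm v
    have key : b.coord ⟨p.val, p.mem⟩ ∘ₗ
        (𝓧.ractLin (𝓑.incl v)).baseChange (SmoothGerm 𝕜 E p.pt) =
        algebraMap (CcU 𝕜 E M) (SmoothGerm 𝕜 E p.pt) t • b.coord ⟨p.val, p.mem⟩ := by
      refine b.ext fun i => ?_
      obtain ⟨n, hn, hqn⟩ := SpectralSheaf.exists_isGermOf
        (⟨p.pt, i, i.2⟩ : SpectralSheaf 𝕜 E M X)
      have hin : b i = germAt 𝕜 E p.pt n := ((h𝓧 p.pt).basis_apply i).trans hqn.2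
      have hact : ∀ (n : X) (r : Cc 𝕜 E M), 𝓧.ract (𝓑.incl v) n = (r : CcU 𝕜 E M) • n →
          b i = germAt 𝕜 E p.pt n →
          (𝓧.ractLin (𝓑.incl v)).baseChange (SmoothGerm 𝕜 E p.pt) (b i) =
            algebraMap (CcU 𝕜 E M) (SmoothGerm 𝕜 E p.pt) r • b i := by
        intro n r hr hin
        rw [hin, germAt, LinearMap.baseChange_tmul, ractLin_apply, hr, one_tmul_smul]
      rw [LinearMap.comp_apply, LinearMap.smul_apply]
      by_cases hi : i = ⟨p.val, p.mem⟩
      · have him : b i = germAt 𝕜 E p.pt m := by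
          rw [hi, (h𝓧 p.pt).basis_apply]; exact hp.2
        rw [hact m t ht him, map_smul]
      · obtain ⟨r, hr, -⟩ := 𝓧.exists_ract_incl_eq_smul hn v
        rw [hact n r hr hin, map_smul]
        have h0 : b.coord ⟨p.val, p.mem⟩ (b i) = 0 := by
          rw [Module.Basis.coord_apply, b.repr_self, Finsupp.single_eq_of_ne (Ne.symm hi)]
        rw [h0, smul_zero, smul_zero]
    have h1 := congrArg (fun f => germEval p.pt (f (germAt 𝕜 E p.pt n))) key
    simp only [LinearMap.comp_apply, LinearMap.smul_apply, smul_eq_mul, map_mul,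
      germEval_algebraMap, CcU.toFun_inr] at h1
    rw [htq p hp.2, e₁] at h1
    exact h1
  have hk : ∀ (v : Cc 𝕜 E' N) (d : B), k (𝓑.incl v * d) = (v : N → 𝕜) z * k d := by
    intro v d
    rw [← 𝓑.smul_eq]
    exact fibreFunctional_inr_smul _ v d
  let f : X ⊗[𝕜] B →ₗ[𝕜] 𝕜 := LinearMap.mul' 𝕜 𝕜 ∘ₗ TensorProduct.map l k
  have hf : ∀ n d, f (n ⊗ₜ d) = l n * k d := fun n d => by simp [f]
  have hker : Submodule.span 𝕜 {z | ∃ (m : X) (v : Cc 𝕜 E' N) (b : B),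
      z = 𝓧.ract (𝓑.incl v) m ⊗ₜ[𝕜] b - m ⊗ₜ[𝕜] (𝓑.incl v * b)} ≤ LinearMap.ker f := by
    rw [Submodule.span_le]
    rintro _ ⟨n, v, d, rfl⟩
    rw [SetLike.mem_coe, LinearMap.mem_ker, map_sub, hf, hf, hl, hk]
    ring
  have h1 := hker ((Submodule.Quotient.eq _).1 hquot)
  have hlu : l ((u : CcU 𝕜 E M) • m) = 1 := by
    have h3 : germAt 𝕜 E p.pt m = b ⟨p.val, p.mem⟩ := by
      rw [(h𝓧 p.pt).basis_apply]; exact hp.2.symm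
    have h4 : l m = 1 := by
      change germEval p.pt (b.coord _ (germAt 𝕜 E p.pt m)) = 1
      rw [h3, Module.Basis.coord_apply, b.repr_self, Finsupp.single_eq_same, map_one]
    have h5 : l ((u : CcU 𝕜 E M) • m) = (u : M → 𝕜) p.pt * l m := fibreFunctional_inr_smul _ u m
    rw [h5, hu.self_of_nhds, h4, mul_one]
  rw [LinearMap.mem_ker, map_sub, hf, hf, hlu, one_mul, one_mul] at h1
  have hkβ : ∀ (β : LocalAt 𝕜 E' B z) (hβ : β ∈ 𝓑.arrowsAt z) (d : B), β = germAt 𝕜 E' z d →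
      k d = if β = β₁ then 1 else 0 := by
    intro β hβ d hd
    have h3 : c ⟨β, hβ⟩ = germAt 𝕜 E' z d := ((h𝓑 z).basis_apply _).trans hd
    change germEval z (c.coord _ (germAt 𝕜 E' z d)) = _
    rw [← h3, Module.Basis.coord_apply, c.repr_self, Finsupp.single_apply]
    rw [apply_ite (germEval z), map_one, map_zero]
    exact if_congr Subtype.ext_iff rfl rfl
  rw [hkβ β₁ ha₁ b₁ hβ₁', hkβ β₂ ha₂ b₂ hβ₂', if_pos rfl] at h1
  have h2 : β₂ = β₁ := by
    by_contra hne
    rw [if_neg hne, sub_zero] at h1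
    exact one_ne_zero h1
  exact SpectralSheaf.ext rfl (heq_of_eq h2.symm)

end PreprincipalBimodule

end Fibres

/-! ### The principal bundle of a principal bimodule -/

section Bundle

variable {𝕜 : Type*} [RCLike 𝕜]
  {E : Type*} [NormedAddCommGroup E] [NormedSpace ℝ E] [FiniteDimensional ℝ E]
  {M : Type*} [TopologicalSpace M] [T2Space M] [ChartedSpace E M] [IsManifold 𝓘(ℝ, E) ∞ M]
  {E' : Type*} [NormedAddCommGroup E'] [NormedSpace ℝ E'] [FiniteDimensional ℝ E']
  {N : Type*} [TopologicalSpace N] [T2Space N] [ChartedSpace E' N] [IsManifold 𝓘(ℝ, E') ∞ N]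
  {A : Type*} [NonUnitalRing A] [Module 𝕜 A] [IsScalarTower 𝕜 A A] [SMulCommClass 𝕜 A A]
  [Module (CcU 𝕜 E M) A] [IsScalarTower 𝕜 (CcU 𝕜 E M) A] [Coalgebra (CcU 𝕜 E M) A]
  {B : Type*} [NonUnitalRing B] [Module 𝕜 B] [IsScalarTower 𝕜 B B] [SMulCommClass 𝕜 B B]
  [Module (CcU 𝕜 E' N) B] [IsScalarTower 𝕜 (CcU 𝕜 E' N) B] [Coalgebra (CcU 𝕜 E' N) B]
  {X : Type*} [AddCommGroup X] [Module 𝕜 X]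
  [Module (CcU 𝕜 E M) X] [IsScalarTower 𝕜 (CcU 𝕜 E M) X] [Coalgebra (CcU 𝕜 E M) X]

namespace PreprincipalBimodule

section Bialgebroid

variable {𝓐 : Bialgebroid 𝕜 (Cc 𝕜 E M) A} {𝓑 : HopfAlgebroid 𝕜 (Cc 𝕜 E' N) B}
  {𝓧 : PreprincipalBimodule 𝓐 𝓑.toBialgebroid X}

omit [T2Space N] [FiniteDimensional ℝ E'] [IsManifold 𝓘(ℝ, E') ∞ N] in
/-- Since the counit is onto, the localisations of `X` do not vanish, so each of them contains a
grouplike element. -/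
theorem IsPrincipal.pt_surjective (h : 𝓧.IsPrincipal) (h𝓧 : IsLocallyGrouplike 𝕜 E M X) :
    Function.Surjective (SpectralSheaf.pt : SpectralSheaf 𝕜 E M X → M) := by
  intro x
  by_contra hne
  have hempty : grouplikeAt 𝕜 E X x = ∅ :=
    eq_empty_of_forall_notMem fun ζ hζ => hne ⟨⟨x, ζ, hζ⟩, rfl⟩
  obtain ⟨u, hu⟩ := Cc.exists_eq_one (𝕜 := 𝕜) (E := E) x
  obtain ⟨m, hm⟩ := h.1 u
  have hspan := (h𝓧 x).2
  rw [hempty, Submodule.span_empty] at hspan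
  have hzero : germAt 𝕜 E x m = germAt 𝕜 E x 0 := by
    have h1 : ∀ ξ : LocalAt 𝕜 E X x, ξ = 0 := fun ξ =>
      (Submodule.mem_bot _).1 (hspan ▸ Submodule.mem_top)
    rw [h1 (germAt 𝕜 E x m), h1 (germAt 𝕜 E x 0)]
  have h2 := (𝓧.counitFun_eventuallyEq hzero).self_of_nhds
  have h3 : counitFun 𝕜 E m x = 1 := by
    rw [← hu.self_of_nhds, ← hm]
    rfl
  have h4 : counitFun 𝕜 E (0 : X) x = 0 := by
    simp [counitFun, counitR]
  rw [h3, h4] at h2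
  exact one_ne_zero h2

/-- The inverse of `(p, h) ↦ (p, p · h)` is smooth: for `(p', q')` near `(p, p · h)`, the arrow
with `q' = p' · h'` lies on the local section through `h`. -/
theorem IsPrincipal.diffeo_sheafRact (h : 𝓧.IsPrincipal) (h𝓑 : 𝓑.IsLocallyGrouplike)
    (h𝓧 : IsLocallyGrouplike 𝕜 E M X) :
    DiffeoOnSubset (𝓘(ℝ, E).prod 𝓘(ℝ, E')) (𝓘(ℝ, E).prod 𝓘(ℝ, E))
      (S := {q : SpectralSheaf 𝕜 E M X × SpectralSheaf 𝕜 E' N B | 𝓧.moment q.1 = q.2.pt})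
      (T := {q : SpectralSheaf 𝕜 E M X × SpectralSheaf 𝕜 E M X | q.1.pt = q.2.pt})
      (fun q => ⟨(q.1.1, 𝓧.sheafRact q.1.1 q.1.2 q.2), (𝓧.sheafRact_pt q.2).symm⟩) := by
  refine ⟨fun q => ?_, ?_⟩
  · obtain ⟨U, F, hU, hqU, hF, hFq⟩ := 𝓧.smooth_sheafRact q
    exact ⟨U, fun q => (q.1, F q), hU, hqU, contMDiffOn_fst.prodMk hF,
      fun q hq => Prod.ext rfl (hFq q hq)⟩
  · choose d hd hdq using fun q : {q : SpectralSheaf 𝕜 E M X × SpectralSheaf 𝕜 E M X |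
      q.1.pt = q.2.pt} => h.exists_sheafRact_eq h𝓑 h𝓧 q.1.1 q.1.2 q.2
    refine ⟨fun q => ⟨(q.1.1, d q), hd q⟩, fun q => ?_, fun q => ?_, fun q => ?_⟩
    · exact Subtype.ext (Prod.ext rfl (h.sheafRact_injective h𝓑 h𝓧
        (hd ⟨(q.1.1, 𝓧.sheafRact q.1.1 q.1.2 q.2), (𝓧.sheafRact_pt q.2).symm⟩) q.2 (hdq _)))
    · exact Subtype.ext (Prod.ext rfl (hdq q))
    · obtain ⟨⟨p, q⟩, e⟩ := q
      obtain ⟨m, hm, ⟨V, hV, hpV, hnm⟩, hp⟩ := p.exists_isGermOf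
      obtain ⟨b, hb, ⟨W, hW, hdW, hnb⟩, hdb⟩ := (d ⟨(p, q), e⟩).exists_isGermOf
      have hmb := 𝓧.weaklyGrouplike_ract hm hb
      have hdq₀ := hdq ⟨(p, q), e⟩
      have hd₀ := hd ⟨(p, q), e⟩
      have hq : q.IsGermOf (𝓧.ract b m) := by
        have h1 := 𝓧.sheafRact_val hd₀ hm hp hdb
        rw [hdq₀] at h1
        exact 𝓧.isGermOf_iff.2 h1
      obtain ⟨⟨O, hO, hqO, hnO⟩, hqv⟩ := hq
      let s := SpectralSheaf.sectionFun b W (d ⟨(p, q), e⟩)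
      have hs : ContMDiffOn 𝓘(ℝ, E') 𝓘(ℝ, E') ∞ s W :=
        SpectralSheaf.contMDiffOn_sectionFun hW hb hnb _
      refine ⟨(SpectralSheaf.basicSet m V ∩ 𝓧.moment ⁻¹' W) ×ˢ
          SpectralSheaf.basicSet (𝓧.ract b m) O, fun q => (q.1, s (𝓧.moment q.1)),
        ((SpectralSheaf.isOpen_basicSet hV hm hnm).inter
          (hW.preimage 𝓧.contMDiff_moment.continuous)).prod
          (SpectralSheaf.isOpen_basicSet hO hmb hnO),
        ⟨⟨⟨hpV, hp⟩, ?_⟩, ⟨hqO, hqv⟩⟩, ?_, ?_⟩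
      · change 𝓧.moment p ∈ W
        rw [hd₀]
        exact hdW
      · refine contMDiffOn_fst.prodMk (hs.comp
          (𝓧.contMDiff_moment.comp contMDiff_fst).contMDiffOn fun q hq => hq.1.2)
      · rintro ⟨⟨p', q'⟩, e'⟩ ⟨⟨⟨hp'V, hp'⟩, hp'W⟩, ⟨hq'O, hq'⟩⟩
        obtain ⟨h1, h2⟩ : (s (𝓧.moment p')).pt = 𝓧.moment p' ∧
            (s (𝓧.moment p')).val = germAt 𝕜 E' (s (𝓧.moment p')).pt b :=
          SpectralSheaf.sectionFun_spec hW hb hnb _ hp'W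
        refine Prod.ext rfl (h.sheafRact_injective h𝓑 h𝓧 h1.symm (hd ⟨(p', q'), e'⟩) ?_)
        exact (SpectralSheaf.ext_of_val_eq ((𝓧.sheafRact_pt h1.symm).trans e')
          (𝓧.sheafRact_val h1.symm hm hp' h2) hq').trans (hdq ⟨(p', q'), e'⟩).symm

end Bialgebroid

variable {𝓐 : HopfAlgebroid 𝕜 (Cc 𝕜 E M) A} {𝓑 : HopfAlgebroid 𝕜 (Cc 𝕜 E' N) B}
  {𝓧 : PreprincipalBimodule 𝓐.toBialgebroid 𝓑.toBialgebroid X}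

/-- The principal bundle on the spectral sheaf of a principal bimodule. -/
def IsPrincipal.spectralBundle (h : 𝓧.IsPrincipal) (h𝓐 : 𝓐.IsLocallyGrouplike)
    (h𝓑 : 𝓑.IsLocallyGrouplike) (h𝓧 : IsLocallyGrouplike 𝕜 E M X) :
    PrincipalBundle h𝓐.spectralGroupoid h𝓑.spectralGroupoid E (SpectralSheaf 𝕜 E M X) where
  isManifold := inferInstance
  π := SpectralSheaf.pt
  φ := 𝓧.moment
  lact := 𝓧.sheafLact
  ract := 𝓧.sheafRact
  π_surjective := h.pt_surjective h𝓧
  π_submersion := SpectralSheaf.isSubmersion_pt 𝕜 E M X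
  φ_smooth := 𝓧.contMDiff_moment
  lact_smooth := 𝓧.smooth_sheafLact
  ract_smooth := 𝓧.smooth_sheafRact
  π_lact _ _ e := 𝓧.sheafLact_pt e
  uni_lact p := 𝓧.sheafUnit_sheafLact p _
  lact_lact _ _ _ e' e := 𝓧.sheafLact_sheafLact e e' _ _
  φ_ract _ _ e := 𝓧.moment_sheafRact e
  ract_uni p := 𝓧.sheafRact_sheafUnit p _
  ract_ract _ _ _ e e' := 𝓧.sheafRact_sheafRact e e' _ _
  φ_lact _ _ e := 𝓧.moment_sheafLact e
  π_ract _ _ e := 𝓧.sheafRact_pt e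
  lact_ract _ _ _ e e' := 𝓧.sheafLact_sheafRact e e' _ _
  diffeo := h.diffeo_sheafRact h𝓑 h𝓧

theorem IsPrincipal.isSpectralBundle (h : 𝓧.IsPrincipal) (h𝓐 : 𝓐.IsLocallyGrouplike)
    (h𝓑 : 𝓑.IsLocallyGrouplike) (h𝓧 : IsLocallyGrouplike 𝕜 E M X) :
    𝓧.IsSpectralBundle (h.spectralBundle h𝓐 h𝓑 h𝓧) where
  π_eq _ := rfl
  φ_eq _ _ v _ hp := 𝓧.counitFun_ract_incl hp.2 v
  lact_eq _ _ _ _ e ha _ hg hp :=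
    𝓧.isGermOf_iff.2 (𝓧.sheafLact_val e ha.weaklyGrouplike hg.2 hp.2)
  ract_eq _ _ _ _ e _ hm hp hh := 𝓧.isGermOf_iff.2 (𝓧.sheafRact_val e hm hp.2 hh.2)

theorem IsSpectralBundle.eq {G : EtaleLieGroupoid E M (SpectralSheaf 𝕜 E M A)}
    {H : EtaleLieGroupoid E' N (SpectralSheaf 𝕜 E' N B)} (hG : 𝓐.IsSpectralGroupoid G)
    (hH : 𝓑.IsSpectralGroupoid H) {P P' : PrincipalBundle G H E (SpectralSheaf 𝕜 E M X)}
    (hP : 𝓧.IsSpectralBundle P) (hP' : 𝓧.IsSpectralBundle P') : P = P' := by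
  have hπ : P.π = P'.π := funext fun p => (hP.π_eq p).trans (hP'.π_eq p).symm
  have hφ : P.φ = P'.φ := by
    funext p
    obtain ⟨m, hm, hp⟩ := p.exists_isGermOf
    exact Cc.eq_of_forall_apply_eq 𝕜 E' fun v =>
      (hP.φ_eq m p v hm hp).symm.trans (hP'.φ_eq m p v hm hp)
  have hlact : ∀ g p (e : G.src g = P.π p) (e' : G.src g = P'.π p),
      P.lact g p e = P'.lact g p e' := by
    intro g p e e'
    obtain ⟨a, ha, hg⟩ := hG.exists_isGermOf g
    obtain ⟨m, hm, hp⟩ := p.exists_isGermOf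
    refine SpectralSheaf.ext_of_val_eq ?_ (hP.lact_eq a m g p e ha hm hg hp).2
      (hP'.lact_eq a m g p e' ha hm hg hp).2
    rw [← hP.π_eq, ← hP'.π_eq, P.π_lact, P'.π_lact]
  have hract : ∀ p h (e : P.φ p = H.tgt h) (e' : P'.φ p = H.tgt h),
      P.ract p h e = P'.ract p h e' := by
    intro p h e e'
    obtain ⟨b, hb, hh⟩ := hH.exists_isGermOf h
    obtain ⟨m, hm, hp⟩ := p.exists_isGermOf
    refine SpectralSheaf.ext_of_val_eq ?_ (hP.ract_eq b m p h e hb hm hp hh).2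
      (hP'.ract_eq b m p h e' hb hm hp hh).2
    rw [← hP.π_eq, ← hP'.π_eq, P.π_ract, P'.π_ract, hπ]
  clear hP hP'
  cases P
  cases P'
  cases hπ
  cases hφ
  congr
  · funext g p e
    exact hlact g p e e
  · funext p h e
    exact hract p h e e

end PreprincipalBimodule

end Bundle

end SpectralTheory

theorem mainTheorem3
    {𝕜 : Type*} [RCLike 𝕜]
    -- the Hausdorff manifolds `M` and `N`
    {E : Type*} [NormedAddCommGroup E] [NormedSpace ℝ E] [FiniteDimensional ℝ E]
    {M : Type*} [TopologicalSpace M] [T2Space M] [ChartedSpace E M] [IsManifold 𝓘(ℝ, E) ∞ M]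
    {E' : Type*} [NormedAddCommGroup E'] [NormedSpace ℝ E'] [FiniteDimensional ℝ E']
    {N : Type*} [TopologicalSpace N] [T2Space N] [ChartedSpace E' N] [IsManifold 𝓘(ℝ, E') ∞ N]
    -- the locally grouplike Hopf algebroids `(A, M)` and `(B, N)`
    {A : Type*} [NonUnitalRing A] [Module 𝕜 A] [IsScalarTower 𝕜 A A] [SMulCommClass 𝕜 A A]
    [Module (CcU 𝕜 E M) A] [IsScalarTower 𝕜 (CcU 𝕜 E M) A] [Coalgebra (CcU 𝕜 E M) A]
    {B : Type*} [NonUnitalRing B] [Module 𝕜 B] [IsScalarTower 𝕜 B B] [SMulCommClass 𝕜 B B]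
    [Module (CcU 𝕜 E' N) B] [IsScalarTower 𝕜 (CcU 𝕜 E' N) B] [Coalgebra (CcU 𝕜 E' N) B]
    (𝓐 : HopfAlgebroid 𝕜 (Cc 𝕜 E M) A) (h𝓐 : 𝓐.IsLocallyGrouplike)
    (𝓑 : HopfAlgebroid 𝕜 (Cc 𝕜 E' N) B) (h𝓑 : 𝓑.IsLocallyGrouplike)
    -- the locally grouplike principal `A`-`B`-bimodule `X`
    {X : Type*} [AddCommGroup X] [Module 𝕜 X]
    [Module (CcU 𝕜 E M) X] [IsScalarTower 𝕜 (CcU 𝕜 E M) X] [Coalgebra (CcU 𝕜 E M) X]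
    (𝓧 : PreprincipalBimodule 𝓐.toBialgebroid 𝓑.toBialgebroid X)
    (h𝓧 : 𝓧.IsPrincipal) (h𝓧' : IsLocallyGrouplike 𝕜 E M X) :
    -- the spectral étale groupoids of `A` and `B` exist and are unique
    (∃! G : EtaleLieGroupoid E M (SpectralSheaf 𝕜 E M A), 𝓐.IsSpectralGroupoid G) ∧
    (∃! H : EtaleLieGroupoid E' N (SpectralSheaf 𝕜 E' N B), 𝓑.IsSpectralGroupoid H) ∧
    -- the projection of the spectral sheaf of `X` is a local diffeomorphism of manifolds
    IsManifold 𝓘(ℝ, E) ∞ (SpectralSheaf 𝕜 E M X) ∧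
    IsLocalDiffeomorph 𝓘(ℝ, E) 𝓘(ℝ, E) ∞ (SpectralSheaf.pt : SpectralSheaf 𝕜 E M X → M) ∧
    -- the spectral sheaf of `X` is a principal `H`-bundle over `G`
    ∀ (G : EtaleLieGroupoid E M (SpectralSheaf 𝕜 E M A))
      (H : EtaleLieGroupoid E' N (SpectralSheaf 𝕜 E' N B)),
      𝓐.IsSpectralGroupoid G → 𝓑.IsSpectralGroupoid H →
        ∃! P : PrincipalBundle G H E (SpectralSheaf 𝕜 E M X), 𝓧.IsSpectralBundle P := by
  refine ⟨⟨_, h𝓐.isSpectralGroupoid, fun _ hG => hG.eq h𝓐.isSpectralGroupoid⟩,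
    ⟨_, h𝓑.isSpectralGroupoid, fun _ hH => hH.eq h𝓑.isSpectralGroupoid⟩, inferInstance,
    SpectralSheaf.isLocalDiffeomorph_pt 𝕜 E M X, fun G H hG hH => ?_⟩
  obtain rfl := hG.eq h𝓐.isSpectralGroupoid
  obtain rfl := hH.eq h𝓑.isSpectralGroupoid
  exact ⟨_, h𝓧.isSpectralBundle h𝓐 h𝓑 h𝓧', fun _ hP =>
    hP.eq hG hH (h𝓧.isSpectralBundle h𝓐 h𝓑 h𝓧')⟩
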